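/- **Notation.** Let $d\ge 3$, $g_t(x)=(4\pi t)^{-d/2}e^{-|x|^2/(4t)}$ and $e^{t\Delta}a=g_t*a$. Let $F=(F_{j;h,k})(x,t)$ be the kernel of the operator $e^{t\Delta}\mathbb P\nabla\cdot$ (acting on matrix fields), where $\mathbb P=\mathrm{Id}-\nabla\Delta^{-1}\mathrm{div}$ is the Leray projector; that is, $F_{j;h,k}(\cdot,t)$ is the inverse Fourier transform of $2\pi i\,\xi_h e^{-4\pi^2t|\xi|^2}(\delta_{jk}-\xi_j\xi_k/|\xi|^2)$. For a third order tensor $Q$ and a matrix $B$, $Q:B$ is the vector with components $\sum_{h,k}Q_{j;h,k}B_{h,k}$; and $e^{t\Delta}\mathbb P\nabla\cdot w(x)=\int_{\mathbb R^d} F(x-y,t):w(y)\,dy$. Let $\mathfrak F=(\mathfrak F_{j;h,k})$ be the tensor, homogeneous of degree $-d-1$, $$\mathfrak F_{j;h,k}(x)=\frac{\Gamma(\frac{d+2}2)}{\pi^{d/2}}\cdot\frac{(\delta_{jh}x_k+\delta_{hk}x_j+\delta_{kj}x_h)|x|^2-(d+2)x_jx_hx_k}{|x|^{d+4}} .$$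 The space $\dot E^m_1$ consists of the vector fields $f\in C^m(\mathbb R^d\setminus\{0\})$ such that $|x|^{1+|\alpha|}\partial^\alpha f$ is bounded for all $|\alpha|\le m$. The space $X^m_1$ consists of the measurable vector fields $u(x,t)$ on $\mathbb R^d\times(0,\infty)$, of class $C^m$ in $x$ for a.e. $t$, such that $\operatorname{ess\,sup}_{x,t}(\sqrt t+|x|)^{1+|\alpha|}|\partial^\alpha_xu(x,t)|<\infty$ for all $|\alpha|\le m$. **Theorem.** Let $d\ge3$, let $a\in\dot E^3_1$ with $\operatorname{div}a=0$ in the sense of distributions, and let $u\in X^3_1$ be a global solution of the Navier–Stokes equations with datum $a$ in the integral form $$u(t)=e^{t\Delta}a-\int_0^te^{(t-s)\Delta}\mathbb P\nabla\cdot(u\otimes u)(s)\,ds,\qquad t>0 .$$ (i) If $d=3$, there are a constant $C$ and a matrix-valued function $\Lambda(t)=(\Lambda_{h,k}(t))$ with $|\Lambda(t)|\le Ct^{3/2}$ for all $t>0$ such that, for all $t>0$ and all $x$ with $|x|\ge e\sqrt t$, $$\Bigl|u(x,t)-e^{t\Delta}a(x)+t\,e^{t\Delta}\mathbb P\nabla\cdot(a\otimes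 a)(x)+\mathfrak F(x):\Lambda(t)\Bigr|\le C\,t^2|x|^{-5}\log\Bigl(\frac{|x|}{\sqrt t}\Bigr).$$ (ii) If $d\ge4$, there is a constant $C$ such that, for all $t>0$ and all $x$ with $|x|\ge e\sqrt t$, $$\Bigl|u(x,t)-e^{t\Delta}a(x)+t\,e^{t\Delta}\mathbb P\nabla\cdot(a\otimes a)(x)\Bigr|\le C\,t^2|x|^{-5}\log\Bigl(\frac{|x|}{\sqrt t}\Bigr).$$ -/

import Mathlib

open MeasureTheory Set
open scoped FourierTransform ContDiff

noncomputable section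

namespace NSFar

/-- The Euclidean space `ℝ^d`. -/
abbrev Sp (d : ℕ) : Type := EuclideanSpace ℝ (Fin d)

/-- The Kronecker symbol. -/
def kron {d : ℕ} (j k : Fin d) : ℝ := if j = k then 1 else 0

/-- The tensor product of two vectors, `(v ⊗ w)_{h,k} = v_h w_k`. -/
def outer {d : ℕ} (v w : Sp d) : Matrix (Fin d) (Fin d) ℝ :=
  Matrix.of fun h k => v h * w k

/-- The contraction `(Q : B)_j = ∑_{h,k} Q_{j;h,k} B_{h,k}` of a third order tensor with a
second order tensor. -/
def contract {d : ℕ} (Q : Fin d → Fin d → Fin d → ℝ) (B : Matrix (Fin d) (Fin d) ℝ) : Sp d :=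
  WithLp.toLp 2 fun j => ∑ h, ∑ k, Q j h k * B h k

/-- The homogeneous space `Ė^m_θ`: functions of class `C^m` outside the origin such that
`|x|^{θ+|α|} ∂^α f` is bounded for all `|α| ≤ m`. (The operator norm of the `k`-th derivative is
comparable to the maximum of `|∂^α f|` over `|α| = k`.) -/
def MemE {d : ℕ} (m : ℕ) (θ : ℝ) (f : Sp d → Sp d) : Prop :=
  ContDiffOn ℝ m f {0}ᶜ ∧
    ∃ C : ℝ, ∀ k : ℕ, k ≤ m → ∀ x : Sp d, x ≠ 0 →
      ‖x‖ ^ (θ + k) * ‖iteratedFDeriv ℝ k f x‖ ≤ C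

/-- The space-time space `X^m_θ`: measurable functions `u(x,t)` on `ℝ^d × (0,∞)` which are of class
`C^m` in `x` for almost every `t`, with `(√t + |x|)^{θ+|α|} |∂_x^α u(x,t)|` essentially
bounded for all `|α| ≤ m`. (As `∂_x^α u(·,t)` is continuous, the essential supremum in `x` is a
supremum; the bound implies that `u` is locally integrable in time with values in `C^m`.) -/
def MemX {d : ℕ} (m : ℕ) (θ : ℝ) (u : ℝ → Sp d → Sp d) : Prop :=
  AEStronglyMeasurable (fun p : ℝ × Sp d => u p.1 p.2) (volume.restrict (Ioi 0 ×ˢ univ)) ∧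
    ∃ C : ℝ, ∀ᵐ t ∂(volume.restrict (Ioi (0 : ℝ))),
      ContDiff ℝ m (u t) ∧
        ∀ k : ℕ, k ≤ m → ∀ x : Sp d,
          (√t + ‖x‖) ^ (θ + k) * ‖iteratedFDeriv ℝ k (u t) x‖ ≤ C

/-- `div a = 0` in the sense of distributions. -/
def DivFree {d : ℕ} (a : Sp d → Sp d) : Prop :=
  ∀ φ : Sp d → ℝ, ContDiff ℝ ∞ φ → HasCompactSupport φ →
    ∫ x, fderiv ℝ φ x (a x) = 0

/-- The gaussian `g_t(x) = (4πt)^{-d/2} e^{-|x|²/(4t)}`. -/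
def gauss {d : ℕ} (t : ℝ) (x : Sp d) : ℝ :=
  (4 * Real.pi * t) ^ (-(d : ℝ) / 2) * Real.exp (-‖x‖ ^ 2 / (4 * t))

/-- The heat semigroup `e^{tΔ} a = g_t * a`. -/
def heat {d : ℕ} (t : ℝ) (a : Sp d → Sp d) (x : Sp d) : Sp d :=
  ∫ y, gauss t (x - y) • a y

/-- The Fourier multiplier `δ_{jk} - ξ_j ξ_k / |ξ|²` of the Leray projector
`P = Id - ∇ Δ⁻¹ div`. -/
def leraySymbol {d : ℕ} (j k : Fin d) (ξ : Sp d) : ℝ :=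
  kron j k - ξ j * ξ k / ‖ξ‖ ^ 2

/-- The kernel `F_{j;h,k}(x,t)` of the operator `e^{tΔ} P ∇·`, which sends a matrix field `w` to the
vector field with components `∑_{h,k} e^{tΔ} P_{j,k} ∂_h w_{h,k}`: the inverse Fourier transform of
`2πi ξ_h e^{-4π²t|ξ|²} (δ_{jk} - ξ_j ξ_k / |ξ|²)`, which is real valued. -/
def oseenDiv {d : ℕ} (t : ℝ) (x : Sp d) (j h k : Fin d) : ℝ :=
  (𝓕⁻ (fun ξ : Sp d =>
    2 * (Real.pi : ℂ) * Complex.I * (ξ h : ℂ) *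
      ((Real.exp (-(4 * Real.pi ^ 2 * t * ‖ξ‖ ^ 2)) * leraySymbol j k ξ : ℝ) : ℂ)) x).re

/-- The operator `e^{tΔ} P ∇·` applied to the matrix field `w`, i.e. the convolution
`F(·,t) * w`. -/
def heatLerayDiv {d : ℕ} (t : ℝ) (w : Sp d → Matrix (Fin d) (Fin d) ℝ) (x : Sp d) : Sp d :=
  ∫ y, contract (oseenDiv t (x - y)) (w y)

/-- The homogeneous kernel of degree `-d-1`
`𝔉_{j;h,k}(x) = Γ((d+2)/2) π^{-d/2} (σ_{j,h,k}(x)|x|² - (d+2) x_j x_h x_k) / |x|^{d+4}`, with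
`σ_{j,h,k}(x) = δ_{jh} x_k + δ_{hk} x_j + δ_{kj} x_h`. -/
def homKernel {d : ℕ} (x : Sp d) (j h k : Fin d) : ℝ :=
  Real.Gamma (((d : ℝ) + 2) / 2) / Real.pi ^ ((d : ℝ) / 2) *
    (((kron j h * x k + kron h k * x j + kron k j * x h) * ‖x‖ ^ 2
      - ((d : ℝ) + 2) * x j * x h * x k) / ‖x‖ ^ (d + 4))

/-- `u` is a global solution of the Navier–Stokes equations in integral form with datum `a`:
`div a = 0` and `u(t) = e^{tΔ} a - ∫₀ᵗ e^{(t-s)Δ} P ∇·(u ⊗ u)(s) ds` for all `t > 0`. -/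
def IsMildSolution {d : ℕ} (a : Sp d → Sp d) (u : ℝ → Sp d → Sp d) : Prop :=
  DivFree a ∧
    ∀ t : ℝ, 0 < t → ∀ x : Sp d,
      u t x = heat t a x -
        ∫ s in (0 : ℝ)..t, heatLerayDiv (t - s) (fun y => outer (u s y) (u s y)) x

end NSFar

end

open NSFar

/-!
The argument compares `u ⊗ u` with the heat extension of `a ⊗ a`. By the semigroup property
(`FlowBd.integral_oseenDiv_heat`), the convolution of the kernel `F(t-s)` with `e^{sΔ}(a ⊗ a)` does
not depend on `s`, so its integral over `(0,t)` is exactly `t e^{tΔ} P∇·(a ⊗ a)`. The remainder is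
therefore the time integral of `F(t-s)` applied to `defect`, the difference
`D(s) = u ⊗ u - e^{sΔ}(a ⊗ a)`.

The defect is concentrated near the origin. Away from the origin the datum is smooth at the scale
`|x|`, so both `e^{sΔ}a - a` and the Duhamel term are `O(s|x|⁻³)`, whence
`D(s) = O(min(s⁻¹, s|x|⁻⁴))`, with a matching Lipschitz bound (`FlowBd.exists_defect_le`). The class
of functions bounded and Lipschitz at the scale `|x|` around the point `x` is `LocalBd`; it is
stable under products, and it contains `e^{sΔ}w - w` and `F(τ) * w` when the derivatives of `w` obey
homogeneous bounds (`exists_localBd_heat_sub`, `exists_localBd_oseenDiv`).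

Let `R = |x| ≥ e√t`, and split `D(s)` by a cut-off at the scale `R`. In the far part the
singularity of `F` costs one logarithm, `log(R²/(t-s))`, since `D(s)` is only known to be Lipschitz
(`DecayBd.exists_integral_oseenDiv_mul_farPart_le`). In the near part `F(x-y,t-s)` is smooth in `y`.
If `d ≥ 4` it is simply bounded by `R^{-d-1}`, and the integral of `|D(s)|` over the ball of radius
`R` is `O(s R^{d-4})`, up to a logarithm. If `d = 3` the defect is integrable, with mass `O(√s)`,
and replacing `F(x-y,t-s)` by the homogeneous kernel `𝔉(x)` costs again a logarithm
(`DecayBd.exists_integral_oseenDiv_mul_nearPart_sub_le`); the matrix `Λ(t)` is the integral of the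
mass of `D(s)` over `(0,t)`. All the errors at time `s` lie below `timeMajorant`, whose integral
over `(0,t)` is `O(t²R⁻⁵ log(R/√t))`.

All estimates of `F` come from writing it as `δ_{jk} ∂_h g_t + ∫_t^∞ ∂_j∂_h∂_k g_r dr`
(`oseenDiv_eq`), because `|ξ|⁻² e^{-4π²t|ξ|²} = 4π² ∫_t^∞ e^{-4π²r|ξ|²} dr`. Extending the integral
down to time zero gives `𝔉` (`integral_d3G_eq_homKernel`). The derivatives of the Gaussian are all
controlled through `GaussBd`.
-/

namespace NSFar

/-! ### The heat kernel and its derivatives -/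

/-- The first derivative `∂_h g_r` of the Gaussian, in closed form. -/
noncomputable def dG {d : ℕ} (h : Fin d) (r : ℝ) (z : Sp d) : ℝ := -(z h) / (2 * r) * gauss r z

/-- The second derivative `∂_j ∂_h g_r` of the Gaussian, in closed form. -/
noncomputable def d2G {d : ℕ} (j h : Fin d) (r : ℝ) (z : Sp d) : ℝ :=
  (z j * z h / (4 * r ^ 2) - kron j h / (2 * r)) * gauss r z

/-- The third derivative `∂_j ∂_h ∂_k g_r` of the Gaussian, in closed form. -/
noncomputable def d3G {d : ℕ} (j h k : Fin d) (r : ℝ) (z : Sp d) : ℝ :=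
  (-(z j * z h * z k) / (8 * r ^ 3)
    + (kron j h * z k + kron h k * z j + kron k j * z h) / (4 * r ^ 2)) * gauss r z

variable {d : ℕ}

lemma kron_comm (j k : Fin d) : kron j k = kron k j := by
  simp [kron, eq_comm]

lemma abs_kron_le (j k : Fin d) : |kron j k| ≤ 1 := by
  unfold kron; split_ifs <;> simp

lemma abs_apply_le_norm (z : Sp d) (j : Fin d) : |z j| ≤ ‖z‖ := by
  simpa using PiLp.norm_apply_le z j

lemma gauss_pos {r : ℝ} (hr : 0 < r) (z : Sp d) : 0 < gauss r z := by
  unfold gauss; positivity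

lemma gauss_neg (r : ℝ) (z : Sp d) : gauss r (-z) = gauss r z := by
  simp [gauss]

lemma integral_gauss {r : ℝ} (hr : 0 < r) : ∫ z : Sp d, gauss r z = 1 := by
  unfold gauss
  rw [integral_const_mul]
  have h := GaussianFourier.integral_rexp_neg_mul_sq_norm (V := Sp d) (b := 1 / (4 * r))
    (by positivity)
  have e : (fun z : Sp d => Real.exp (-‖z‖ ^ 2 / (4 * r)))
      = fun z => Real.exp (-(1 / (4 * r)) * ‖z‖ ^ 2) := by
    funext z; congr 1; ring
  rw [e, h]
  have : Real.pi / (1 / (4 * r)) = 4 * Real.pi * r := by field_simp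
  rw [this, finrank_euclideanSpace_fin, ← Real.rpow_add (by positivity)]
  have : -(d : ℝ) / 2 + d / 2 = 0 := by ring
  simp [this]

lemma integrable_gauss {r : ℝ} (hr : 0 < r) : Integrable (fun z : Sp d => gauss r z) := by
  by_contra h
  have := integral_gauss (d := d) hr
  rw [integral_undef h] at this
  exact zero_ne_one this

lemma hasFDerivAt_coord (j : Fin d) (z : Sp d) :
    HasFDerivAt (fun z : Sp d => z j) (EuclideanSpace.proj j : Sp d →L[ℝ] ℝ) z :=
  (EuclideanSpace.proj j : Sp d →L[ℝ] ℝ).hasFDerivAt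

lemma hasFDerivAt_gauss (r : ℝ) (z : Sp d) :
    HasFDerivAt (gauss r) ((-(1 / (2 * r)) * gauss r z) • innerSL ℝ z) z := by
  have h1 : HasFDerivAt (fun z : Sp d => ‖z‖ ^ 2) (2 • innerSL ℝ z) z :=
    (hasStrictFDerivAt_norm_sq z).hasFDerivAt
  have h2 := ((h1.const_mul (-(1 / (4 * r)))).exp).const_mul ((4 * Real.pi * r) ^ (-(d : ℝ) / 2))
  have e : gauss r = fun z : Sp d =>
      (4 * Real.pi * r) ^ (-(d : ℝ) / 2) * Real.exp (-(1 / (4 * r)) * ‖z‖ ^ 2) := by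
    funext z; unfold gauss; congr 2; ring
  rw [e]
  refine h2.congr_fderiv ?_
  ext y
  simp
  ring_nf

lemma proj_single (h j : Fin d) :
    (EuclideanSpace.proj j : Sp d →L[ℝ] ℝ) (EuclideanSpace.single h 1) = kron h j := by
  simp [kron, eq_comm]

lemma hasFDerivAt_dG (h : Fin d) (r : ℝ) (z : Sp d) :
    HasFDerivAt (dG h r)
      ((-(z h) / (2 * r)) • ((-(1 / (2 * r)) * gauss r z) • innerSL ℝ z) +
        gauss r z • ((-1 / (2 * r)) • (EuclideanSpace.proj h : Sp d →L[ℝ] ℝ))) z := by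
  refine HasFDerivAt.mul ?_ (hasFDerivAt_gauss r z)
  convert (hasFDerivAt_coord h z).const_mul (-1 / (2 * r)) using 1
  funext y; ring

lemma hasFDerivAt_d2G (j h : Fin d) (r : ℝ) (z : Sp d) :
    HasFDerivAt (d2G j h r)
      ((z j * z h / (4 * r ^ 2) - kron j h / (2 * r)) • ((-(1 / (2 * r)) * gauss r z) • innerSL ℝ z) +
        gauss r z • ((1 / (4 * r ^ 2)) • (z j • (EuclideanSpace.proj h : Sp d →L[ℝ] ℝ)
          + z h • (EuclideanSpace.proj j : Sp d →L[ℝ] ℝ)))) z := by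
  refine HasFDerivAt.mul ?_ (hasFDerivAt_gauss r z)
  have key := (((hasFDerivAt_coord j z).mul (hasFDerivAt_coord h z)).const_mul
    (1 / (4 * r ^ 2))).sub_const (kron j h / (2 * r))
  refine key.congr_of_eventuallyEq (Filter.Eventually.of_forall fun y => ?_)
  simp; ring

lemma hasFDerivAt_d3G (j h k : Fin d) (r : ℝ) (z : Sp d) :
    HasFDerivAt (d3G j h k r)
      ((-(z j * z h * z k) / (8 * r ^ 3)
        + (kron j h * z k + kron h k * z j + kron k j * z h) / (4 * r ^ 2)) •
          ((-(1 / (2 * r)) * gauss r z) • innerSL ℝ z) +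
        gauss r z • ((-1 / (8 * r ^ 3)) • ((z j * z h) • (EuclideanSpace.proj k : Sp d →L[ℝ] ℝ)
          + z k • (z j • (EuclideanSpace.proj h : Sp d →L[ℝ] ℝ)
            + z h • (EuclideanSpace.proj j : Sp d →L[ℝ] ℝ)))
          + (1 / (4 * r ^ 2)) • (kron j h • (EuclideanSpace.proj k : Sp d →L[ℝ] ℝ)
            + kron h k • (EuclideanSpace.proj j : Sp d →L[ℝ] ℝ)
            + kron k j • (EuclideanSpace.proj h : Sp d →L[ℝ] ℝ)))) z := by
  refine HasFDerivAt.mul ?_ (hasFDerivAt_gauss r z)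
  have key := ((((hasFDerivAt_coord j z).mul (hasFDerivAt_coord h z)).mul
    (hasFDerivAt_coord k z)).const_mul (-1 / (8 * r ^ 3))).add
    (((((hasFDerivAt_coord k z).const_mul (kron j h)).add
      ((hasFDerivAt_coord j z).const_mul (kron h k))).add
      ((hasFDerivAt_coord h z).const_mul (kron k j))).const_mul (1 / (4 * r ^ 2)))
  refine key.congr_of_eventuallyEq (Filter.Eventually.of_forall fun y => ?_)
  simp; ring

lemma fderiv_gauss_single (h : Fin d) (r : ℝ) (z : Sp d) :
    fderiv ℝ (gauss r) z (EuclideanSpace.single h 1) = dG h r z := by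
  rw [(hasFDerivAt_gauss r z).fderiv]
  simp [dG, EuclideanSpace.inner_single_right]
  ring

lemma fderiv_dG_single (j h : Fin d) (r : ℝ) (z : Sp d) :
    fderiv ℝ (dG h r) z (EuclideanSpace.single j 1) = d2G j h r z := by
  rw [(hasFDerivAt_dG h r z).fderiv]
  simp only [add_apply, smul_apply, proj_single, smul_eq_mul, innerSL_apply_apply]
  simp [d2G, EuclideanSpace.inner_single_right]
  ring

lemma fderiv_d2G_single (j h k : Fin d) (r : ℝ) (z : Sp d) :
    fderiv ℝ (d2G h k r) z (EuclideanSpace.single j 1) = d3G j h k r z := by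
  rw [(hasFDerivAt_d2G h k r z).fderiv]
  simp only [add_apply, smul_apply, proj_single, smul_eq_mul, innerSL_apply_apply]
  simp [d3G, EuclideanSpace.inner_single_right, kron_comm k j]
  ring

lemma continuous_gauss (r : ℝ) : Continuous (gauss r : Sp d → ℝ) := by
  unfold gauss; fun_prop

lemma continuous_dG (h : Fin d) (r : ℝ) : Continuous (dG h r) :=
  continuous_iff_continuousAt.2 fun z => (hasFDerivAt_dG h r z).continuousAt

lemma continuous_d2G (j h : Fin d) (r : ℝ) : Continuous (d2G j h r) :=
  continuous_iff_continuousAt.2 fun z => (hasFDerivAt_d2G j h r z).continuousAt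

lemma continuous_d3G (j h k : Fin d) (r : ℝ) : Continuous (d3G j h k r) :=
  continuous_iff_continuousAt.2 fun z => (hasFDerivAt_d3G j h k r z).continuousAt

lemma measurable_gauss : Measurable fun p : ℝ × Sp d => gauss p.1 p.2 := by
  unfold gauss; fun_prop

lemma measurable_d3G (j h k : Fin d) : Measurable fun p : ℝ × Sp d => d3G j h k p.1 p.2 := by
  unfold d3G
  refine Measurable.mul ?_ measurable_gauss
  fun_prop

/-! ### Pointwise bounds for the heat kernel -/

/-- Powers of `|z|/√r` are absorbed by doubling the time of the Gaussian. -/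
lemma exists_pow_mul_gauss_le (d k : ℕ) : ∃ C : ℝ, 0 ≤ C ∧ ∀ r : ℝ, 0 < r → ∀ z : Sp d,
    ‖z‖ ^ k * gauss r z ≤ C * √r ^ k * gauss (2 * r) z := by
  refine ⟨k.factorial * Real.exp 2 * 2 ^ ((d : ℝ) / 2), by positivity, fun r hr z => ?_⟩
  set u := ‖z‖ / √r with hu
  have hs : 0 < √r := Real.sqrt_pos.2 hr
  have hsq : √r ^ 2 = r := Real.sq_sqrt hr.le
  have hu0 : 0 ≤ u := by positivity
  have hz : ‖z‖ = u * √r := by rw [hu]; field_simp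
  have h1 : u ^ k ≤ k.factorial * Real.exp u := by
    have := Real.pow_div_factorial_le_exp u hu0 k
    rw [div_le_iff₀ (by positivity)] at this
    linarith
  have h2 : Real.exp u ≤ Real.exp 2 * Real.exp (u ^ 2 / 8) := by
    rw [← Real.exp_add, Real.exp_le_exp]; nlinarith [sq_nonneg (u - 4)]
  have h3 : gauss r z * Real.exp (u ^ 2 / 8) = 2 ^ ((d : ℝ) / 2) * gauss (2 * r) z := by
    have e1 : u ^ 2 = ‖z‖ ^ 2 / r := by rw [hu, div_pow, hsq]
    have e2 : 4 * Real.pi * (2 * r) = 2 * (4 * Real.pi * r) := by ring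
    unfold gauss
    have e3 : (2 : ℝ) ^ ((d : ℝ) / 2) * 2 ^ (-(d : ℝ) / 2) = 1 := by
      rw [← Real.rpow_add (by norm_num)]
      simp [neg_div]
    have e4 : -‖z‖ ^ 2 / (4 * r) + ‖z‖ ^ 2 / r / 8 = -‖z‖ ^ 2 / (4 * (2 * r)) := by
      field_simp; ring
    rw [e2, Real.mul_rpow (x := 2) (y := 4 * Real.pi * r) (by norm_num) (by positivity),
      mul_assoc, ← Real.exp_add, e1, e4]
    linear_combination (-(4 * Real.pi * r) ^ (-(d : ℝ) / 2) *
      Real.exp (-‖z‖ ^ 2 / (4 * (2 * r)))) * e3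
  calc ‖z‖ ^ k * gauss r z = u ^ k * (√r ^ k * gauss r z) := by rw [hz]; ring
    _ ≤ (k.factorial * (Real.exp 2 * Real.exp (u ^ 2 / 8))) * (√r ^ k * gauss r z) := by
        have := gauss_pos hr z
        gcongr
        exact h1.trans (by gcongr)
    _ = (k.factorial * Real.exp 2) * √r ^ k * (gauss r z * Real.exp (u ^ 2 / 8)) := by ring
    _ = _ := by rw [h3]; ring

lemma gauss_le {r : ℝ} (hr : 0 < r) (z : Sp d) : gauss r z ≤ (√r)⁻¹ ^ d := by
  have h1 : Real.exp (-‖z‖ ^ 2 / (4 * r)) ≤ 1 := by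
    rw [Real.exp_le_one_iff, neg_div]; simp; positivity
  have h2 : (4 * Real.pi * r) ^ (-(d : ℝ) / 2) ≤ r ^ (-(d : ℝ) / 2) := by
    apply Real.rpow_le_rpow_of_nonpos hr
    · nlinarith [Real.pi_gt_three]
    · rw [neg_div]; simp; positivity
  have h3 : r ^ (-(d : ℝ) / 2) = (√r)⁻¹ ^ d := by
    rw [Real.sqrt_eq_rpow, ← Real.rpow_neg hr.le, ← Real.rpow_natCast, ← Real.rpow_mul hr.le]
    congr 1; ring
  rw [← h3]
  unfold gauss
  calc _ ≤ r ^ (-(d : ℝ) / 2) * 1 := by gcongr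
    _ = _ := mul_one _

/-- Gaussian decay, in the form of arbitrarily high algebraic decay. -/
lemma exists_gauss_le_pow (d N : ℕ) : ∃ C : ℝ, 0 ≤ C ∧ ∀ r : ℝ, 0 < r → ∀ z : Sp d, z ≠ 0 →
    gauss r z ≤ C * √r ^ N * ‖z‖⁻¹ ^ (d + N) := by
  obtain ⟨C, hC, h⟩ := exists_pow_mul_gauss_le d (d + N)
  refine ⟨C, hC, fun r hr z hz => ?_⟩
  have hz' : 0 < ‖z‖ := norm_pos_iff.2 hz
  have hs : 0 < √r := Real.sqrt_pos.2 hr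
  have h1 := h r hr z
  have h2 := gauss_le (by positivity : 0 < 2 * r) z
  have h3 : (√(2 * r))⁻¹ ^ d ≤ (√r)⁻¹ ^ d := by
    gcongr; linarith
  calc gauss r z = ‖z‖⁻¹ ^ (d + N) * (‖z‖ ^ (d + N) * gauss r z) := by
        rw [← mul_assoc, ← mul_pow, inv_mul_cancel₀ hz'.ne', one_pow, one_mul]
    _ ≤ ‖z‖⁻¹ ^ (d + N) * (C * √r ^ (d + N) * (√r)⁻¹ ^ d) := by
        refine mul_le_mul_of_nonneg_left (h1.trans ?_) (by positivity)
        exact mul_le_mul_of_nonneg_left (h2.trans h3) (by positivity)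
    _ = ‖z‖⁻¹ ^ (d + N) * (C * √r ^ N * (√r * (√r)⁻¹) ^ d) := by rw [mul_pow]; ring
    _ = _ := by rw [mul_inv_cancel₀ hs.ne', one_pow]; ring

/-! ### Integration in time -/

lemma sqrt_inv_pow_eq_rpow {r : ℝ} (hr : 0 < r) (p : ℕ) : (√r)⁻¹ ^ p = r ^ (-(p : ℝ) / 2) := by
  rw [Real.sqrt_eq_rpow, ← Real.rpow_neg hr.le, ← Real.rpow_natCast, ← Real.rpow_mul hr.le]
  congr 1; ring

lemma integrableOn_time_near {p : ℕ} (hp : p < 2) {ρ : ℝ} (hρ : 0 < ρ) :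
    IntegrableOn (fun r => (ρ / √r) ^ p) (Ioc 0 (ρ ^ 2)) ∧
      ∫ r in Ioc 0 (ρ ^ 2), (ρ / √r) ^ p = (1 - (p : ℝ) / 2)⁻¹ * ρ ^ 2 := by
  have hp' : (p : ℝ) < 2 := by exact_mod_cast hp
  have e : EqOn (fun r => ρ ^ p * r ^ (-(p : ℝ) / 2)) (fun r => (ρ / √r) ^ p) (Ioc 0 (ρ ^ 2)) := by
    intro r hr
    change ρ ^ p * r ^ (-(p : ℝ) / 2) = (ρ / √r) ^ p
    rw [← sqrt_inv_pow_eq_rpow hr.1, ← mul_pow, ← div_eq_mul_inv]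
  have hi : IntervalIntegrable (fun r : ℝ => r ^ (-(p : ℝ) / 2)) volume 0 (ρ ^ 2) :=
    intervalIntegral.intervalIntegrable_rpow' (by linarith)
  have hI : IntegrableOn (fun r : ℝ => r ^ (-(p : ℝ) / 2)) (Ioc 0 (ρ ^ 2)) := by
    rwa [intervalIntegrable_iff_integrableOn_Ioc_of_le (by positivity)] at hi
  refine ⟨(integrableOn_congr_fun e measurableSet_Ioc).1 (hI.const_mul _), ?_⟩
  rw [← setIntegral_congr_fun measurableSet_Ioc e, integral_const_mul,
    ← intervalIntegral.integral_of_le (by positivity), integral_rpow (Or.inl (by linarith))]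
  have h1 : -(p : ℝ) / 2 + 1 ≠ 0 := by linarith
  have h2 : (ρ ^ 2) ^ (-(p : ℝ) / 2 + 1) = ρ ^ 2 / ρ ^ p := by
    rw [← Real.rpow_natCast ρ 2, ← Real.rpow_mul hρ.le, ← Real.rpow_natCast ρ p,
      ← Real.rpow_sub hρ]
    congr 1; push_cast; ring
  rw [Real.zero_rpow h1, h2, sub_zero]
  have h3 : 1 - (p : ℝ) / 2 = -(p : ℝ) / 2 + 1 := by ring
  rw [h3]
  field_simp

lemma integrableOn_time_far {q : ℕ} (hq : 2 < q) {ρ : ℝ} (hρ : 0 < ρ) :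
    IntegrableOn (fun r => (ρ / √r) ^ q) (Ioi (ρ ^ 2)) ∧
      ∫ r in Ioi (ρ ^ 2), (ρ / √r) ^ q = ((q : ℝ) / 2 - 1)⁻¹ * ρ ^ 2 := by
  have hq' : (2 : ℝ) < q := by exact_mod_cast hq
  have hρ2 : 0 < ρ ^ 2 := by positivity
  have e : EqOn (fun r => ρ ^ q * r ^ (-(q : ℝ) / 2)) (fun r => (ρ / √r) ^ q) (Ioi (ρ ^ 2)) := by
    intro r hr
    change ρ ^ q * r ^ (-(q : ℝ) / 2) = (ρ / √r) ^ q
    rw [← sqrt_inv_pow_eq_rpow (hρ2.trans hr), ← mul_pow, ← div_eq_mul_inv]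
  refine ⟨(integrableOn_congr_fun e measurableSet_Ioi).1
    ((integrableOn_Ioi_rpow_of_lt (by linarith) hρ2).const_mul _), ?_⟩
  rw [← setIntegral_congr_fun measurableSet_Ioi e, integral_const_mul,
    integral_Ioi_rpow_of_lt (by linarith) hρ2]
  have h2 : (ρ ^ 2) ^ (-(q : ℝ) / 2 + 1) = ρ ^ 2 / ρ ^ q := by
    rw [← Real.rpow_natCast ρ 2, ← Real.rpow_mul hρ.le, ← Real.rpow_natCast ρ q,
      ← Real.rpow_sub hρ]
    congr 1; push_cast; ring
  rw [h2]
  have h1 : (q : ℝ) / 2 - 1 ≠ 0 := by linarith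
  have h3 : -(q : ℝ) / 2 + 1 = -((q : ℝ) / 2 - 1) := by ring
  rw [h3]
  field_simp

/-- A function of time below both `A (ρ/√r)^p` with `p < 2` and `A (ρ/√r)^q` with `q > 2` has
integral at most a constant times `A ρ²`: the times before and after `ρ²` contribute alike. -/
lemma exists_time_integral_le {p q : ℕ} (hp : p < 2) (hq : 2 < q) : ∃ C : ℝ, 0 ≤ C ∧
    ∀ ρ : ℝ, 0 < ρ → ∀ τ : ℝ, 0 ≤ τ → ∀ A : ℝ, ∀ f : ℝ → ℝ,
      (∀ r, 0 < r → |f r| ≤ A * (ρ / √r) ^ p) → (∀ r, 0 < r → |f r| ≤ A * (ρ / √r) ^ q) →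
      |∫ r in Ioi τ, f r| ≤ C * (A * ρ ^ 2) ∧
        (AEStronglyMeasurable f (volume.restrict (Ioi τ)) → IntegrableOn f (Ioi τ)) := by
  have hp' : (p : ℝ) < 2 := by exact_mod_cast hp
  have hq' : (2 : ℝ) < q := by exact_mod_cast hq
  have hC : 0 ≤ (1 - (p : ℝ) / 2)⁻¹ + ((q : ℝ) / 2 - 1)⁻¹ :=
    add_nonneg (inv_nonneg.2 (by linarith)) (inv_nonneg.2 (by linarith))
  refine ⟨_, hC, fun ρ hρ τ hτ A f h1 h2 => ?_⟩
  obtain ⟨i1, v1⟩ := integrableOn_time_near hp hρ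
  obtain ⟨i2, v2⟩ := integrableOn_time_far hq hρ
  set m : ℝ → ℝ := fun r => A * (if r ≤ ρ ^ 2 then (ρ / √r) ^ p else (ρ / √r) ^ q) with hm
  have hA : 0 ≤ A := by
    have := (abs_nonneg _).trans (h1 1 one_pos)
    have h' : 0 < (ρ / √1) ^ p := by positivity
    exact nonneg_of_mul_nonneg_left this h'
  have m1 : EqOn (fun r => A * (ρ / √r) ^ p) m (Ioc 0 (ρ ^ 2)) := fun r hr => by
    simp only [hm, if_pos hr.2]
  have m2 : EqOn (fun r => A * (ρ / √r) ^ q) m (Ioi (ρ ^ 2)) := fun r hr => by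
    simp only [hm, if_neg (not_le.2 (mem_Ioi.1 hr))]
  have j1 : IntegrableOn m (Ioc 0 (ρ ^ 2)) :=
    (integrableOn_congr_fun m1 measurableSet_Ioc).1 (i1.const_mul A)
  have j2 : IntegrableOn m (Ioi (ρ ^ 2)) :=
    (integrableOn_congr_fun m2 measurableSet_Ioi).1 (i2.const_mul A)
  have hU : Ioc 0 (ρ ^ 2) ∪ Ioi (ρ ^ 2) = Ioi 0 := Ioc_union_Ioi_eq_Ioi (by positivity)
  have j : IntegrableOn m (Ioi 0) := hU ▸ j1.union j2
  have v : ∫ r in Ioi 0, m r = ((1 - (p : ℝ) / 2)⁻¹ + ((q : ℝ) / 2 - 1)⁻¹) * (A * ρ ^ 2) := by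
    rw [← hU, setIntegral_union (Ioc_disjoint_Ioi le_rfl) measurableSet_Ioi j1 j2,
      ← setIntegral_congr_fun measurableSet_Ioc m1, ← setIntegral_congr_fun measurableSet_Ioi m2,
      integral_const_mul, integral_const_mul, v1, v2]
    ring
  have hfm : ∀ r ∈ Ioi τ, ‖f r‖ ≤ m r := by
    intro r hr
    have hr0 : 0 < r := hτ.trans_lt hr
    simp only [hm, Real.norm_eq_abs]
    split_ifs
    · exact h1 r hr0
    · exact h2 r hr0
  have jτ : IntegrableOn m (Ioi τ) := j.mono_set (Ioi_subset_Ioi hτ)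
  constructor
  · rw [← v, ← Real.norm_eq_abs]
    refine (norm_integral_le_of_norm_le jτ (ae_restrict_of_forall_mem measurableSet_Ioi hfm)).trans ?_
    refine setIntegral_mono_set j ?_ (Ioi_subset_Ioi hτ).eventuallyLE
    refine ae_restrict_of_forall_mem measurableSet_Ioi fun r hr => ?_
    simp only [hm, Pi.zero_apply]
    have := Real.sqrt_pos.2 (mem_Ioi.1 hr)
    split_ifs <;> positivity
  · exact fun hf => jτ.mono' hf (ae_restrict_of_forall_mem measurableSet_Ioi hfm)

/-- The borderline case of `exists_time_integral_le`: a decay `r⁻¹` near the initial time `τ`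
costs a logarithm. -/
lemma exists_time_integral_log_le : ∃ C : ℝ, 0 ≤ C ∧
    ∀ ρ : ℝ, 0 < ρ → ∀ τ : ℝ, 0 < τ → ∀ A : ℝ, ∀ f : ℝ → ℝ,
      (∀ r, 0 < r → |f r| ≤ A * (ρ / √r) ^ 2) → (∀ r, 0 < r → |f r| ≤ A * (ρ / √r) ^ 3) →
      |∫ r in Ioi τ, f r| ≤ C * (A * ρ ^ 2) * (1 + Real.log (1 + ρ ^ 2 / τ)) := by
  refine ⟨2, by norm_num, fun ρ hρ τ hτ A f h1 h2 => ?_⟩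
  obtain ⟨i2, v2⟩ := integrableOn_time_far (q := 3) (by norm_num) hρ
  have hρ2 : 0 < ρ ^ 2 := by positivity
  have hA : 0 ≤ A := by
    have := (abs_nonneg _).trans (h1 1 one_pos)
    have h' : 0 < (ρ / √1) ^ 2 := by positivity
    exact nonneg_of_mul_nonneg_left this h'
  set T := max τ (ρ ^ 2) with hT
  have hτT : τ ≤ T := le_max_left _ _
  set m : ℝ → ℝ := fun r => A * (if r ≤ T then ρ ^ 2 * r⁻¹ else (ρ / √r) ^ 3) with hm
  have m1 : EqOn (fun r => A * (ρ ^ 2 * r⁻¹)) m (Ioc τ T) := fun r hr => by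
    simp only [hm, if_pos hr.2]
  have m2 : EqOn (fun r => A * (ρ / √r) ^ 3) m (Ioi T) := fun r hr => by
    simp only [hm, if_neg (not_le.2 (mem_Ioi.1 hr))]
  have hi : IntervalIntegrable (fun r : ℝ => r⁻¹) volume τ T :=
    intervalIntegral.intervalIntegrable_inv (fun r hr => by
      rw [uIcc_of_le hτT] at hr; exact (hτ.trans_le hr.1).ne') continuousOn_id
  have hI : IntegrableOn (fun r : ℝ => r⁻¹) (Ioc τ T) := by
    rwa [intervalIntegrable_iff_integrableOn_Ioc_of_le hτT] at hi
  have j1 : IntegrableOn m (Ioc τ T) :=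
    (integrableOn_congr_fun m1 measurableSet_Ioc).1 ((hI.const_mul _).const_mul A)
  have hsub : Ioi T ⊆ Ioi (ρ ^ 2) := Ioi_subset_Ioi (le_max_right _ _)
  have i3 := i2.mono_set hsub
  have j2 : IntegrableOn m (Ioi T) :=
    (integrableOn_congr_fun m2 measurableSet_Ioi).1 (i3.const_mul A)
  have hU : Ioc τ T ∪ Ioi T = Ioi τ := Ioc_union_Ioi_eq_Ioi hτT
  have j : IntegrableOn m (Ioi τ) := hU ▸ j1.union j2
  have hfm : ∀ r ∈ Ioi τ, ‖f r‖ ≤ m r := by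
    intro r hr
    have hr0 : 0 < r := hτ.trans hr
    simp only [hm, Real.norm_eq_abs]
    split_ifs
    · refine (h1 r hr0).trans_eq ?_
      rw [div_pow, Real.sq_sqrt hr0.le]; ring
    · exact h2 r hr0
  have hlog : Real.log (T / τ) ≤ Real.log (1 + ρ ^ 2 / τ) := by
    apply Real.log_le_log (by positivity)
    rw [hT, div_le_iff₀ hτ, add_mul, div_mul_cancel₀ _ hτ.ne', one_mul]
    exact max_le (by linarith) (by linarith)
  have hlog0 : 0 ≤ Real.log (1 + ρ ^ 2 / τ) :=
    Real.log_nonneg (by have : 0 < ρ ^ 2 / τ := by positivity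
                        linarith)
  have hfar : ∫ r in Ioi T, (ρ / √r) ^ 3 ≤ 2 * ρ ^ 2 := by
    refine (setIntegral_mono_set i2 (ae_restrict_of_forall_mem measurableSet_Ioi fun r hr => ?_)
      hsub.eventuallyLE).trans ?_
    · simp only [Pi.zero_apply]; positivity
    · rw [v2]; norm_num
  rw [← Real.norm_eq_abs]
  refine (norm_integral_le_of_norm_le j (ae_restrict_of_forall_mem measurableSet_Ioi hfm)).trans ?_
  rw [← hU, setIntegral_union (Ioc_disjoint_Ioi le_rfl) measurableSet_Ioi j1 j2,
    ← setIntegral_congr_fun measurableSet_Ioc m1, ← setIntegral_congr_fun measurableSet_Ioi m2,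
    integral_const_mul, integral_const_mul, integral_const_mul,
    ← intervalIntegral.integral_of_le hτT, integral_inv_of_pos hτ (hτ.trans_le hτT)]
  have e1 := mul_le_mul_of_nonneg_left hlog (by positivity : 0 ≤ A * ρ ^ 2)
  have e2 := mul_le_mul_of_nonneg_left hfar hA
  have e3 : 0 ≤ A * ρ ^ 2 * Real.log (1 + ρ ^ 2 / τ) := by positivity
  nlinarith

/-! ### Gaussian bounds for kernels -/

/-- `φ_r` is bounded by `r^{-n/2}` times a Gaussian, as is any `n`-th derivative of `g_r`. -/
def GaussBd (n : ℕ) (φ : ℝ → Sp d → ℝ) : Prop :=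
  ∃ C : ℝ, 0 ≤ C ∧ ∀ r : ℝ, 0 < r → ∀ z : Sp d, |φ r z| ≤ C * (√r)⁻¹ ^ n * gauss (2 * r) z

lemma GaussBd.of_poly {n : ℕ} {φ : ℝ → Sp d → ℝ}
    (c : ℕ → ℝ) (hc : ∀ k, 0 ≤ c k)
    (h : ∀ r : ℝ, 0 < r → ∀ z : Sp d,
      |φ r z| ≤ (∑ k ∈ Finset.range 5, c k * ((√r)⁻¹ ^ (n + k) * ‖z‖ ^ k)) * gauss r z) :
    GaussBd n φ := by
  choose K hK0 hK using exists_pow_mul_gauss_le d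
  refine ⟨∑ k ∈ Finset.range 5, c k * K k, Finset.sum_nonneg fun k _ => mul_nonneg (hc k) (hK0 k),
    fun r hr z => (h r hr z).trans ?_⟩
  rw [Finset.sum_mul, Finset.sum_mul, Finset.sum_mul]
  refine Finset.sum_le_sum fun k _ => ?_
  have hs : 0 < √r := Real.sqrt_pos.2 hr
  calc _ = c k * (√r)⁻¹ ^ (n + k) * (‖z‖ ^ k * gauss r z) := by ring
    _ ≤ c k * (√r)⁻¹ ^ (n + k) * (K k * √r ^ k * gauss (2 * r) z) :=
        mul_le_mul_of_nonneg_left (hK k r hr z) (mul_nonneg (hc k) (by positivity))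
    _ = c k * K k * (√r)⁻¹ ^ n * gauss (2 * r) z * ((√r)⁻¹ * √r) ^ k := by
        rw [mul_pow, pow_add]; ring
    _ = _ := by rw [inv_mul_cancel₀ hs.ne', one_pow, mul_one]

lemma inv_eq_sqrt_inv_sq {r : ℝ} (hr : 0 < r) : r⁻¹ = (√r)⁻¹ ^ 2 := by
  rw [inv_pow, Real.sq_sqrt hr.le]

lemma gaussBd_gauss : GaussBd 0 (gauss (d := d)) := by
  refine GaussBd.of_poly (fun k => if k = 0 then 1 else 0) (fun k => by split_ifs <;> simp)
    fun r hr z => ?_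
  simp [abs_of_pos (gauss_pos hr z)]

lemma gaussBd_dG (h : Fin d) : GaussBd 1 (dG h) := by
  refine GaussBd.of_poly (fun k => if k = 1 then 1 else 0) (fun k => by split_ifs <;> simp)
    fun r hr z => ?_
  have h1 := abs_apply_le_norm z h
  have := gauss_pos hr z
  simp only [Finset.sum_range_succ, dG, abs_mul, abs_of_pos this]
  gcongr
  simp
  rw [abs_div, abs_neg, abs_of_pos (by positivity : 0 < 2 * r), div_eq_mul_inv, mul_inv, inv_eq_sqrt_inv_sq hr]
  have hs : 0 < (√r)⁻¹ ^ 2 := by positivity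
  have : 0 ≤ (√r)⁻¹ ^ 2 * ‖z‖ := by positivity
  simp only [inv_pow] at *
  nlinarith [mul_le_mul_of_nonneg_left h1 hs.le]

lemma gaussBd_d2G (j h : Fin d) : GaussBd 2 (d2G j h) := by
  refine GaussBd.of_poly (fun k => 1) (fun k => by simp)
    fun r hr z => ?_
  have h1 := abs_apply_le_norm z h
  have h2 := abs_apply_le_norm z j
  have hg := gauss_pos hr z
  have hs : 0 < (√r)⁻¹ := by positivity
  simp only [d2G, abs_mul, abs_of_pos hg]
  refine mul_le_mul_of_nonneg_right ?_ hg.le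
  have e : z j * z h / (4 * r ^ 2) - kron j h / (2 * r)
      = (1 / 4) * (√r)⁻¹ ^ 4 * (z j * z h) - (1 / 2) * (√r)⁻¹ ^ 2 * kron j h := by
    rw [show (√r)⁻¹ ^ 4 = ((√r)⁻¹ ^ 2) ^ 2 by ring, ← inv_eq_sqrt_inv_sq hr]; field_simp
  rw [e]
  refine (abs_sub _ _).trans ?_
  simp only [abs_mul, abs_of_pos (pow_pos hs _), Finset.sum_range_succ]
  have a1 : |z j| * |z h| ≤ ‖z‖ ^ 2 := by rw [sq]; gcongr
  have a2 := abs_kron_le j h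
  have t1 : (√r)⁻¹ ^ 4 * (|z j| * |z h|) ≤ (√r)⁻¹ ^ 4 * ‖z‖ ^ 2 := by gcongr
  have t2 : (√r)⁻¹ ^ 2 * |kron j h| ≤ (√r)⁻¹ ^ 2 := mul_le_of_le_one_right (by positivity) a2
  have n1 : 0 ≤ (√r)⁻¹ ^ 3 * ‖z‖ := by positivity
  have n2 : 0 ≤ (√r)⁻¹ ^ 4 * ‖z‖ ^ 2 := by positivity
  have n3 : 0 ≤ (√r)⁻¹ ^ 5 * ‖z‖ ^ 3 := by positivity
  have n4 : 0 ≤ (√r)⁻¹ ^ 6 * ‖z‖ ^ 4 := by positivity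
  have n5 : 0 ≤ (√r)⁻¹ ^ 2 := by positivity
  norm_num
  simp only [inv_pow] at *
  linarith

lemma gaussBd_d3G (j h k : Fin d) : GaussBd 3 (d3G j h k) := by
  refine GaussBd.of_poly (fun k => 1) (fun k => by simp)
    fun r hr z => ?_
  have h1 := abs_apply_le_norm z h
  have h2 := abs_apply_le_norm z j
  have h3 := abs_apply_le_norm z k
  have hg := gauss_pos hr z
  have hs : 0 < (√r)⁻¹ := by positivity
  simp only [d3G, abs_mul, abs_of_pos hg]
  refine mul_le_mul_of_nonneg_right ?_ hg.le
  have e : -(z j * z h * z k) / (8 * r ^ 3)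
      + (kron j h * z k + kron h k * z j + kron k j * z h) / (4 * r ^ 2)
      = (1 / 8) * (√r)⁻¹ ^ 6 * -(z j * z h * z k)
        + (1 / 4) * (√r)⁻¹ ^ 4 * (kron j h * z k + kron h k * z j + kron k j * z h) := by
    rw [show (√r)⁻¹ ^ 4 = ((√r)⁻¹ ^ 2) ^ 2 by ring, show (√r)⁻¹ ^ 6 = ((√r)⁻¹ ^ 2) ^ 3 by ring,
      ← inv_eq_sqrt_inv_sq hr]; field_simp
  rw [e]
  refine (abs_add_le _ _).trans ?_
  simp only [abs_mul, abs_neg, abs_of_pos (pow_pos hs _), Finset.sum_range_succ]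
  have a1 : |z j| * |z h| * |z k| ≤ ‖z‖ ^ 3 := by
    rw [pow_succ, sq]; gcongr
  have a2 : |kron j h * z k + kron h k * z j + kron k j * z h| ≤ 3 * ‖z‖ := by
    refine (abs_add_three _ _ _).trans ?_
    have := mul_le_mul (abs_kron_le j h) h3 (abs_nonneg _) zero_le_one
    have := mul_le_mul (abs_kron_le h k) h2 (abs_nonneg _) zero_le_one
    have := mul_le_mul (abs_kron_le k j) h1 (abs_nonneg _) zero_le_one
    simp only [abs_mul]
    linarith
  have t1 : (√r)⁻¹ ^ 6 * (|z j| * |z h| * |z k|) ≤ (√r)⁻¹ ^ 6 * ‖z‖ ^ 3 := by gcongr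
  have t2 : (√r)⁻¹ ^ 4 * |kron j h * z k + kron h k * z j + kron k j * z h|
      ≤ (√r)⁻¹ ^ 4 * (3 * ‖z‖) := by gcongr
  have n1 : 0 ≤ (√r)⁻¹ ^ 4 * ‖z‖ := by positivity
  have n2 : 0 ≤ (√r)⁻¹ ^ 5 * ‖z‖ ^ 2 := by positivity
  have n3 : 0 ≤ (√r)⁻¹ ^ 6 * ‖z‖ ^ 3 := by positivity
  have n4 : 0 ≤ (√r)⁻¹ ^ 7 * ‖z‖ ^ 4 := by positivity
  have n5 : 0 ≤ (√r)⁻¹ ^ 3 := by positivity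
  norm_num
  simp only [inv_pow] at *
  linarith

lemma gaussBd_fderiv_gauss : GaussBd 1 (fun r (z : Sp d) => ‖fderiv ℝ (gauss r) z‖) := by
  refine GaussBd.of_poly (fun k => 1) (fun k => by simp) fun r hr z => ?_
  have hg := gauss_pos hr z
  have hs : 0 < (√r)⁻¹ := by positivity
  rw [(hasFDerivAt_gauss r z).fderiv, abs_norm, norm_smul, innerSL_apply_norm, norm_mul, norm_neg,
    Real.norm_eq_abs, Real.norm_eq_abs, abs_of_pos hg, abs_of_pos (by positivity)]
  have e : 1 / (2 * r) = (1 / 2) * (√r)⁻¹ ^ 2 := by rw [← inv_eq_sqrt_inv_sq hr]; field_simp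
  rw [e, mul_right_comm]
  refine mul_le_mul_of_nonneg_right ?_ hg.le
  simp only [Finset.sum_range_succ]
  have n1 : 0 ≤ (√r)⁻¹ ^ 2 * ‖z‖ := by positivity
  have n2 : 0 ≤ (√r)⁻¹ ^ 3 * ‖z‖ ^ 2 := by positivity
  have n3 : 0 ≤ (√r)⁻¹ ^ 4 * ‖z‖ ^ 3 := by positivity
  have n4 : 0 ≤ (√r)⁻¹ ^ 5 * ‖z‖ ^ 4 := by positivity
  have n5 : 0 ≤ (√r)⁻¹ := by positivity
  norm_num
  simp only [inv_pow] at *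
  linarith

lemma norm_proj_le (j : Fin d) : ‖(EuclideanSpace.proj j : Sp d →L[ℝ] ℝ)‖ ≤ 1 :=
  ContinuousLinearMap.opNorm_le_bound _ zero_le_one fun z => by
    simpa using PiLp.norm_apply_le z j

lemma gaussBd_fderiv_dG (h : Fin d) : GaussBd 2 (fun r (z : Sp d) => ‖fderiv ℝ (dG h r) z‖) := by
  refine GaussBd.of_poly (fun k => 1) (fun k => by simp) fun r hr z => ?_
  have hg := gauss_pos hr z
  have hs : 0 < (√r)⁻¹ := by positivity
  have h1 := abs_apply_le_norm z h
  have e1 : -(1 / (2 * r)) = -((1 / 2) * (√r)⁻¹ ^ 2) := by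
    rw [← inv_eq_sqrt_inv_sq hr]; field_simp
  have e2 : -(z h) / (2 * r) = -((1 / 2) * (√r)⁻¹ ^ 2 * z h) := by
    rw [← inv_eq_sqrt_inv_sq hr]; field_simp
  have e3 : -1 / (2 * r) = -((1 / 2) * (√r)⁻¹ ^ 2) := by
    rw [← inv_eq_sqrt_inv_sq hr]; field_simp
  rw [(hasFDerivAt_dG h r z).fderiv, abs_norm, e1, e2, e3]
  refine (norm_add_le _ _).trans ?_
  simp only [norm_smul, innerSL_apply_norm, norm_mul, norm_neg, Real.norm_eq_abs, abs_of_pos hg,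
    abs_of_pos (pow_pos hs _)]
  have a1 := mul_le_mul_of_nonneg_left h1 (by positivity : 0 ≤ (√r)⁻¹ ^ 4 * ‖z‖)
  have a2 := mul_le_mul_of_nonneg_left (norm_proj_le h) (by positivity : 0 ≤ (√r)⁻¹ ^ 2)
  have : |(1 : ℝ) / 2| = 1 / 2 := abs_of_pos (by norm_num)
  rw [this]
  refine le_trans (b := (1 / 4 * ((√r)⁻¹ ^ 4 * ‖z‖ * |z h|) + 1 / 2 * ((√r)⁻¹ ^ 2 *
    ‖(EuclideanSpace.proj h : Sp d →L[ℝ] ℝ)‖)) * gauss r z) (le_of_eq (by ring)) ?_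
  refine mul_le_mul_of_nonneg_right ?_ hg.le
  simp only [Finset.sum_range_succ]
  have n1 : 0 ≤ (√r)⁻¹ ^ 3 * ‖z‖ := by positivity
  have n2 : 0 ≤ (√r)⁻¹ ^ 4 * ‖z‖ ^ 2 := by positivity
  have n3 : 0 ≤ (√r)⁻¹ ^ 5 * ‖z‖ ^ 3 := by positivity
  have n4 : 0 ≤ (√r)⁻¹ ^ 6 * ‖z‖ ^ 4 := by positivity
  have n5 : 0 ≤ (√r)⁻¹ ^ 2 := by positivity
  norm_num
  simp only [inv_pow] at *
  nlinarith

lemma gaussBd_fderiv_d3G (j h k : Fin d) :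
    GaussBd 4 (fun r (z : Sp d) => ‖fderiv ℝ (d3G j h k r) z‖) := by
  refine GaussBd.of_poly (fun k => 4) (fun k => by simp) fun r hr z => ?_
  have hg := gauss_pos hr z
  have hs : 0 < (√r)⁻¹ := by positivity
  have h1 := abs_apply_le_norm z h
  have h2 := abs_apply_le_norm z j
  have h3 := abs_apply_le_norm z k
  set s := (√r)⁻¹ with hsdef
  have er : r⁻¹ = s ^ 2 := inv_eq_sqrt_inv_sq hr
  have e1 : -(1 / (2 * r)) = -((1 / 2) * s ^ 2) := by rw [← er]; field_simp
  have e2 : -(z j * z h * z k) / (8 * r ^ 3)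
      + (kron j h * z k + kron h k * z j + kron k j * z h) / (4 * r ^ 2)
      = (1 / 8) * s ^ 6 * -(z j * z h * z k)
        + (1 / 4) * s ^ 4 * (kron j h * z k + kron h k * z j + kron k j * z h) := by
    rw [show s ^ 4 = (s ^ 2) ^ 2 by ring, show s ^ 6 = (s ^ 2) ^ 3 by ring, ← er]; field_simp
  have e3 : -1 / (8 * r ^ 3) = -((1 / 8) * s ^ 6) := by
    rw [show s ^ 6 = (s ^ 2) ^ 3 by ring, ← er]; field_simp
  have e4 : 1 / (4 * r ^ 2) = (1 / 4) * s ^ 4 := by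
    rw [show s ^ 4 = (s ^ 2) ^ 2 by ring, ← er]; field_simp
  rw [(hasFDerivAt_d3G j h k r z).fderiv, abs_norm, e1, e2, e3, e4]
  have a1 : |z j| * |z h| * |z k| ≤ ‖z‖ ^ 3 := by rw [pow_succ, sq]; gcongr
  have a2 : |kron j h * z k + kron h k * z j + kron k j * z h| ≤ 3 * ‖z‖ := by
    refine (abs_add_three _ _ _).trans ?_
    have := mul_le_mul (abs_kron_le j h) h3 (abs_nonneg _) zero_le_one
    have := mul_le_mul (abs_kron_le h k) h2 (abs_nonneg _) zero_le_one
    have := mul_le_mul (abs_kron_le k j) h1 (abs_nonneg _) zero_le_one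
    simp only [abs_mul]
    linarith
  have p1 := norm_proj_le h
  have p2 := norm_proj_le j
  have p3 := norm_proj_le k
  have b1 : |(1 / 8) * s ^ 6 * -(z j * z h * z k)
        + (1 / 4) * s ^ 4 * (kron j h * z k + kron h k * z j + kron k j * z h)|
      ≤ s ^ 6 * ‖z‖ ^ 3 + s ^ 4 * (3 * ‖z‖) := by
    refine (abs_add_le _ _).trans ?_
    simp only [abs_mul, abs_neg, abs_of_pos (pow_pos hs _)]
    rw [abs_of_pos (by norm_num : (0 : ℝ) < 1 / 8), abs_of_pos (by norm_num : (0 : ℝ) < 1 / 4)]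
    have t1 : s ^ 6 * (|z j| * |z h| * |z k|) ≤ s ^ 6 * ‖z‖ ^ 3 := by gcongr
    have t2 : s ^ 4 * |kron j h * z k + kron h k * z j + kron k j * z h|
      ≤ s ^ 4 * (3 * ‖z‖) := by gcongr
    have n1 : 0 ≤ s ^ 6 * ‖z‖ ^ 3 := by positivity
    have n2 : 0 ≤ s ^ 4 * (3 * ‖z‖) := by positivity
    linarith
  have b2 : ‖(z j * z h) • (EuclideanSpace.proj k : Sp d →L[ℝ] ℝ)
          + z k • (z j • (EuclideanSpace.proj h : Sp d →L[ℝ] ℝ)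
            + z h • (EuclideanSpace.proj j : Sp d →L[ℝ] ℝ))‖ ≤ 3 * ‖z‖ ^ 2 := by
    refine (norm_add_le _ _).trans ?_
    rw [norm_smul, norm_smul, norm_mul]
    simp only [Real.norm_eq_abs]
    have c0 : ‖z j • (EuclideanSpace.proj h : Sp d →L[ℝ] ℝ)
            + z h • (EuclideanSpace.proj j : Sp d →L[ℝ] ℝ)‖ ≤ ‖z‖ * 1 + ‖z‖ * 1 := by
      refine (norm_add_le _ _).trans ?_
      rw [norm_smul, norm_smul]
      simp only [Real.norm_eq_abs]
      gcongr
    have c1 : |z j| * |z h| * ‖(EuclideanSpace.proj k : Sp d →L[ℝ] ℝ)‖ ≤ ‖z‖ * ‖z‖ * 1 := by gcongr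
    have c2 := mul_le_mul h3 c0 (norm_nonneg _) (norm_nonneg _)
    nlinarith
  have b3 : ‖kron j h • (EuclideanSpace.proj k : Sp d →L[ℝ] ℝ)
            + kron h k • (EuclideanSpace.proj j : Sp d →L[ℝ] ℝ)
            + kron k j • (EuclideanSpace.proj h : Sp d →L[ℝ] ℝ)‖ ≤ 3 := by
    refine norm_add₃_le.trans ?_
    simp only [norm_smul, Real.norm_eq_abs]
    have := mul_le_mul (abs_kron_le j h) p3 (norm_nonneg _) zero_le_one
    have := mul_le_mul (abs_kron_le h k) p2 (norm_nonneg _) zero_le_one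
    have := mul_le_mul (abs_kron_le k j) p1 (norm_nonneg _) zero_le_one
    linarith
  refine (norm_add_le _ _).trans ?_
  rw [norm_smul, norm_smul, norm_smul, innerSL_apply_norm, norm_mul, norm_neg, norm_mul]
  simp only [Real.norm_eq_abs, abs_of_pos hg, abs_of_pos (pow_pos hs _)]
  rw [abs_of_pos (by norm_num : (0 : ℝ) < 1 / 2)]
  have b4 : ‖-((1 / 8) * s ^ 6) • ((z j * z h) • (EuclideanSpace.proj k : Sp d →L[ℝ] ℝ)
          + z k • (z j • (EuclideanSpace.proj h : Sp d →L[ℝ] ℝ)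
            + z h • (EuclideanSpace.proj j : Sp d →L[ℝ] ℝ)))
          + (1 / 4 * s ^ 4) • (kron j h • (EuclideanSpace.proj k : Sp d →L[ℝ] ℝ)
            + kron h k • (EuclideanSpace.proj j : Sp d →L[ℝ] ℝ)
            + kron k j • (EuclideanSpace.proj h : Sp d →L[ℝ] ℝ))‖
      ≤ (1 / 8 * s ^ 6) * (3 * ‖z‖ ^ 2) + (1 / 4 * s ^ 4) * 3 := by
    refine (norm_add_le _ _).trans ?_
    rw [norm_smul, norm_smul, norm_neg, Real.norm_of_nonneg (by positivity),
      Real.norm_of_nonneg (by positivity)]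
    gcongr
  refine (add_le_add (mul_le_mul_of_nonneg_right b1 (by positivity))
    (mul_le_mul_of_nonneg_left b4 hg.le)).trans ?_
  refine le_trans (b := ((s ^ 6 * ‖z‖ ^ 3 + s ^ 4 * (3 * ‖z‖)) * (1 / 2 * s ^ 2 * ‖z‖) +
    ((1 / 8 * s ^ 6) * (3 * ‖z‖ ^ 2) + (1 / 4 * s ^ 4) * 3)) * gauss r z) (le_of_eq (by ring)) ?_
  refine mul_le_mul_of_nonneg_right ?_ hg.le
  simp only [Finset.sum_range_succ]
  have n1 : 0 ≤ s ^ 5 * ‖z‖ := by positivity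
  have n2 : 0 ≤ s ^ 6 * ‖z‖ ^ 2 := by positivity
  have n3 : 0 ≤ s ^ 7 * ‖z‖ ^ 3 := by positivity
  have n4 : 0 ≤ s ^ 8 * ‖z‖ ^ 4 := by positivity
  have n5 : 0 ≤ s ^ 4 := by positivity
  norm_num
  nlinarith

/-! ### The Oseen kernel in terms of the heat kernel -/

lemma integrable_pow_mul_exp {c : ℝ} (hc : 0 < c) (n : ℕ) :
    Integrable (fun ξ : Sp d => ‖ξ‖ ^ n * Real.exp (-(c * ‖ξ‖ ^ 2))) := by
  obtain ⟨C, hC, h⟩ := exists_pow_mul_gauss_le d n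
  set r := 1 / (4 * c) with hr
  have hr0 : 0 < r := by positivity
  set K := (4 * Real.pi * r) ^ (-(d : ℝ) / 2) with hK
  have hK0 : 0 < K := by positivity
  have e : ∀ ξ : Sp d, gauss r ξ = K * Real.exp (-(c * ‖ξ‖ ^ 2)) := by
    intro ξ
    unfold gauss
    congr 2
    rw [hr]; field_simp
  have h1 : Integrable (fun ξ : Sp d => ‖ξ‖ ^ n * gauss r ξ) := by
    refine ((integrable_gauss (d := d) (by positivity : 0 < 2 * r)).const_mul (C * √r ^ n)).mono'
      (by have := continuous_gauss (d := d) r; fun_prop) (Filter.Eventually.of_forall fun ξ => ?_)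
    rw [Real.norm_of_nonneg (mul_nonneg (by positivity) (gauss_pos hr0 ξ).le)]
    exact h r hr0 ξ
  refine (h1.const_mul K⁻¹).congr (Filter.Eventually.of_forall fun ξ => ?_)
  simp only [e]
  field_simp

/-- The Fourier transform of the heat kernel at time `r`. -/
noncomputable def gaussHat (r : ℝ) (ξ : Sp d) : ℂ :=
  (Real.exp (-(4 * Real.pi ^ 2 * r * ‖ξ‖ ^ 2)) : ℝ)

lemma continuous_gaussHat (r : ℝ) : Continuous (gaussHat r : Sp d → ℂ) := by
  unfold gaussHat; fun_prop

lemma norm_gaussHat (r : ℝ) (ξ : Sp d) :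
    ‖gaussHat r ξ‖ = Real.exp (-(4 * Real.pi ^ 2 * r * ‖ξ‖ ^ 2)) := by
  rw [gaussHat, Complex.norm_real, Real.norm_of_nonneg (Real.exp_nonneg _)]

lemma ofReal_gauss {r : ℝ} (hr : 0 < r) (x : Sp d) :
    ((gauss r x : ℝ) : ℂ) = (4 * Real.pi * r : ℂ) ^ (-(d : ℂ) / 2)
      * Complex.exp (-‖x‖ ^ 2 / (4 * r)) := by
  unfold gauss
  push_cast
  rw [Complex.ofReal_cpow (by positivity)]
  push_cast
  rfl

lemma fourierInv_gaussHat {r : ℝ} (hr : 0 < r) (x : Sp d) :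
    𝓕⁻ (gaussHat r : Sp d → ℂ) x = (gauss r x : ℝ) := by
  have hb : 0 < ((4 * Real.pi ^ 2 * r : ℝ) : ℂ).re := by
    rw [Complex.ofReal_re]; positivity
  have e : (gaussHat r : Sp d → ℂ)
      = fun v => Complex.exp (-((4 * Real.pi ^ 2 * r : ℝ) : ℂ) * ‖v‖ ^ 2) := by
    funext v; unfold gaussHat; push_cast; congr 1; ring
  rw [Real.fourierInv_eq_fourier_neg, e, fourier_gaussian_innerProductSpace hb, ofReal_gauss hr,
    finrank_euclideanSpace_fin, norm_neg]
  have hπ : (Real.pi : ℂ) ≠ 0 := by exact_mod_cast Real.pi_ne_zero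
  have hrc : (r : ℂ) ≠ 0 := by exact_mod_cast hr.ne'
  congr 1
  · have : (Real.pi : ℂ) / ((4 * Real.pi ^ 2 * r : ℝ) : ℂ) = ((4 * Real.pi * r : ℝ) : ℂ)⁻¹ := by
      push_cast; field_simp
    rw [this, Complex.inv_cpow, ← Complex.cpow_neg]
    · push_cast; congr 1; ring
    · rw [Complex.arg_ofReal_of_nonneg (by positivity)]; exact Real.pi_pos.ne
  · congr 1
    push_cast; field_simp

lemma fourier_gauss {s : ℝ} (hs : 0 < s) (ξ : Sp d) :
    𝓕 (fun y : Sp d => ((gauss s y : ℝ) : ℂ)) ξ = gaussHat s ξ := by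
  have hb : 0 < ((1 / (4 * s) : ℝ) : ℂ).re := by
    rw [Complex.ofReal_re]; positivity
  have hsc : (s : ℂ) ≠ 0 := by exact_mod_cast hs.ne'
  have hπ : (Real.pi : ℂ) ≠ 0 := by exact_mod_cast Real.pi_ne_zero
  have e : (fun y : Sp d => ((gauss s y : ℝ) : ℂ))
      = (4 * Real.pi * s : ℂ) ^ (-(d : ℂ) / 2) •
        fun v : Sp d => Complex.exp (-((1 / (4 * s) : ℝ) : ℂ) * ‖v‖ ^ 2) := by
    funext v
    rw [ofReal_gauss hs, Pi.smul_apply, smul_eq_mul]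
    congr 2; push_cast; field_simp
  have h0 : ((4 * Real.pi * s : ℝ) : ℂ) ≠ 0 := by
    exact_mod_cast (by positivity : 4 * Real.pi * s ≠ 0)
  have h1 : (Real.pi : ℂ) / ((1 / (4 * s) : ℝ) : ℂ) = ((4 * Real.pi * s : ℝ) : ℂ) := by
    push_cast; field_simp
  have h2 : (4 * Real.pi * s : ℂ) = ((4 * Real.pi * s : ℝ) : ℂ) := by push_cast; rfl
  have hsmul : 𝓕 ((4 * Real.pi * s : ℂ) ^ (-(d : ℂ) / 2) •
      fun v : Sp d => Complex.exp (-((1 / (4 * s) : ℝ) : ℂ) * ‖v‖ ^ 2)) ξ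
      = (4 * Real.pi * s : ℂ) ^ (-(d : ℂ) / 2) *
        𝓕 (fun v : Sp d => Complex.exp (-((1 / (4 * s) : ℝ) : ℂ) * ‖v‖ ^ 2)) ξ := by
    rw [Real.fourier_eq', Real.fourier_eq', ← integral_const_mul]
    refine integral_congr_ae (Filter.Eventually.of_forall fun v => ?_)
    simp only [Pi.smul_apply, smul_eq_mul]
    ring
  rw [e, hsmul, fourier_gaussian_innerProductSpace hb,
    finrank_euclideanSpace_fin, h1, h2, ← mul_assoc, ← Complex.cpow_add _ _ h0]
  have : -(d : ℂ) / 2 + d / 2 = 0 := by ring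
  rw [this, Complex.cpow_zero, one_mul, gaussHat]
  push_cast
  congr 1; field_simp

lemma fourierInv_coord_mul {f : Sp d → ℂ} (hf : Integrable f)
    (hf' : Integrable (fun v => ‖v‖ * ‖f v‖)) (h : Fin d) (x : Sp d) :
    𝓕⁻ (fun ξ => 2 * Real.pi * Complex.I * ξ h * f ξ) x
      = fderiv ℝ (𝓕⁻ f) x (EuclideanSpace.single h 1) := by
  have e : 𝓕⁻ f = fun x => 𝓕 f (-x) := funext fun x => Real.fourierInv_eq_fourier_neg f x
  have hF := Real.hasFDerivAt_fourier hf hf' (-x)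
  have hd : HasFDerivAt (fun x => 𝓕 f (-x)) _ x := hF.comp x (hasFDerivAt_id x).neg
  have hint : Integrable (VectorFourier.fourierSMulRight (innerSL ℝ) f) := by
    refine (hf'.const_mul (2 * Real.pi * ‖innerSL ℝ (E := Sp d)‖)).mono'
      hf.1.fourierSMulRight (Filter.Eventually.of_forall fun v => ?_)
    refine (VectorFourier.norm_fourierSMulRight_le _ _ _).trans (le_of_eq (by ring))
  rw [e, hd.fderiv, Real.fourierInv_eq_fourier_neg]
  simp only [ContinuousLinearMap.comp_apply, neg_apply, ContinuousLinearMap.id_apply, map_neg]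
  rw [Real.fourier_continuousLinearMap_apply hint]
  have : (fun ξ : Sp d => 2 * (Real.pi : ℂ) * Complex.I * ξ h * f ξ)
      = fun ξ => -((VectorFourier.fourierSMulRight (innerSL ℝ) f ξ)
        (EuclideanSpace.single h 1)) := by
    funext ξ
    rw [VectorFourier.fourierSMulRight_apply, innerSL_apply_apply,
      EuclideanSpace.inner_single_right]
    simp
    ring
  rw [this]
  simp only [Real.fourier_eq, smul_neg, integral_neg]

lemma integrable_of_norm_le_gaussHat {f : Sp d → ℂ} (hf : Continuous f) {r : ℝ} (hr : 0 < r)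
    {c : ℝ} {n : ℕ} (h : ∀ ξ, ‖f ξ‖ ≤ c * ‖ξ‖ ^ n * ‖gaussHat r ξ‖) (m : ℕ) :
    Integrable (fun v => ‖v‖ ^ m * ‖f v‖) := by
  have := (integrable_pow_mul_exp (d := d) (by positivity : 0 < 4 * Real.pi ^ 2 * r)
    (m + n)).const_mul c
  refine this.mono' (by fun_prop) (Filter.Eventually.of_forall fun ξ => ?_)
  rw [norm_mul, norm_norm, norm_pow, norm_norm]
  have h1 := h ξ
  rw [norm_gaussHat] at h1
  calc _ ≤ ‖ξ‖ ^ m * (c * ‖ξ‖ ^ n * Real.exp (-(4 * Real.pi ^ 2 * r * ‖ξ‖ ^ 2))) := by gcongr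
    _ = _ := by ring

lemma norm_coord_mul_le {f : Sp d → ℂ} {r c : ℝ} {n : ℕ}
    (hf : ∀ ξ, ‖f ξ‖ ≤ c * ‖ξ‖ ^ n * ‖gaussHat r ξ‖) (h : Fin d) (ξ : Sp d) :
    ‖2 * (Real.pi : ℂ) * Complex.I * ξ h * f ξ‖
      ≤ (2 * Real.pi * c) * ‖ξ‖ ^ (n + 1) * ‖gaussHat r ξ‖ := by
  have h1 := abs_apply_le_norm ξ h
  have h2 := hf ξ
  have hn := (norm_nonneg _).trans h2
  simp only [norm_mul, Complex.norm_I, Complex.norm_real, Real.norm_eq_abs, mul_one,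
    Complex.norm_ofNat, abs_of_pos Real.pi_pos]
  calc 2 * Real.pi * |ξ h| * ‖f ξ‖ ≤ 2 * Real.pi * ‖ξ‖ * (c * ‖ξ‖ ^ n * ‖gaussHat r ξ‖) := by
        gcongr
    _ = _ := by ring

lemma fderiv_ofReal_comp {f : Sp d → ℝ} {x : Sp d} (hf : DifferentiableAt ℝ f x) (v : Sp d) :
    fderiv ℝ (fun x => ((f x : ℝ) : ℂ)) x v = (fderiv ℝ f x v : ℝ) := by
  have h := (Complex.ofRealCLM.hasFDerivAt (x := f x)).comp x hf.hasFDerivAt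
  have h' : fderiv ℝ (fun x => ((f x : ℝ) : ℂ)) x = _ := h.fderiv
  rw [h']
  simp

lemma continuous_coord_mul {f : Sp d → ℂ} (hf : Continuous f) (h : Fin d) :
    Continuous fun ξ : Sp d => 2 * (Real.pi : ℂ) * Complex.I * ξ h * f ξ := by
  have : Continuous fun ξ : Sp d => ((ξ h : ℝ) : ℂ) := by fun_prop
  fun_prop

lemma fourierInv_dG {r : ℝ} (hr : 0 < r) (h : Fin d) (x : Sp d) :
    𝓕⁻ (fun ξ : Sp d => 2 * Real.pi * Complex.I * ξ h * gaussHat r ξ) x = (dG h r x : ℝ) := by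
  have hb : ∀ ξ : Sp d, ‖gaussHat r ξ‖ ≤ 1 * ‖ξ‖ ^ 0 * ‖gaussHat r ξ‖ := fun ξ => by simp
  have hc := continuous_gaussHat (d := d) r
  have i0 := integrable_of_norm_le_gaussHat hc hr hb 0
  have i1 := integrable_of_norm_le_gaussHat hc hr hb 1
  simp only [pow_zero, one_mul, pow_one] at i0 i1
  rw [fourierInv_coord_mul ((integrable_norm_iff hc.aestronglyMeasurable).1 i0) i1,
    show 𝓕⁻ (gaussHat r : Sp d → ℂ) = fun x => ((gauss r x : ℝ) : ℂ) from
      funext (fourierInv_gaussHat hr),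
    fderiv_ofReal_comp (hasFDerivAt_gauss r x).differentiableAt, fderiv_gauss_single]

lemma fourierInv_d3G {r : ℝ} (hr : 0 < r) (j h k : Fin d) (x : Sp d) :
    𝓕⁻ (fun ξ : Sp d => 2 * Real.pi * Complex.I * ξ j * (2 * Real.pi * Complex.I * ξ h *
      (2 * Real.pi * Complex.I * ξ k * gaussHat r ξ))) x = (d3G j h k r x : ℝ) := by
  have b0 : ∀ ξ : Sp d, ‖gaussHat r ξ‖ ≤ 1 * ‖ξ‖ ^ 0 * ‖gaussHat r ξ‖ := fun ξ => by simp
  have c0 := continuous_gaussHat (d := d) r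
  have b1 := norm_coord_mul_le b0 k
  have c1 := continuous_coord_mul c0 k
  have b2 := norm_coord_mul_le b1 h
  have c2 := continuous_coord_mul c1 h
  have i0 := integrable_of_norm_le_gaussHat c1 hr b1 0
  have i1 := integrable_of_norm_le_gaussHat c1 hr b1 1
  have k0 := integrable_of_norm_le_gaussHat c2 hr b2 0
  have k1 := integrable_of_norm_le_gaussHat c2 hr b2 1
  simp only [pow_zero, one_mul, pow_one] at i0 i1 k0 k1
  have s2 : 𝓕⁻ (fun ξ : Sp d => 2 * Real.pi * Complex.I * ξ h *
      (2 * Real.pi * Complex.I * ξ k * gaussHat r ξ)) = fun x => ((d2G h k r x : ℝ) : ℂ) := by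
    funext x
    rw [fourierInv_coord_mul ((integrable_norm_iff c1.aestronglyMeasurable).1 i0) i1,
      show 𝓕⁻ (fun ξ : Sp d => 2 * Real.pi * Complex.I * ξ k * gaussHat r ξ) =
        fun x => ((dG k r x : ℝ) : ℂ) from funext (fourierInv_dG hr k),
      fderiv_ofReal_comp (hasFDerivAt_dG k r x).differentiableAt, fderiv_dG_single]
  rw [fourierInv_coord_mul ((integrable_norm_iff c2.aestronglyMeasurable).1 k0) k1, s2,
    fderiv_ofReal_comp (hasFDerivAt_d2G h k r x).differentiableAt, fderiv_d2G_single]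

/-- The symbol of the operator `e^{tΔ} P ∇·`. -/
noncomputable def oseenSymbol (t : ℝ) (j h k : Fin d) (ξ : Sp d) : ℂ :=
  2 * (Real.pi : ℂ) * Complex.I * (ξ h : ℂ) *
      ((Real.exp (-(4 * Real.pi ^ 2 * t * ‖ξ‖ ^ 2)) * leraySymbol j k ξ : ℝ) : ℂ)

/-- `∂_j ∂_h ∂_k e^{rΔ}` as a multiplier. -/
noncomputable def thirdSymbol (j h k : Fin d) (r : ℝ) (ξ : Sp d) : ℂ :=
  2 * Real.pi * Complex.I * ξ j * (2 * Real.pi * Complex.I * ξ h *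
      (2 * Real.pi * Complex.I * ξ k * gaussHat r ξ))

lemma thirdSymbol_eq (j h k : Fin d) (r : ℝ) (ξ : Sp d) :
    thirdSymbol j h k r ξ = (-(8 * Real.pi ^ 3 * (ξ j * ξ h * ξ k)) * Complex.I : ℂ) *
      (Real.exp (-(4 * Real.pi ^ 2 * ‖ξ‖ ^ 2) * r) : ℝ) := by
  unfold thirdSymbol gaussHat
  rw [show -(4 * Real.pi ^ 2 * r * ‖ξ‖ ^ 2) = -(4 * Real.pi ^ 2 * ‖ξ‖ ^ 2) * r by ring]
  linear_combination (8 * (Real.pi : ℂ) ^ 3 * (ξ j * ξ h * ξ k) * Complex.I *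
    (Real.exp (-(4 * Real.pi ^ 2 * ‖ξ‖ ^ 2) * r) : ℝ)) * Complex.I_sq

lemma norm_thirdSymbol_le (j h k : Fin d) (r : ℝ) (ξ : Sp d) :
    ‖thirdSymbol j h k r ξ‖ ≤ 8 * Real.pi ^ 3 * ‖ξ‖ ^ 3 *
      Real.exp (-(4 * Real.pi ^ 2 * ‖ξ‖ ^ 2) * r) := by
  have h0 : ∀ ξ : Sp d, ‖gaussHat r ξ‖ ≤ 1 * ‖ξ‖ ^ 0 * ‖gaussHat r ξ‖ := fun ξ => by simp
  have h1 := norm_coord_mul_le (norm_coord_mul_le (norm_coord_mul_le h0 k) h) j ξ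
  unfold thirdSymbol
  refine h1.trans (le_of_eq ?_)
  rw [norm_gaussHat, show -(4 * Real.pi ^ 2 * r * ‖ξ‖ ^ 2) = -(4 * Real.pi ^ 2 * ‖ξ‖ ^ 2) * r by
    ring]
  ring

lemma continuous_thirdSymbol (j h k : Fin d) :
    Continuous fun p : Sp d × ℝ => thirdSymbol j h k p.2 p.1 := by
  have hc : ∀ i : Fin d, Continuous fun p : Sp d × ℝ => ((p.1 i : ℝ) : ℂ) := fun i => by fun_prop
  have := hc j
  have := hc h
  have := hc k
  have hg : Continuous fun p : Sp d × ℝ => gaussHat p.2 p.1 := by unfold gaussHat; fun_prop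
  unfold thirdSymbol
  fun_prop

lemma integrable_thirdSymbol {t : ℝ} (ht : 0 < t) (j h k : Fin d) :
    Integrable (fun p : Sp d × ℝ => thirdSymbol j h k p.2 p.1)
      (volume.prod (volume.restrict (Ioi t))) := by
  have hd : (∀ᵐ ξ : Sp d, ξ ≠ 0) ∨ d = 0 := by
    rcases Nat.eq_zero_or_pos d with h | h
    · exact Or.inr h
    · left
      have : Nontrivial (Sp d) := by
        have : Nonempty (Fin d) := ⟨⟨0, h⟩⟩
        infer_instance
      exact Measure.ae_ne volume 0
  rcases hd with hd | hd
  swap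
  · subst hd; exact j.elim0
  have hexp : ∀ ξ : Sp d, ξ ≠ 0 → -(4 * Real.pi ^ 2 * ‖ξ‖ ^ 2) < 0 := fun ξ hξ => by
    have := norm_pos_iff.2 hξ
    have : 0 < 4 * Real.pi ^ 2 * ‖ξ‖ ^ 2 := by positivity
    linarith
  have hb : ∀ ξ : Sp d, ξ ≠ 0 → Integrable (fun r => 8 * Real.pi ^ 3 * ‖ξ‖ ^ 3 *
      Real.exp (-(4 * Real.pi ^ 2 * ‖ξ‖ ^ 2) * r)) (volume.restrict (Ioi t)) := fun ξ hξ =>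
    (integrableOn_exp_mul_Ioi (hexp ξ hξ) t).const_mul _
  have hcont := continuous_thirdSymbol j h k
  rw [integrable_prod_iff hcont.aestronglyMeasurable]
  constructor
  · filter_upwards [hd] with ξ hξ
    refine (hb ξ hξ).mono' ?_ (Filter.Eventually.of_forall fun r => norm_thirdSymbol_le j h k r ξ)
    exact (hcont.comp (by fun_prop : Continuous fun r : ℝ => (ξ, r))).aestronglyMeasurable
  · refine ((integrable_pow_mul_exp (d := d) (by positivity : 0 < 4 * Real.pi ^ 2 * t) 1).const_mul
      (2 * Real.pi)).mono' hcont.aestronglyMeasurable.norm.integral_prod_right' ?_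
    filter_upwards [hd] with ξ hξ
    rw [Real.norm_of_nonneg (integral_nonneg fun _ => norm_nonneg _)]
    have hξ' := norm_pos_iff.2 hξ
    calc ∫ r in Ioi t, ‖thirdSymbol j h k r ξ‖
        ≤ ∫ r in Ioi t, 8 * Real.pi ^ 3 * ‖ξ‖ ^ 3 * Real.exp (-(4 * Real.pi ^ 2 * ‖ξ‖ ^ 2) * r) :=
          integral_mono_of_nonneg (Filter.Eventually.of_forall fun _ => norm_nonneg _) (hb ξ hξ)
            (Filter.Eventually.of_forall fun r => norm_thirdSymbol_le j h k r ξ)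
      _ = _ := by
          rw [integral_const_mul, integral_exp_mul_Ioi (hexp ξ hξ),
            show -(4 * Real.pi ^ 2 * ‖ξ‖ ^ 2) * t = -(4 * Real.pi ^ 2 * t * ‖ξ‖ ^ 2) by ring]
          field_simp
          ring

lemma oseenSymbol_eq (t : ℝ) (j h k : Fin d) {ξ : Sp d} (hξ : ξ ≠ 0) :
    oseenSymbol t j h k ξ = kron j k * (2 * Real.pi * Complex.I * ξ h * gaussHat t ξ)
      + ∫ r in Ioi t, thirdSymbol j h k r ξ := by
  have hξ' := norm_pos_iff.2 hξ
  have hneg : -(4 * Real.pi ^ 2 * ‖ξ‖ ^ 2) < 0 := by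
    have : 0 < 4 * Real.pi ^ 2 * ‖ξ‖ ^ 2 := by positivity
    linarith
  simp_rw [thirdSymbol_eq]
  rw [integral_const_mul, integral_complex_ofReal, integral_exp_mul_Ioi hneg]
  unfold oseenSymbol leraySymbol gaussHat
  rw [show -(4 * Real.pi ^ 2 * ‖ξ‖ ^ 2) * t = -(4 * Real.pi ^ 2 * t * ‖ξ‖ ^ 2) by ring]
  have hπ : (Real.pi : ℂ) ≠ 0 := by exact_mod_cast Real.pi_ne_zero
  have hn : ((‖ξ‖ : ℝ) : ℂ) ≠ 0 := by exact_mod_cast hξ'.ne'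
  push_cast
  field_simp
  ring

lemma integrable_dGSymbol {t : ℝ} (ht : 0 < t) (h : Fin d) :
    Integrable fun ξ : Sp d => 2 * Real.pi * Complex.I * ξ h * gaussHat t ξ := by
  have b0 : ∀ ξ : Sp d, ‖gaussHat t ξ‖ ≤ 1 * ‖ξ‖ ^ 0 * ‖gaussHat t ξ‖ := fun ξ => by simp
  have c1 := continuous_coord_mul (continuous_gaussHat (d := d) t) h
  have i0 := integrable_of_norm_le_gaussHat c1 ht (norm_coord_mul_le b0 h) 0
  simp only [pow_zero, one_mul] at i0
  exact (integrable_norm_iff c1.aestronglyMeasurable).1 i0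

lemma oseenSymbol_ae_eq (t : ℝ) (j h k : Fin d) :
    oseenSymbol t j h k =ᵐ[volume] fun ξ : Sp d =>
      kron j k * (2 * Real.pi * Complex.I * ξ h * gaussHat t ξ)
      + ∫ r in Ioi t, thirdSymbol j h k r ξ := by
  have : Nontrivial (Sp d) := by
    have : Nonempty (Fin d) := ⟨j⟩
    infer_instance
  filter_upwards [Measure.ae_ne volume (0 : Sp d)] with ξ hξ
  exact oseenSymbol_eq t j h k hξ

lemma integrable_oseenSymbol {t : ℝ} (ht : 0 < t) (j h k : Fin d) :
    Integrable (oseenSymbol t j h k) :=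
  (((integrable_dGSymbol ht h).const_mul _).add (integrable_thirdSymbol ht j h k).integral_prod_left
    ).congr (oseenSymbol_ae_eq t j h k).symm

/-- Since `|ξ|⁻² e^{-4π²t|ξ|²} = 4π² ∫_t^∞ e^{-4π²r|ξ|²} dr`, the Oseen kernel is an integral of
derivatives of the heat kernel. -/
lemma fourierInv_oseenSymbol {t : ℝ} (ht : 0 < t) (j h k : Fin d) (x : Sp d) :
    𝓕⁻ (oseenSymbol t j h k) x
      = ((kron j k * dG h t x + ∫ r in Ioi t, d3G j h k r x : ℝ) : ℂ) := by
  have hI := integrable_thirdSymbol ht j h k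
  have i1 := (integrable_dGSymbol ht h).const_mul ((kron j k : ℝ) : ℂ)
  have i2 := hI.integral_prod_left
  have key : ∫ ξ : Sp d, Complex.exp (↑(2 * Real.pi * inner ℝ ξ x) * Complex.I) •
      ∫ r in Ioi t, thirdSymbol j h k r ξ = ((∫ r in Ioi t, d3G j h k r x : ℝ) : ℂ) := by
    simp_rw [← integral_smul]
    rw [integral_integral_swap, ← integral_complex_ofReal]
    · refine setIntegral_congr_fun measurableSet_Ioi fun r hr => ?_
      have := fourierInv_d3G (ht.trans hr) j h k x
      rw [Real.fourierInv_eq'] at this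
      exact this
    · have hc : Continuous fun p : Sp d × ℝ =>
          Complex.exp (↑(2 * Real.pi * inner ℝ p.1 x) * Complex.I) := by fun_prop
      refine (hI.bdd_mul (c := 1) hc.aestronglyMeasurable
        (Filter.Eventually.of_forall fun p => ?_))
      rw [Complex.norm_exp_ofReal_mul_I]
  have hph : ∀ {f : Sp d → ℂ}, Integrable f → Integrable fun ξ =>
      Complex.exp (↑(2 * Real.pi * inner ℝ ξ x) * Complex.I) • f ξ := by
    intro f hf
    have hc : Continuous fun ξ : Sp d =>
          Complex.exp (↑(2 * Real.pi * inner ℝ ξ x) * Complex.I) := by fun_prop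
    refine (hf.bdd_mul (c := 1) hc.aestronglyMeasurable
      (Filter.Eventually.of_forall fun p => ?_))
    rw [Complex.norm_exp_ofReal_mul_I]
  have h1 := fourierInv_dG ht h x
  rw [Real.fourierInv_eq'] at h1
  rw [Real.fourierInv_eq']
  have : ∫ ξ : Sp d, Complex.exp (↑(2 * Real.pi * inner ℝ ξ x) * Complex.I) • oseenSymbol t j h k ξ
      = ∫ ξ : Sp d, (Complex.exp (↑(2 * Real.pi * inner ℝ ξ x) * Complex.I) •
          ((kron j k : ℝ) * (2 * Real.pi * Complex.I * ξ h * gaussHat t ξ) : ℂ)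
        + Complex.exp (↑(2 * Real.pi * inner ℝ ξ x) * Complex.I) •
          ∫ r in Ioi t, thirdSymbol j h k r ξ) := by
    refine integral_congr_ae ?_
    filter_upwards [oseenSymbol_ae_eq t j h k] with ξ hξ
    rw [hξ, smul_add]
  rw [this, integral_add (hph i1) (hph i2), key]
  have e : ∀ ξ : Sp d, Complex.exp (↑(2 * Real.pi * inner ℝ ξ x) * Complex.I) •
          ((kron j k : ℝ) * (2 * Real.pi * Complex.I * ξ h * gaussHat t ξ) : ℂ)
      = (kron j k : ℝ) * (Complex.exp (↑(2 * Real.pi * inner ℝ ξ x) * Complex.I) •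
          (2 * Real.pi * Complex.I * ξ h * gaussHat t ξ)) := fun ξ => by
    simp only [smul_eq_mul]; ring
  simp_rw [e]
  rw [integral_const_mul, h1]
  push_cast
  rfl

lemma oseenDiv_eq {t : ℝ} (ht : 0 < t) (x : Sp d) (j h k : Fin d) :
    oseenDiv t x j h k = kron j k * dG h t x + ∫ r in Ioi t, d3G j h k r x := by
  have := congrArg Complex.re (fourierInv_oseenSymbol ht j h k x)
  rw [Complex.ofReal_re] at this
  exact this

/-- The semigroup property `F(·,τ) * g_s = F(·,τ+s)`. -/
lemma integral_oseenDiv_mul_gauss {τ s : ℝ} (hτ : 0 < τ) (hs : 0 < s) (j h k : Fin d)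
    (x z : Sp d) :
    ∫ y, oseenDiv τ (x - y) j h k * gauss s (y - z) = oseenDiv (τ + s) (x - z) j h k := by
  rw [← integral_add_right_eq_self _ z]
  simp only [add_sub_cancel_right]
  have e0 : ∀ y, x - (y + z) = (x - z) - y := fun y => by abel
  simp only [e0]
  set w := x - z
  have hre : ∀ {t : ℝ}, 0 < t → ∀ y, ((oseenDiv t y j h k : ℝ) : ℂ) = 𝓕⁻ (oseenSymbol t j h k) y :=
    fun ht y => by rw [fourierInv_oseenSymbol ht, oseenDiv_eq ht]
  apply Complex.ofReal_injective
  rw [← integral_complex_ofReal, hre (by positivity)]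
  have hmod : ∀ y, 𝓕⁻ (oseenSymbol τ j h k) (w - y) = 𝓕 (fun ξ : Sp d =>
      Complex.exp (↑(2 * Real.pi * inner ℝ ξ w) * Complex.I) * oseenSymbol τ j h k ξ) y := by
    intro y
    rw [Real.fourierInv_eq', Real.fourier_eq']
    refine integral_congr_ae (Filter.Eventually.of_forall fun ξ => ?_)
    simp only [smul_eq_mul, ← mul_assoc, ← Complex.exp_add]
    congr 2
    rw [inner_sub_right]
    push_cast
    ring
  have hint : Integrable fun ξ : Sp d =>
      Complex.exp (↑(2 * Real.pi * inner ℝ ξ w) * Complex.I) * oseenSymbol τ j h k ξ := by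
    have hc : Continuous fun ξ : Sp d =>
          Complex.exp (↑(2 * Real.pi * inner ℝ ξ w) * Complex.I) := by fun_prop
    refine ((integrable_oseenSymbol hτ j h k).bdd_mul (c := 1) hc.aestronglyMeasurable
      (Filter.Eventually.of_forall fun p => ?_))
    rw [Complex.norm_exp_ofReal_mul_I]
  have hflip := VectorFourier.integral_fourierIntegral_smul_eq_flip (L := innerₗ (Sp d))
    (μ := volume) (ν := volume) (e := Real.fourierChar) Real.continuous_fourierChar
    continuous_inner hint
    (g := fun y : Sp d => ((gauss s y : ℝ) : ℂ)) ((integrable_gauss (d := d) hs).ofReal (𝕜 := ℂ))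
  rw [flip_innerₗ] at hflip
  have hflip' : ∫ y : Sp d, 𝓕 (fun ξ : Sp d =>
      Complex.exp (↑(2 * Real.pi * inner ℝ ξ w) * Complex.I) * oseenSymbol τ j h k ξ) y •
        ((gauss s y : ℝ) : ℂ)
      = ∫ ξ : Sp d, (Complex.exp (↑(2 * Real.pi * inner ℝ ξ w) * Complex.I) *
        oseenSymbol τ j h k ξ) • 𝓕 (fun y : Sp d => ((gauss s y : ℝ) : ℂ)) ξ := hflip
  have e1 : ∀ y : Sp d, ((oseenDiv τ (w - y) j h k * gauss s y : ℝ) : ℂ) = 𝓕 (fun ξ : Sp d =>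
      Complex.exp (↑(2 * Real.pi * inner ℝ ξ w) * Complex.I) * oseenSymbol τ j h k ξ) y •
        ((gauss s y : ℝ) : ℂ) := fun y => by
    rw [← hmod, ← hre hτ, Complex.ofReal_mul, smul_eq_mul]
  simp_rw [e1]
  rw [hflip', Real.fourierInv_eq']
  refine integral_congr_ae (Filter.Eventually.of_forall fun ξ => ?_)
  simp only [smul_eq_mul]
  rw [fourier_gauss hs, mul_assoc]
  congr 1
  unfold oseenSymbol gaussHat
  rw [show -(4 * Real.pi ^ 2 * (τ + s) * ‖ξ‖ ^ 2) = -(4 * Real.pi ^ 2 * τ * ‖ξ‖ ^ 2) +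
    -(4 * Real.pi ^ 2 * s * ‖ξ‖ ^ 2) by ring, Real.exp_add]
  push_cast
  ring

/-! ### Pointwise estimates of the Oseen kernel -/

lemma integral_rpow_mul_exp_neg_div {a b : ℝ} (ha : 0 < a) (hb : 0 < b) :
    ∫ r in Ioi (0 : ℝ), r ^ (-(a + 1)) * Real.exp (-(b / r)) = (1 / b) ^ a * Real.Gamma a := by
  rw [← Real.integral_rpow_mul_exp_neg_mul_Ioi ha hb,
    ← integral_comp_rpow_Ioi (fun v : ℝ => v ^ (a - 1) * Real.exp (-(b * v)))
      (by norm_num : (-1 : ℝ) ≠ 0)]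
  refine setIntegral_congr_fun measurableSet_Ioi fun r hr => ?_
  have hr' : 0 < r := hr
  simp only [smul_eq_mul]
  rw [Real.rpow_neg_one r, Real.inv_rpow hr'.le, ← Real.rpow_neg hr'.le, ← mul_assoc, mul_assoc |(-1 : ℝ)|,
    ← Real.rpow_add hr', div_eq_mul_inv]
  simp only [abs_neg, abs_one, one_mul]
  congr 2; ring

lemma integral_inv_pow_mul_gauss (m : ℕ) (hm : 2 ≤ m) {x : Sp d} (hx : x ≠ 0) :
    ∫ r in Ioi (0 : ℝ), (r ^ m)⁻¹ * gauss r x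
      = 4 ^ (m - 1) * Real.Gamma ((d : ℝ) / 2 + (m - 1)) /
        (Real.pi ^ ((d : ℝ) / 2) * ‖x‖ ^ (d + 2 * (m - 1))) := by
  have hx' : 0 < ‖x‖ := norm_pos_iff.2 hx
  have hm' : (2 : ℝ) ≤ m := by exact_mod_cast hm
  have ha : 0 < (d : ℝ) / 2 + (m - 1) := by
    have : (0 : ℝ) ≤ (d : ℝ) / 2 := by positivity
    linarith
  have e : ∀ r ∈ Ioi (0 : ℝ), (r ^ m)⁻¹ * gauss r x = (4 * Real.pi) ^ (-(d : ℝ) / 2) *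
      (r ^ (-(((d : ℝ) / 2 + (m - 1)) + 1)) * Real.exp (-(‖x‖ ^ 2 / 4 / r))) := by
    intro r hr
    have hr' : 0 < r := hr
    unfold gauss
    rw [Real.mul_rpow (by positivity) hr'.le, ← Real.rpow_natCast r m, ← Real.rpow_neg hr'.le]
    have h1 : -‖x‖ ^ 2 / (4 * r) = -(‖x‖ ^ 2 / 4 / r) := by field_simp
    have h2 : r ^ (-(((d : ℝ) / 2 + (m - 1)) + 1)) = r ^ (-(m : ℝ)) * r ^ (-(d : ℝ) / 2) := by
      rw [← Real.rpow_add hr']; congr 1; ring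
    rw [h1, h2]; ring
  rw [setIntegral_congr_fun measurableSet_Ioi e, integral_const_mul,
    integral_rpow_mul_exp_neg_div ha (by positivity)]
  obtain ⟨n, rfl⟩ : ∃ n, m = n + 1 := ⟨m - 1, by omega⟩
  push_cast
  simp only [add_sub_cancel_right]
  have h1 : (1 / (‖x‖ ^ 2 / 4)) ^ ((d : ℝ) / 2 + n)
      = 4 ^ ((d : ℝ) / 2) * 4 ^ n / ‖x‖ ^ (d + 2 * n) := by
    have : 1 / (‖x‖ ^ 2 / 4) = 4 / ‖x‖ ^ 2 := by field_simp
    rw [this, Real.div_rpow (by norm_num) (by positivity), Real.rpow_add (by norm_num),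
      Real.rpow_natCast, ← Real.rpow_natCast ‖x‖ 2, ← Real.rpow_mul hx'.le]
    congr 1
    rw [← Real.rpow_natCast]
    congr 1; push_cast; ring
  have h2 : (4 * Real.pi) ^ (-(d : ℝ) / 2) * 4 ^ ((d : ℝ) / 2) * Real.pi ^ ((d : ℝ) / 2) = 1 := by
    rw [mul_assoc, ← Real.mul_rpow (by norm_num) Real.pi_pos.le, ← Real.rpow_add (by positivity)]
    simp [neg_div]
  rw [h1]
  have hp : 0 < Real.pi ^ ((d : ℝ) / 2) := by positivity
  rw [eq_div_iff (by positivity)]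
  generalize Real.Gamma ((d : ℝ) / 2 + n) = G
  generalize (4 * Real.pi) ^ (-(d : ℝ) / 2) = A at *
  generalize (4 : ℝ) ^ ((d : ℝ) / 2) = B at *
  field_simp
  linear_combination G * h2

lemma integrableOn_inv_pow_mul_gauss (m : ℕ) (hm : 2 ≤ m) {x : Sp d} (hx : x ≠ 0) :
    IntegrableOn (fun r => (r ^ m)⁻¹ * gauss r x) (Ioi 0) := by
  by_contra h
  have h1 := integral_inv_pow_mul_gauss m hm hx
  rw [integral_undef h] at h1
  have hx' : 0 < ‖x‖ := norm_pos_iff.2 hx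
  have hm' : (2 : ℝ) ≤ m := by exact_mod_cast hm
  have ha : 0 < (d : ℝ) / 2 + (m - 1) := by
    have : (0 : ℝ) ≤ (d : ℝ) / 2 := by positivity
    linarith
  have := Real.Gamma_pos_of_pos ha
  exact absurd h1 (by positivity)

/-- The homogeneous kernel is the limit of the Oseen kernel as the time tends to zero. -/
lemma integral_d3G_eq_homKernel {x : Sp d} (hx : x ≠ 0) (j h k : Fin d) :
    ∫ r in Ioi (0 : ℝ), d3G j h k r x = homKernel x j h k := by
  have hx' : 0 < ‖x‖ := norm_pos_iff.2 hx
  have e : ∀ r ∈ Ioi (0 : ℝ), d3G j h k r x = -(x j * x h * x k) / 8 * ((r ^ 3)⁻¹ * gauss r x)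
      + (kron j h * x k + kron h k * x j + kron k j * x h) / 4 * ((r ^ 2)⁻¹ * gauss r x) := by
    intro r hr
    have hr' : 0 < r := hr
    unfold d3G; field_simp
  rw [setIntegral_congr_fun measurableSet_Ioi e, integral_add
    ((integrableOn_inv_pow_mul_gauss 3 (by norm_num) hx).const_mul _)
    ((integrableOn_inv_pow_mul_gauss 2 (by norm_num) hx).const_mul _), integral_const_mul,
    integral_const_mul, integral_inv_pow_mul_gauss 3 (by norm_num) hx,
    integral_inv_pow_mul_gauss 2 (by norm_num) hx]
  have hG : Real.Gamma ((d : ℝ) / 2 + ((3 : ℕ) - 1))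
      = ((d : ℝ) / 2 + 1) * Real.Gamma (((d : ℝ) + 2) / 2) := by
    rw [show (d : ℝ) / 2 + ((3 : ℕ) - 1) = ((d : ℝ) / 2 + 1) + 1 by push_cast; ring,
      Real.Gamma_add_one (by positivity)]
    congr 2; ring
  have hG2 : (d : ℝ) / 2 + ((2 : ℕ) - 1) = ((d : ℝ) + 2) / 2 := by push_cast; ring
  rw [hG, hG2]
  unfold homKernel
  have hp : 0 < Real.pi ^ ((d : ℝ) / 2) := by positivity
  simp only [Nat.add_one_sub_one, Nat.reduceMul]
  have e4 : ‖x‖ ^ (d + 4) = ‖x‖ ^ (d + 2) * ‖x‖ ^ 2 := by rw [← pow_add]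
  rw [e4]
  field_simp
  ring

lemma GaussBd.far {n : ℕ} {φ : ℝ → Sp d → ℝ} (hφ : GaussBd n φ) (N : ℕ) :
    ∃ C : ℝ, 0 ≤ C ∧ ∀ r : ℝ, 0 < r → ∀ z : Sp d, z ≠ 0 →
      |φ r z| ≤ C * √r ^ N * ‖z‖⁻¹ ^ (d + n + N) := by
  obtain ⟨C, hC, h⟩ := hφ
  obtain ⟨K, hK, h'⟩ := exists_gauss_le_pow d (n + N)
  refine ⟨C * (K * √2 ^ (n + N)), by positivity, fun r hr z hz => ?_⟩
  have hs : 0 < √r := Real.sqrt_pos.2 hr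
  calc |φ r z| ≤ C * (√r)⁻¹ ^ n * gauss (2 * r) z := h r hr z
    _ ≤ C * (√r)⁻¹ ^ n * (K * √(2 * r) ^ (n + N) * ‖z‖⁻¹ ^ (d + (n + N))) := by
        gcongr; exact h' _ (by positivity) z hz
    _ = C * (K * √2 ^ (n + N)) * ((√r)⁻¹ * √r) ^ n * √r ^ N * ‖z‖⁻¹ ^ (d + (n + N)) := by
        rw [Real.sqrt_mul (by norm_num), mul_pow, mul_pow, pow_add √r]; ring
    _ = _ := by rw [inv_mul_cancel₀ hs.ne', one_pow, mul_one, add_assoc]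

lemma GaussBd.sup {n : ℕ} {φ : ℝ → Sp d → ℝ} (hφ : GaussBd n φ) :
    ∃ C : ℝ, 0 ≤ C ∧ ∀ r : ℝ, 0 < r → ∀ z : Sp d, |φ r z| ≤ C * (√r)⁻¹ ^ (d + n) := by
  obtain ⟨C, hC, h⟩ := hφ
  refine ⟨C, by positivity, fun r hr z => (h r hr z).trans ?_⟩
  have hs : 0 < √r := Real.sqrt_pos.2 hr
  have h1 := gauss_le (by positivity : 0 < 2 * r) z
  have h3 : (√(2 * r))⁻¹ ^ d ≤ (√r)⁻¹ ^ d := by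
    gcongr; linarith
  calc _ ≤ C * (√r)⁻¹ ^ n * (√r)⁻¹ ^ d := by gcongr; exact h1.trans h3
    _ = _ := by ring

lemma GaussBd.lipschitz_sup {n : ℕ} {φ : ℝ → Sp d → ℝ} (hd : ∀ r, Differentiable ℝ (φ r))
    (hφ : GaussBd n fun r z => ‖fderiv ℝ (φ r) z‖) :
    ∃ C : ℝ, 0 ≤ C ∧ ∀ r : ℝ, 0 < r → ∀ z z' : Sp d,
      |φ r z' - φ r z| ≤ C * (√r)⁻¹ ^ (d + n) * ‖z' - z‖ := by
  obtain ⟨C, hC, h⟩ := hφ.sup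
  refine ⟨C, hC, fun r hr z z' => ?_⟩
  refine Convex.norm_image_sub_le_of_norm_fderiv_le (𝕜 := ℝ) (s := univ) (f := φ r)
    (fun y _ => hd r y) (fun y _ => ?_) convex_univ (mem_univ _) (mem_univ _)
  simpa using h r hr y

lemma GaussBd.lipschitz_far {n : ℕ} {φ : ℝ → Sp d → ℝ} (hd : ∀ r, Differentiable ℝ (φ r))
    (hφ : GaussBd n fun r z => ‖fderiv ℝ (φ r) z‖) (N : ℕ) :
    ∃ C : ℝ, 0 ≤ C ∧ ∀ r : ℝ, 0 < r → ∀ z z' : Sp d, z ≠ 0 → ‖z' - z‖ ≤ ‖z‖ / 2 →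
      |φ r z' - φ r z| ≤ C * √r ^ N * ‖z‖⁻¹ ^ (d + n + N) * ‖z' - z‖ := by
  obtain ⟨C, hC, h⟩ := hφ.far N
  refine ⟨C * 2 ^ (d + n + N), by positivity, fun r hr z z' hz hzz => ?_⟩
  have hz' : 0 < ‖z‖ := norm_pos_iff.2 hz
  refine Convex.norm_image_sub_le_of_norm_fderiv_le (𝕜 := ℝ) (s := Metric.closedBall z (‖z‖ / 2))
    (f := φ r) (fun y _ => hd r y) (fun y hy => ?_) (convex_closedBall _ _)
    (Metric.mem_closedBall_self (by positivity)) (by rwa [mem_closedBall_iff_norm])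
  rw [mem_closedBall_iff_norm] at hy
  have hy1 : ‖z‖ / 2 ≤ ‖y‖ := by
    have := norm_sub_norm_le z y
    rw [norm_sub_rev] at this
    linarith
  have hy0 : 0 < ‖y‖ := by linarith
  have := h r hr y (norm_pos_iff.1 hy0)
  rw [abs_norm] at this
  refine this.trans ?_
  have h2 : ‖y‖⁻¹ ≤ 2 * ‖z‖⁻¹ := by
    rw [inv_le_comm₀ hy0 (by positivity)]
    refine le_trans (le_of_eq ?_) hy1
    field_simp
  calc C * √r ^ N * ‖y‖⁻¹ ^ (d + n + N) ≤ C * √r ^ N * (2 * ‖z‖⁻¹) ^ (d + n + N) := by gcongr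
    _ = _ := by rw [mul_pow]; ring

lemma differentiable_gauss (r : ℝ) : Differentiable ℝ (gauss r : Sp d → ℝ) :=
  fun z => (hasFDerivAt_gauss r z).differentiableAt

lemma differentiable_dG (h : Fin d) (r : ℝ) : Differentiable ℝ (dG h r) :=
  fun z => (hasFDerivAt_dG h r z).differentiableAt

lemma differentiable_d2G (j h : Fin d) (r : ℝ) : Differentiable ℝ (d2G j h r) :=
  fun z => (hasFDerivAt_d2G j h r z).differentiableAt

lemma differentiable_d3G (j h k : Fin d) (r : ℝ) : Differentiable ℝ (d3G j h k r) :=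
  fun z => (hasFDerivAt_d3G j h k r z).differentiableAt

lemma aestronglyMeasurable_d3G_time (j h k : Fin d) (z : Sp d) (μ : Measure ℝ) :
    AEStronglyMeasurable (fun r => d3G j h k r z) μ :=
  ((measurable_d3G j h k).comp (measurable_id.prodMk measurable_const)).aestronglyMeasurable

lemma inv_pow_mul_div_pow {ρ : ℝ} (hρ : 0 < ρ) (s : ℝ) (n : ℕ) :
    ρ⁻¹ ^ n * (ρ / s) ^ n = s⁻¹ ^ n := by
  rw [← mul_pow]; congr 1; field_simp

lemma exists_integral_d3G_le (j h k : Fin d) : ∃ C : ℝ, 0 ≤ C ∧ ∀ z : Sp d, z ≠ 0 →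
    ∀ τ : ℝ, 0 ≤ τ → |∫ r in Ioi τ, d3G j h k r z| ≤ C * ‖z‖⁻¹ ^ (d + 1) ∧
      IntegrableOn (fun r => d3G j h k r z) (Ioi τ) := by
  obtain ⟨C₁, hC₁, h₁⟩ := (gaussBd_d3G j h k).far 0
  obtain ⟨C₂, hC₂, h₂⟩ := (gaussBd_d3G j h k).sup
  obtain ⟨C, hC, H⟩ := exists_time_integral_le (p := 0) (q := d + 3) (by norm_num) (by omega)
  refine ⟨C * max C₁ C₂, by positivity, fun z hz τ hτ => ?_⟩
  have hz' : 0 < ‖z‖ := norm_pos_iff.2 hz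
  have e₁ : ∀ r, 0 < r →
      |d3G j h k r z| ≤ max C₁ C₂ * ‖z‖⁻¹ ^ (d + 3) * (‖z‖ / √r) ^ 0 := fun r hr => by
    refine (h₁ r hr z hz).trans ?_
    simp only [pow_zero, mul_one, add_zero]
    gcongr; exact le_max_left _ _
  have e₂ : ∀ r, 0 < r →
      |d3G j h k r z| ≤ max C₁ C₂ * ‖z‖⁻¹ ^ (d + 3) * (‖z‖ / √r) ^ (d + 3) := fun r hr => by
    refine (h₂ r hr z).trans ?_
    rw [mul_assoc, inv_pow_mul_div_pow hz']
    gcongr; exact le_max_right _ _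
  obtain ⟨a, b⟩ := H ‖z‖ hz' τ hτ _ _ e₁ e₂
  refine ⟨a.trans (le_of_eq ?_), b (aestronglyMeasurable_d3G_time j h k z _)⟩
  rw [show d + 3 = (d + 1) + 2 by ring, pow_add _ _ 2]
  field_simp

lemma exists_oseenDiv_le (j h k : Fin d) : ∃ C : ℝ, 0 ≤ C ∧ ∀ z : Sp d, z ≠ 0 →
    ∀ τ : ℝ, 0 < τ → |oseenDiv τ z j h k| ≤ C * ‖z‖⁻¹ ^ (d + 1) := by
  obtain ⟨C₁, hC₁, h₁⟩ := (gaussBd_dG h).far 0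
  obtain ⟨C₂, hC₂, h₂⟩ := exists_integral_d3G_le j h k
  refine ⟨C₁ + C₂, by positivity, fun z hz τ hτ => ?_⟩
  rw [oseenDiv_eq hτ]
  have a1 := h₁ τ hτ z hz
  simp only [pow_zero, mul_one, add_zero] at a1
  have a2 := (h₂ z hz τ hτ.le).1
  have a3 := mul_le_mul (abs_kron_le j k) a1 (abs_nonneg _) zero_le_one
  refine (abs_add_le _ _).trans ?_
  rw [abs_mul]
  linarith

lemma exists_homKernel_le (j h k : Fin d) : ∃ C : ℝ, 0 ≤ C ∧ ∀ z : Sp d, z ≠ 0 →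
    |homKernel z j h k| ≤ C * ‖z‖⁻¹ ^ (d + 1) := by
  obtain ⟨C₂, hC₂, h₂⟩ := exists_integral_d3G_le j h k
  refine ⟨C₂, hC₂, fun z hz => ?_⟩
  rw [← integral_d3G_eq_homKernel hz]
  exact (h₂ z hz 0 le_rfl).1

lemma exists_oseenDiv_sub_le (j h k : Fin d) : ∃ C : ℝ, 0 ≤ C ∧ ∀ z z' : Sp d, z ≠ 0 →
    ‖z' - z‖ ≤ ‖z‖ / 2 → ∀ τ : ℝ, 0 < τ →
      |oseenDiv τ z' j h k - oseenDiv τ z j h k| ≤ C * ‖z‖⁻¹ ^ (d + 2) * ‖z' - z‖ := by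
  obtain ⟨C₀, hC₀, h₀⟩ := GaussBd.lipschitz_far (differentiable_dG h) (gaussBd_fderiv_dG h) 0
  obtain ⟨C₁, hC₁, h₁⟩ :=
    GaussBd.lipschitz_far (differentiable_d3G j h k) (gaussBd_fderiv_d3G j h k) 0
  obtain ⟨C₂, hC₂, h₂⟩ := GaussBd.lipschitz_sup (differentiable_d3G j h k) (gaussBd_fderiv_d3G j h k)
  obtain ⟨C₃, hC₃, h₃⟩ := exists_integral_d3G_le j h k
  obtain ⟨C, hC, H⟩ := exists_time_integral_le (p := 0) (q := d + 4) (by norm_num) (by omega)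
  refine ⟨C₀ + C * max C₁ C₂, by positivity, fun z z' hz hzz τ hτ => ?_⟩
  have hz0 : 0 < ‖z‖ := norm_pos_iff.2 hz
  have hz' : z' ≠ 0 := by
    rintro rfl
    rw [zero_sub, norm_neg] at hzz
    linarith
  have e₁ : ∀ r, 0 < r → |d3G j h k r z' - d3G j h k r z|
      ≤ max C₁ C₂ * ‖z‖⁻¹ ^ (d + 4) * ‖z' - z‖ * (‖z‖ / √r) ^ 0 := fun r hr => by
    refine (h₁ r hr z z' hz hzz).trans ?_
    simp only [pow_zero, mul_one, add_zero]
    gcongr; exact le_max_left _ _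
  have e₂ : ∀ r, 0 < r → |d3G j h k r z' - d3G j h k r z|
      ≤ max C₁ C₂ * ‖z‖⁻¹ ^ (d + 4) * ‖z' - z‖ * (‖z‖ / √r) ^ (d + 4) := fun r hr => by
    refine (h₂ r hr z z').trans ?_
    rw [mul_right_comm _ ‖z' - z‖, mul_assoc (max C₁ C₂), inv_pow_mul_div_pow hz0]
    gcongr; exact le_max_right _ _
  obtain ⟨a, -⟩ := H ‖z‖ hz0 τ hτ.le _ _ e₁ e₂
  rw [integral_sub (h₃ z' hz' τ hτ.le).2 (h₃ z hz τ hτ.le).2] at a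
  have a1 := h₀ τ hτ z z' hz hzz
  simp only [pow_zero, mul_one, add_zero] at a1
  have a3 := mul_le_mul (abs_kron_le j k) a1 (abs_nonneg _) zero_le_one
  rw [← abs_mul] at a3
  rw [oseenDiv_eq hτ, oseenDiv_eq hτ]
  have e : C * (max C₁ C₂ * ‖z‖⁻¹ ^ (d + 4) * ‖z' - z‖ * ‖z‖ ^ 2)
      = C * max C₁ C₂ * ‖z‖⁻¹ ^ (d + 2) * ‖z' - z‖ := by
    rw [show d + 4 = (d + 2) + 2 by ring, pow_add _ _ 2]
    field_simp
  rw [e] at a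
  calc _ = |kron j k * (dG h τ z' - dG h τ z)
        + ((∫ r in Ioi τ, d3G j h k r z') - ∫ r in Ioi τ, d3G j h k r z)| := by
          congr 1; ring
    _ ≤ _ := (abs_add_le _ _).trans (add_le_add a3 a)
    _ = _ := by ring

/-- The Oseen kernel and its homogeneous limit differ by the third derivatives of the heat kernel
at the times in `(0, τ)`, which are far from the origin bounded by `|z|^{-d-3}`. -/
lemma exists_oseenDiv_sub_homKernel_le (j h k : Fin d) : ∃ C : ℝ, 0 ≤ C ∧ ∀ z : Sp d, z ≠ 0 →
    ∀ τ : ℝ, 0 < τ →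
      |oseenDiv τ z j h k - homKernel z j h k| ≤ C * τ * ‖z‖⁻¹ ^ (d + 3) := by
  obtain ⟨C₀, hC₀, h₀⟩ := (gaussBd_dG h).far 2
  obtain ⟨C₁, hC₁, h₁⟩ := (gaussBd_d3G j h k).far 0
  obtain ⟨C₃, hC₃, h₃⟩ := exists_integral_d3G_le j h k
  refine ⟨C₀ + C₁, by positivity, fun z hz τ hτ => ?_⟩
  have i0 := (h₃ z hz 0 le_rfl).2
  have hU : Ioc 0 τ ∪ Ioi τ = Ioi 0 := Ioc_union_Ioi_eq_Ioi hτ.le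
  have key : ∫ r in Ioi 0, d3G j h k r z
      = (∫ r in Ioc 0 τ, d3G j h k r z) + ∫ r in Ioi τ, d3G j h k r z := by
    rw [← hU]
    exact setIntegral_union (Ioc_disjoint_Ioi le_rfl) measurableSet_Ioi
      (i0.mono_set Ioc_subset_Ioi_self) (i0.mono_set (Ioi_subset_Ioi hτ.le))
  rw [oseenDiv_eq hτ, ← integral_d3G_eq_homKernel hz, key]
  have a1 := h₀ τ hτ z hz
  rw [Real.sq_sqrt hτ.le, show d + 1 + 2 = d + 3 by ring] at a1
  have a3 := mul_le_mul (abs_kron_le j k) a1 (abs_nonneg _) zero_le_one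
  rw [← abs_mul] at a3
  have a2 : ‖∫ r in Ioc 0 τ, d3G j h k r z‖ ≤ C₁ * ‖z‖⁻¹ ^ (d + 3) * volume.real (Ioc 0 τ) := by
    refine norm_setIntegral_le_of_norm_le_const (by simp) fun r hr => ?_
    have := h₁ r hr.1 z hz
    simpa using this
  rw [Real.volume_real_Ioc_of_le hτ.le, sub_zero, Real.norm_eq_abs] at a2
  calc _ = |kron j k * dG h τ z - ∫ r in Ioc 0 τ, d3G j h k r z| := by congr 1; ring
    _ ≤ _ := (abs_sub _ _).trans (add_le_add a3 a2)
    _ = _ := by ring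

/-! ### Convolution with the Oseen kernel -/

lemma GaussBd.integrable {n : ℕ} {φ : ℝ → Sp d → ℝ} (hφ : GaussBd n φ) {r : ℝ} (hr : 0 < r)
    (hc : Continuous (φ r)) (x : Sp d) :
    Integrable fun y => φ r (x - y) := by
  obtain ⟨C, hC, h⟩ := hφ
  have := ((integrable_gauss (d := d) (by positivity : 0 < 2 * r)).comp_sub_left x).const_mul
    (C * (√r)⁻¹ ^ n)
  exact this.mono' (by fun_prop) (Filter.Eventually.of_forall fun y => h r hr _)

lemma GaussBd.integral_le {n : ℕ} {φ : ℝ → Sp d → ℝ} (hφ : GaussBd n φ) :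
    ∃ C : ℝ, 0 ≤ C ∧ ∀ r : ℝ, 0 < r → ∀ x : Sp d, ∀ f : Sp d → ℝ, ∀ M : ℝ, (∀ y, |f y| ≤ M) →
      |∫ y, φ r (x - y) * f y| ≤ C * (√r)⁻¹ ^ n * M := by
  obtain ⟨C, hC, h⟩ := hφ
  refine ⟨C, hC, fun r hr x f M hM => ?_⟩
  have hM0 : 0 ≤ M := (abs_nonneg _).trans (hM 0)
  have i := ((integrable_gauss (d := d) (by positivity : 0 < 2 * r)).comp_sub_left x).const_mul
    (C * (√r)⁻¹ ^ n * M)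
  rw [← Real.norm_eq_abs]
  refine (norm_integral_le_of_norm_le i (Filter.Eventually.of_forall fun y => ?_)).trans ?_
  · rw [norm_mul, Real.norm_eq_abs, Real.norm_eq_abs]
    refine (mul_le_mul (h r hr (x - y)) (hM y) (abs_nonneg _) ?_).trans (le_of_eq (by ring))
    exact mul_nonneg (by positivity) (gauss_pos (by positivity) _).le
  · rw [integral_const_mul, integral_sub_left_eq_self (fun y => gauss (2 * r) y) volume x,
      integral_gauss (by positivity), mul_one]

lemma integrable_d3G_prod {τ : ℝ} (hτ : 0 < τ) (j h k : Fin d) (x : Sp d) :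
    Integrable (fun p : ℝ × Sp d => d3G j h k p.1 (x - p.2))
      ((volume.restrict (Ioi τ)).prod volume) := by
  obtain ⟨C, hC, H⟩ := gaussBd_d3G j h k
  have hm : AEStronglyMeasurable (fun p : ℝ × Sp d => d3G j h k p.1 (x - p.2))
      ((volume.restrict (Ioi τ)).prod volume) :=
    ((measurable_d3G j h k).comp (measurable_fst.prodMk (by fun_prop))).aestronglyMeasurable
  rw [integrable_prod_iff hm]
  constructor
  · refine ae_restrict_of_forall_mem measurableSet_Ioi fun r hr => ?_
    exact (gaussBd_d3G j h k).integrable (hτ.trans hr) (continuous_d3G j h k r) x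
  · have i : IntegrableOn (fun r : ℝ => C * r ^ (-((3 : ℕ) : ℝ) / 2)) (Ioi τ) :=
      (integrableOn_Ioi_rpow_of_lt (by norm_num) hτ).const_mul C
    refine i.mono' hm.norm.integral_prod_right' ?_
    refine ae_restrict_of_forall_mem measurableSet_Ioi fun r hr => ?_
    have hr0 : 0 < r := hτ.trans hr
    rw [Real.norm_of_nonneg (integral_nonneg fun _ => norm_nonneg _),
      ← sqrt_inv_pow_eq_rpow hr0 3]
    have i2 := ((integrable_gauss (d := d) (by positivity : 0 < 2 * r)).comp_sub_left x).const_mul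
      (C * (√r)⁻¹ ^ 3)
    calc _ ≤ ∫ y, C * (√r)⁻¹ ^ 3 * gauss (2 * r) (x - y) :=
          integral_mono_of_nonneg (Filter.Eventually.of_forall fun _ => norm_nonneg _) i2
            (Filter.Eventually.of_forall fun y => H r hr0 (x - y))
      _ = _ := by
          rw [integral_const_mul, integral_sub_left_eq_self (fun y => gauss (2 * r) y) volume x,
            integral_gauss (by positivity), mul_one]

lemma integrable_oseenDiv {τ : ℝ} (hτ : 0 < τ) (j h k : Fin d) (x : Sp d) :
    Integrable fun y => oseenDiv τ (x - y) j h k := by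
  simp_rw [oseenDiv_eq hτ]
  exact (((gaussBd_dG h).integrable hτ (continuous_dG h τ) x).const_mul _).add
    (integrable_d3G_prod hτ j h k x).integral_prod_right

lemma integrable_oseenDiv_mul {τ : ℝ} (hτ : 0 < τ) (j h k : Fin d) (x : Sp d) {f : Sp d → ℝ}
    (hf : AEStronglyMeasurable f volume) {M : ℝ} (hM : ∀ y, |f y| ≤ M) :
    Integrable fun y => oseenDiv τ (x - y) j h k * f y :=
  (integrable_oseenDiv hτ j h k x).mul_bdd hf (Filter.Eventually.of_forall hM)

lemma integral_oseenDiv_mul {τ : ℝ} (hτ : 0 < τ) (j h k : Fin d) (x : Sp d) {f : Sp d → ℝ}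
    (hf : AEStronglyMeasurable f volume) {M : ℝ} (hM : ∀ y, |f y| ≤ M) :
    ∫ y, oseenDiv τ (x - y) j h k * f y = kron j k * (∫ y, dG h τ (x - y) * f y)
      + ∫ r in Ioi τ, ∫ y, d3G j h k r (x - y) * f y := by
  have i1 : Integrable fun y => dG h τ (x - y) * f y :=
    ((gaussBd_dG h).integrable hτ (continuous_dG h τ) x).mul_bdd hf (Filter.Eventually.of_forall hM)
  have i2 : Integrable (fun p : ℝ × Sp d => d3G j h k p.1 (x - p.2) * f p.2)
      ((volume.restrict (Ioi τ)).prod volume) :=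
    (integrable_d3G_prod hτ j h k x).mul_bdd hf.comp_snd
      (Filter.Eventually.of_forall fun p => hM p.2)
  have e : ∀ y, oseenDiv τ (x - y) j h k * f y = kron j k * (dG h τ (x - y) * f y)
      + ∫ r in Ioi τ, d3G j h k r (x - y) * f y := by
    intro y
    rw [oseenDiv_eq hτ, integral_mul_const]
    ring
  simp_rw [e]
  rw [integral_add (i1.const_mul _) i2.integral_prod_right, integral_const_mul]
  congr 1
  exact (integral_integral_swap i2).symm

lemma measurable_oseenDiv (j h k : Fin d) :
    Measurable fun p : ℝ × Sp d => oseenDiv p.1 p.2 j h k := by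
  unfold oseenDiv
  simp_rw [Real.fourierInv_eq']
  refine Complex.measurable_re.comp ?_
  refine StronglyMeasurable.measurable (StronglyMeasurable.integral_prod_right
    (f := fun (p : ℝ × Sp d) (ξ : Sp d) =>
      Complex.exp (↑(2 * Real.pi * inner ℝ ξ p.2) * Complex.I) • (2 * (Real.pi : ℂ) * Complex.I *
      (ξ h : ℂ) * ((Real.exp (-(4 * Real.pi ^ 2 * p.1 * ‖ξ‖ ^ 2)) * leraySymbol j k ξ : ℝ) : ℂ))) ?_)
  apply Measurable.stronglyMeasurable
  unfold leraySymbol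
  simp only
  fun_prop

/-! ### Functions with bounded derivatives at a given length scale -/

/-- `f` is of class `C^n` and, at the length scale `R`, it is bounded by `M` together with its
derivatives: `|∇^k f| ≤ M R^{-k}` for `k ≤ n`. -/
def ScaleBd (n : ℕ) (f : Sp d → ℝ) (M R : ℝ) : Prop :=
  ContDiff ℝ n f ∧ ∀ k ≤ n, ∀ x, ‖iteratedFDeriv ℝ k f x‖ ≤ M * R⁻¹ ^ k

namespace ScaleBd

variable {n : ℕ} {f : Sp d → ℝ} {M R : ℝ}

lemma abs_le (h : ScaleBd n f M R) (x : Sp d) : |f x| ≤ M := by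
  have := h.2 0 (Nat.zero_le _) x
  simpa using this

lemma nonneg (h : ScaleBd n f M R) : 0 ≤ M := (abs_nonneg _).trans (h.abs_le 0)

lemma of_succ (h : ScaleBd (n + 1) f M R) : ScaleBd n f M R :=
  ⟨h.1.of_le (by norm_cast; omega), fun k hk => h.2 k (by omega)⟩

lemma continuous (h : ScaleBd n f M R) : Continuous f := h.1.continuous

lemma norm_iteratedFDeriv_sub_le (h : ScaleBd (n + 1) f M R) {k : ℕ} (hk : k ≤ n) (x y : Sp d) :
    ‖iteratedFDeriv ℝ k f y - iteratedFDeriv ℝ k f x‖ ≤ M * R⁻¹ ^ (k + 1) * ‖y - x‖ := by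
  refine Convex.norm_image_sub_le_of_norm_fderiv_le (𝕜 := ℝ) (s := univ)
    (f := iteratedFDeriv ℝ k f) (fun y _ => ?_) (fun y _ => ?_) convex_univ
    (mem_univ _) (mem_univ _)
  · exact h.1.differentiable_iteratedFDeriv (by exact_mod_cast Nat.lt_succ_of_le hk) y
  · rw [norm_fderiv_iteratedFDeriv]
    exact h.2 _ (by omega) y

lemma abs_sub_le (h : ScaleBd (n + 1) f M R) (x y : Sp d) :
    |f y - f x| ≤ M * R⁻¹ * ‖y - x‖ := by
  have hd : Differentiable ℝ f := h.1.differentiable (by norm_cast)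
  refine Convex.norm_image_sub_le_of_norm_fderiv_le (𝕜 := ℝ) (s := univ)
    (f := f) (fun y _ => hd y) (fun y _ => ?_) convex_univ (mem_univ _) (mem_univ _)
  have := h.2 1 (by omega) y
  rwa [pow_one, norm_iteratedFDeriv_one] at this

lemma sub_shift (h : ScaleBd (n + 1) f M R) (e : Sp d) :
    ScaleBd n (fun y => f y - f (y + e)) (M * R⁻¹ * ‖e‖) R := by
  have h0 : ContDiff ℝ n f := h.of_succ.1
  have h1 : ContDiff ℝ n (fun y => f (y + e)) := h0.comp (contDiff_id.add contDiff_const)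
  refine ⟨h0.sub h1, fun k hk x => ?_⟩
  have hk' : (k : ℕ∞ω) ≤ n := by exact_mod_cast hk
  have e1 : iteratedFDeriv ℝ k (fun y => f y - f (y + e)) x
      = iteratedFDeriv ℝ k f x - iteratedFDeriv ℝ k f (x + e) := by
    rw [fun_iteratedFDeriv_sub_apply (h0.of_le hk').contDiffAt (h1.of_le hk').contDiffAt,
      iteratedFDeriv_comp_add_right]
  rw [e1]
  refine (h.norm_iteratedFDeriv_sub_le hk (x + e) x).trans (le_of_eq ?_)
  rw [show x - (x + e) = -e by abel, norm_neg]
  ring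

lemma fderiv_single (h : ScaleBd (n + 1) f M R) (k : Fin d) :
    ScaleBd n (fun y => fderiv ℝ f y (EuclideanSpace.single k 1)) (M * R⁻¹) R := by
  set L : (Sp d →L[ℝ] ℝ) →L[ℝ] ℝ :=
    ContinuousLinearMap.apply ℝ ℝ (EuclideanSpace.single k (1 : ℝ) : Sp d) with hL
  have hLn : ‖L‖ ≤ 1 := by
    refine ContinuousLinearMap.opNorm_le_bound _ zero_le_one fun A => ?_
    have := A.le_opNorm (EuclideanSpace.single k (1 : ℝ))
    simpa [hL] using this
  have hf : ContDiff ℝ n (fderiv ℝ f) := h.1.fderiv_right (by norm_cast)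
  refine ⟨L.contDiff.comp hf, fun m hm x => ?_⟩
  have hm' : (m : ℕ∞ω) ≤ n := by exact_mod_cast hm
  have := L.norm_iteratedFDeriv_comp_left (f := fderiv ℝ f) (x := x) (hf.of_le hm').contDiffAt le_rfl
  rw [norm_iteratedFDeriv_fderiv] at this
  refine this.trans ?_
  have h2 := h.2 (m + 1) (by omega) x
  calc _ ≤ 1 * (M * R⁻¹ ^ (m + 1)) := by gcongr
    _ = _ := by ring

end ScaleBd

/-! ### Regularising effect of the heat and Oseen kernels on such functions -/

lemma integral_fderiv_mul_eq {φ f : Sp d → ℝ} (hφ : Differentiable ℝ φ) (hf : Differentiable ℝ f)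
    (v x : Sp d) (i1 : Integrable fun y => φ (x - y) * f y)
    (i2 : Integrable fun y => fderiv ℝ φ (x - y) v * f y)
    (i3 : Integrable fun y => φ (x - y) * fderiv ℝ f y v) :
    ∫ y, fderiv ℝ φ (x - y) v * f y = ∫ y, φ (x - y) * fderiv ℝ f y v := by
  have hd : ∀ y, HasFDerivAt (fun y => φ (x - y))
      ((fderiv ℝ φ (x - y)).comp (-ContinuousLinearMap.id ℝ (Sp d))) y := fun y =>
    (hφ (x - y)).hasFDerivAt.comp y ((hasFDerivAt_id y).const_sub x)
  have e : ∀ y, fderiv ℝ (fun y => φ (x - y)) y v = -(fderiv ℝ φ (x - y) v) := fun y => by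
    rw [(hd y).fderiv]; simp
  have := integral_mul_fderiv_eq_neg_fderiv_mul_of_integrable (μ := volume)
    (f := fun y => φ (x - y)) (g := f) (v := v)
    (by simp_rw [e, neg_mul]; exact i2.neg) i3 i1 (fun y _ => (hd y).differentiableAt) fun y _ => hf y
  rw [this]
  simp_rw [e, neg_mul]
  rw [integral_neg, neg_neg]

lemma ScaleBd.integral_dG_mul {f : Sp d → ℝ} {M R : ℝ} (hf : ScaleBd 1 f M R) {r : ℝ} (hr : 0 < r)
    (h : Fin d) (x : Sp d) :
    ∫ y, dG h r (x - y) * f y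
      = ∫ y, gauss r (x - y) * fderiv ℝ f y (EuclideanSpace.single h 1) := by
  have hf' := hf.fderiv_single h
  have := integral_fderiv_mul_eq (differentiable_gauss r) (hf.1.differentiable (by norm_num))
    (EuclideanSpace.single h 1) x
    ((gaussBd_gauss.integrable hr (continuous_gauss r) x).mul_bdd
      hf.continuous.aestronglyMeasurable (Filter.Eventually.of_forall hf.abs_le))
    (by
      simp_rw [fderiv_gauss_single]
      exact ((gaussBd_dG h).integrable hr (continuous_dG h r) x).mul_bdd
        hf.continuous.aestronglyMeasurable (Filter.Eventually.of_forall hf.abs_le))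
    ((gaussBd_gauss.integrable hr (continuous_gauss r) x).mul_bdd
      hf'.continuous.aestronglyMeasurable (Filter.Eventually.of_forall hf'.abs_le))
  simpa only [fderiv_gauss_single] using this

lemma ScaleBd.integral_d3G_mul {f : Sp d → ℝ} {M R : ℝ} (hf : ScaleBd 2 f M R) {r : ℝ} (hr : 0 < r)
    (j h k : Fin d) (x : Sp d) :
    ∫ y, d3G j h k r (x - y) * f y
      = ∫ y, dG k r (x - y) * fderiv ℝ (fun y => fderiv ℝ f y (EuclideanSpace.single j 1)) y
          (EuclideanSpace.single h 1) := by
  have hf1 := hf.fderiv_single j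
  have hf2 := hf1.fderiv_single h
  have s1 := integral_fderiv_mul_eq (differentiable_d2G h k r) (hf.1.differentiable (by norm_num))
    (EuclideanSpace.single j 1) x
    (((gaussBd_d2G h k).integrable hr (continuous_d2G h k r) x).mul_bdd
      hf.continuous.aestronglyMeasurable (Filter.Eventually.of_forall hf.abs_le))
    (by
      simp_rw [fderiv_d2G_single]
      exact ((gaussBd_d3G j h k).integrable hr (continuous_d3G j h k r) x).mul_bdd
        hf.continuous.aestronglyMeasurable (Filter.Eventually.of_forall hf.abs_le))
    (((gaussBd_d2G h k).integrable hr (continuous_d2G h k r) x).mul_bdd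
      hf1.continuous.aestronglyMeasurable (Filter.Eventually.of_forall hf1.abs_le))
  have s2 := integral_fderiv_mul_eq (differentiable_dG k r) (hf1.1.differentiable (by norm_num))
    (EuclideanSpace.single h 1) x
    (((gaussBd_dG k).integrable hr (continuous_dG k r) x).mul_bdd
      hf1.continuous.aestronglyMeasurable (Filter.Eventually.of_forall hf1.abs_le))
    (by
      simp_rw [fderiv_dG_single]
      exact ((gaussBd_d2G h k).integrable hr (continuous_d2G h k r) x).mul_bdd
        hf1.continuous.aestronglyMeasurable (Filter.Eventually.of_forall hf1.abs_le))
    (((gaussBd_dG k).integrable hr (continuous_dG k r) x).mul_bdd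
      hf2.continuous.aestronglyMeasurable (Filter.Eventually.of_forall hf2.abs_le))
  simp only [fderiv_d2G_single, fderiv_dG_single] at s1 s2
  rw [s1, s2]

/-- Convolution with the Oseen kernel gains one derivative, uniformly in time, on functions
with two bounded derivatives: of the three derivatives of the heat kernel, two are moved onto the
function for times before `R²`, and none for later times. -/
lemma exists_integral_oseenDiv_mul_le (j h k : Fin d) : ∃ C : ℝ, 0 ≤ C ∧
    ∀ τ : ℝ, 0 < τ → ∀ (f : Sp d → ℝ) (M R : ℝ), 0 < R → ScaleBd 2 f M R → ∀ x : Sp d,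
      |∫ y, oseenDiv τ (x - y) j h k * f y| ≤ C * (M * R⁻¹) := by
  obtain ⟨C₀, hC₀, h₀⟩ := (gaussBd_gauss (d := d)).integral_le
  obtain ⟨C₁, hC₁, h₁⟩ := (gaussBd_dG k).integral_le
  obtain ⟨C₃, hC₃, h₃⟩ := (gaussBd_d3G j h k).integral_le
  obtain ⟨C, hC, H⟩ := exists_time_integral_le (p := 1) (q := 3) (by norm_num) (by norm_num)
  refine ⟨C₀ + C * max C₁ C₃, by positivity, fun τ hτ f M R hR hf x => ?_⟩
  have hM := hf.nonneg
  have hf1 := (hf.of_succ).fderiv_single h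
  have hf2 := (hf.fderiv_single j).fderiv_single h
  rw [integral_oseenDiv_mul hτ j h k x hf.continuous.aestronglyMeasurable hf.abs_le]
  have a1 := h₀ τ hτ x _ _ hf1.abs_le
  rw [← hf.of_succ.integral_dG_mul hτ h x, pow_zero, mul_one] at a1
  have a3 := mul_le_mul (abs_kron_le j k) a1 (abs_nonneg _) zero_le_one
  rw [← abs_mul] at a3
  have e₁ : ∀ r, 0 < r → |∫ y, d3G j h k r (x - y) * f y|
      ≤ max C₁ C₃ * (M * R⁻¹ ^ 3) * (R / √r) ^ 1 := fun r hr => by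
    rw [hf.integral_d3G_mul hr]
    refine (h₁ r hr x _ _ hf2.abs_le).trans ?_
    have : max C₁ C₃ * (M * R⁻¹ ^ 3) * (R / √r) ^ 1 = max C₁ C₃ * (√r)⁻¹ ^ 1 * (M * R⁻¹ * R⁻¹) := by
      field_simp
    rw [this]
    gcongr; exact le_max_left _ _
  have e₂ : ∀ r, 0 < r → |∫ y, d3G j h k r (x - y) * f y|
      ≤ max C₁ C₃ * (M * R⁻¹ ^ 3) * (R / √r) ^ 3 := fun r hr => by
    refine (h₃ r hr x _ _ hf.abs_le).trans ?_
    have : max C₁ C₃ * (M * R⁻¹ ^ 3) * (R / √r) ^ 3 = max C₁ C₃ * (√r)⁻¹ ^ 3 * M := by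
      field_simp
    rw [this]
    gcongr; exact le_max_right _ _
  have a2 := (H R hR τ hτ.le _ _ e₁ e₂).1
  have e3 : C * (max C₁ C₃ * (M * R⁻¹ ^ 3) * R ^ 2) = C * max C₁ C₃ * (M * R⁻¹) := by
    field_simp
  rw [e3] at a2
  refine (abs_add_le _ _).trans ((add_le_add a3 a2).trans (le_of_eq ?_))
  ring

lemma dG_neg (h : Fin d) (r : ℝ) (z : Sp d) : dG h r (-z) = -dG h r z := by
  simp [dG, gauss_neg, neg_div]

lemma d3G_neg (j h k : Fin d) (r : ℝ) (z : Sp d) : d3G j h k r (-z) = -d3G j h k r z := by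
  simp only [d3G, gauss_neg, PiLp.neg_apply]; ring

lemma integral_eq_zero_of_odd {φ : Sp d → ℝ} (h : ∀ z, φ (-z) = -φ z) (x : Sp d) :
    ∫ y, φ (x - y) = 0 := by
  rw [integral_sub_left_eq_self φ volume x]
  have := integral_neg_eq_self φ volume
  simp_rw [h, integral_neg] at this
  linarith

/-- Convolution with an odd kernel gains a power of the time on Lipschitz functions. -/
lemma GaussBd.integral_le_of_lipschitz {n : ℕ} {φ : ℝ → Sp d → ℝ} (hφ : GaussBd n φ)
    (hodd : ∀ r z, φ r (-z) = -φ r z) (hc : ∀ r, Continuous (φ r)) :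
    ∃ C : ℝ, 0 ≤ C ∧ ∀ r : ℝ, 0 < r → ∀ x : Sp d, ∀ f : Sp d → ℝ, ∀ M L : ℝ,
      AEStronglyMeasurable f volume → (∀ y, |f y| ≤ M) → 0 ≤ L → (∀ y, |f y - f x| ≤ L * ‖y - x‖) →
      |∫ y, φ r (x - y) * f y| ≤ C * ((√r)⁻¹ ^ n * √r) * L := by
  obtain ⟨C, hC, h⟩ := id hφ
  obtain ⟨K, hK, h'⟩ := exists_pow_mul_gauss_le d 1
  refine ⟨C * (K * √2), by positivity, fun r hr x f M L hf hM hL0 hL => ?_⟩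
  have i0 : Integrable fun y => φ r (x - y) := hφ.integrable hr (hc r) x
  have i1 : Integrable fun y => φ r (x - y) * f y := i0.mul_bdd hf (Filter.Eventually.of_forall hM)
  have e : ∫ y, φ r (x - y) * f y = ∫ y, φ r (x - y) * (f y - f x) := by
    simp_rw [mul_sub]
    rw [integral_sub i1 (i0.mul_const _), integral_mul_const, integral_eq_zero_of_odd (hodd r)]
    ring
  have hs : √(2 * r) = √2 * √r := Real.sqrt_mul (by norm_num) r
  have i := ((integrable_gauss (d := d) (by positivity : 0 < 2 * (2 * r))).comp_sub_left x).const_mul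
    (C * (K * √2) * ((√r)⁻¹ ^ n * √r) * L)
  rw [e, ← Real.norm_eq_abs]
  refine (norm_integral_le_of_norm_le i (Filter.Eventually.of_forall fun y => ?_)).trans ?_
  · rw [norm_mul, Real.norm_eq_abs, Real.norm_eq_abs]
    have h2 := h' (2 * r) (by positivity) (x - y)
    rw [pow_one, pow_one, hs] at h2
    have hg := gauss_pos (by positivity : 0 < 2 * r) (x - y)
    calc |φ r (x - y)| * |f y - f x| ≤ (C * (√r)⁻¹ ^ n * gauss (2 * r) (x - y)) * (L * ‖x - y‖) := by
          rw [norm_sub_rev x y]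
          exact mul_le_mul (h r hr _) (hL y) (abs_nonneg _) (by positivity)
      _ = C * (√r)⁻¹ ^ n * L * (‖x - y‖ * gauss (2 * r) (x - y)) := by ring
      _ ≤ C * (√r)⁻¹ ^ n * L * (K * (√2 * √r) * gauss (2 * (2 * r)) (x - y)) := by gcongr
      _ = _ := by ring
  · rw [integral_const_mul, integral_sub_left_eq_self (fun y => gauss (2 * (2 * r)) y) volume x,
      integral_gauss (by positivity), mul_one]

/-- For functions that are only Lipschitz, the gain of one derivative by the Oseen kernel costs a
logarithm. -/
lemma exists_integral_oseenDiv_mul_le_log (j h k : Fin d) : ∃ C : ℝ, 0 ≤ C ∧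
    ∀ τ : ℝ, 0 < τ → ∀ (f : Sp d → ℝ) (M R : ℝ), 0 < R → AEStronglyMeasurable f volume →
      (∀ y, |f y| ≤ M) → ∀ x : Sp d, (∀ y, |f y - f x| ≤ M * R⁻¹ * ‖y - x‖) →
      |∫ y, oseenDiv τ (x - y) j h k * f y| ≤ C * (M * R⁻¹) * (1 + Real.log (1 + R ^ 2 / τ)) := by
  obtain ⟨C₀, hC₀, h₀⟩ := (gaussBd_dG h).integral_le_of_lipschitz (dG_neg h) (continuous_dG h)
  obtain ⟨C₁, hC₁, h₁⟩ :=
    (gaussBd_d3G j h k).integral_le_of_lipschitz (d3G_neg j h k) (continuous_d3G j h k)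
  obtain ⟨C₃, hC₃, h₃⟩ := (gaussBd_d3G j h k).integral_le
  obtain ⟨C, hC, H⟩ := exists_time_integral_log_le
  refine ⟨C₀ + C * max C₁ C₃, by positivity, fun τ hτ f M R hR hf hM x hL => ?_⟩
  have hM0 : 0 ≤ M := (abs_nonneg _).trans (hM 0)
  rw [integral_oseenDiv_mul hτ j h k x hf hM]
  have a1 := h₀ τ hτ x f M _ hf hM (by positivity) hL
  have hsτ : (√τ)⁻¹ ^ 1 * √τ = 1 := by
    have := Real.sqrt_pos.2 hτ
    field_simp
  rw [hsτ, mul_one] at a1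
  have a3 := mul_le_mul (abs_kron_le j k) a1 (abs_nonneg _) zero_le_one
  rw [← abs_mul] at a3
  have e₁ : ∀ r, 0 < r → |∫ y, d3G j h k r (x - y) * f y|
      ≤ max C₁ C₃ * (M * R⁻¹ ^ 3) * (R / √r) ^ 2 := fun r hr => by
    refine (h₁ r hr x f M _ hf hM (by positivity) hL).trans ?_
    have hs := Real.sqrt_pos.2 hr
    have : max C₁ C₃ * (M * R⁻¹ ^ 3) * (R / √r) ^ 2
        = max C₁ C₃ * ((√r)⁻¹ ^ 3 * √r) * (M * R⁻¹) := by
      field_simp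
    rw [this]
    gcongr; exact le_max_left _ _
  have e₂ : ∀ r, 0 < r → |∫ y, d3G j h k r (x - y) * f y|
      ≤ max C₁ C₃ * (M * R⁻¹ ^ 3) * (R / √r) ^ 3 := fun r hr => by
    refine (h₃ r hr x _ _ hM).trans ?_
    have : max C₁ C₃ * (M * R⁻¹ ^ 3) * (R / √r) ^ 3 = max C₁ C₃ * (√r)⁻¹ ^ 3 * M := by
      field_simp
    rw [this]
    gcongr; exact le_max_right _ _
  have a2 := H R hR τ hτ _ _ e₁ e₂
  have e3 : C * (max C₁ C₃ * (M * R⁻¹ ^ 3) * R ^ 2) = C * max C₁ C₃ * (M * R⁻¹) := by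
    field_simp
  rw [e3] at a2
  have hlog : 0 ≤ Real.log (1 + R ^ 2 / τ) :=
    Real.log_nonneg (by have : 0 < R ^ 2 / τ := by positivity
                        linarith)
  have : 0 ≤ C₀ * (M * R⁻¹) * Real.log (1 + R ^ 2 / τ) := by positivity
  refine (abs_add_le _ _).trans ((add_le_add a3 a2).trans ?_)
  linarith

/-- The heat semigroup is close to the identity on functions with two bounded derivatives; the
first order term of the Taylor expansion cancels by symmetry. -/
lemma exists_heat_sub_le (d : ℕ) : ∃ C : ℝ, 0 ≤ C ∧
    ∀ s : ℝ, 0 < s → ∀ (f : Sp d → ℝ) (M R : ℝ), ScaleBd 2 f M R → ∀ x : Sp d,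
      |(∫ y, gauss s (x - y) * f y) - f x| ≤ C * s * (M * R⁻¹ * R⁻¹) := by
  obtain ⟨C, hC, h⟩ := exists_pow_mul_gauss_le d 2
  refine ⟨C, hC, fun s hs f M R hf x => ?_⟩
  have e1 : ∫ y, gauss s (x - y) * f y = ∫ z, gauss s z * f (x - z) := by
    rw [← integral_sub_left_eq_self (fun z => gauss s z * f (x - z)) volume x]
    simp
  have e2 : ∫ y, gauss s (x - y) * f y = ∫ z, gauss s z * f (x + z) := by
    rw [e1, ← integral_neg_eq_self]
    simp [gauss_neg]
  have hi := integrable_gauss (d := d) hs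
  have i1 : Integrable fun z => gauss s z * f (x - z) :=
    hi.mul_bdd (hf.continuous.comp (by fun_prop : Continuous fun z => x - z)).aestronglyMeasurable
      (Filter.Eventually.of_forall fun z => hf.abs_le _)
  have i2 : Integrable fun z => gauss s z * f (x + z) :=
    hi.mul_bdd (hf.continuous.comp (by fun_prop : Continuous fun z => x + z)).aestronglyMeasurable
      (Filter.Eventually.of_forall fun z => hf.abs_le _)
  have e3 : 2 * ((∫ y, gauss s (x - y) * f y) - f x)
      = ∫ z, gauss s z * (f (x - z) + f (x + z) - 2 * f x) := by
    have : ∀ z, gauss s z * (f (x - z) + f (x + z) - 2 * f x)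
        = (gauss s z * f (x - z) + gauss s z * f (x + z)) - gauss s z * (2 * f x) := fun z => by ring
    simp_rw [this]
    have i12 : Integrable fun z => gauss s z * f (x - z) + gauss s z * f (x + z) := i1.add i2
    rw [integral_sub i12 (hi.mul_const _), integral_add i1 i2, ← e1, ← e2, integral_mul_const,
      integral_gauss hs]
    ring
  have hsd : ∀ z, |f (x - z) + f (x + z) - 2 * f x| ≤ M * R⁻¹ * R⁻¹ * ‖z‖ ^ 2 := by
    intro z
    have h2 := (hf.sub_shift z).abs_sub_le x (x - z)
    simp only [sub_add_cancel] at h2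
    rw [show x - z - x = -z by abel, norm_neg] at h2
    calc _ = |f (x - z) - f x - (f x - f (x + z))| := by congr 1; ring
      _ ≤ _ := h2
      _ = _ := by ring
  have i := (integrable_gauss (d := d) (by positivity : 0 < 2 * s)).const_mul
    (C * s * (M * R⁻¹ * R⁻¹))
  have key : |∫ z, gauss s z * (f (x - z) + f (x + z) - 2 * f x)| ≤ C * s * (M * R⁻¹ * R⁻¹) := by
    rw [← Real.norm_eq_abs]
    refine (norm_integral_le_of_norm_le i (Filter.Eventually.of_forall fun z => ?_)).trans ?_
    · rw [norm_mul, Real.norm_eq_abs, Real.norm_eq_abs, abs_of_pos (gauss_pos hs z)]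
      have h2 := h s hs z
      rw [Real.sq_sqrt hs.le] at h2
      have hg := gauss_pos hs z
      have hA : 0 ≤ M * R⁻¹ * R⁻¹ := by
        have := hf.nonneg
        rw [mul_assoc]
        exact mul_nonneg this (mul_self_nonneg _)
      calc _ ≤ gauss s z * (M * R⁻¹ * R⁻¹ * ‖z‖ ^ 2) := by gcongr; exact hsd z
        _ = (M * R⁻¹ * R⁻¹) * (‖z‖ ^ 2 * gauss s z) := by ring
        _ ≤ (M * R⁻¹ * R⁻¹) * (C * s * gauss (2 * s) z) := by gcongr
        _ = _ := by ring
    · rw [integral_const_mul, integral_gauss (by positivity), mul_one]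
  rw [← e3, abs_mul, abs_two] at key
  have := abs_nonneg ((∫ y, gauss s (x - y) * f y) - f x)
  linarith

/-! ### Radial integrals -/

lemma integrableOn_radial {S : Set ℝ} (hS : MeasurableSet S) (f : ℝ → ℝ) (hd : 0 < d)
    (h : IntegrableOn (fun r => r ^ (d - 1) * f r) (Ioi 0 ∩ S)) :
    IntegrableOn (fun y : Sp d => f ‖y‖) (norm ⁻¹' S) := by
  have : Nontrivial (Sp d) := by
    have : Nonempty (Fin d) := ⟨⟨0, hd⟩⟩
    infer_instance
  rw [← integrable_indicator_iff (measurable_norm hS)]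
  have e : (norm ⁻¹' S).indicator (fun y : Sp d => f ‖y‖) = fun y => S.indicator f ‖y‖ := by
    funext y; by_cases hy : ‖y‖ ∈ S <;> simp [hy]
  rw [e, integrable_fun_norm_addHaar volume, finrank_euclideanSpace_fin]
  have e2 : (fun r : ℝ => r ^ (d - 1) • S.indicator f r)
      = S.indicator fun r => r ^ (d - 1) * f r := by
    funext r; by_cases hr : r ∈ S <;> simp [hr]
  rw [e2, integrableOn_indicator_iff hS, inter_comm]
  exact h

lemma setIntegral_radial {S : Set ℝ} (hS : MeasurableSet S) (f : ℝ → ℝ) (hd : 0 < d) :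
    ∫ y : Sp d in norm ⁻¹' S, f ‖y‖
      = d * volume.real (Metric.ball (0 : Sp d) 1) * ∫ r in Ioi 0 ∩ S, r ^ (d - 1) * f r := by
  have : Nontrivial (Sp d) := by
    have : Nonempty (Fin d) := ⟨⟨0, hd⟩⟩
    infer_instance
  rw [← integral_indicator (measurable_norm hS)]
  have e : (norm ⁻¹' S).indicator (fun y : Sp d => f ‖y‖) = fun y => S.indicator f ‖y‖ := by
    funext y; by_cases hy : ‖y‖ ∈ S <;> simp [hy]
  rw [e, integral_fun_norm_addHaar volume, finrank_euclideanSpace_fin]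
  have e2 : (fun r : ℝ => r ^ (d - 1) • S.indicator f r)
      = S.indicator fun r => r ^ (d - 1) * f r := by
    funext r; by_cases hr : r ∈ S <;> simp [hr]
  rw [e2, setIntegral_indicator hS]
  simp [mul_assoc]

lemma exists_integral_inv_norm_pow_le {θ : ℕ} (hθ : θ < d) : ∃ C : ℝ, 0 ≤ C ∧ ∀ R : ℝ, 0 < R →
    IntegrableOn (fun y : Sp d => ‖y‖⁻¹ ^ θ) (norm ⁻¹' Iic R) ∧
      ∫ y : Sp d in norm ⁻¹' Iic R, ‖y‖⁻¹ ^ θ ≤ C * (R ^ d * R⁻¹ ^ θ) := by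
  obtain ⟨n, rfl⟩ : ∃ n, d = θ + n + 1 := ⟨d - θ - 1, by omega⟩
  refine ⟨_, (by positivity : 0 ≤ ((θ + n + 1 : ℕ) : ℝ) *
    volume.real (Metric.ball (0 : Sp (θ + n + 1)) 1)), fun R hR => ?_⟩
  have e : EqOn (fun r : ℝ => r ^ n) (fun r : ℝ => r ^ (θ + n + 1 - 1) * r⁻¹ ^ θ) (Ioc 0 R) := by
    intro r hr
    have := hr.1
    simp only [Nat.add_sub_cancel, pow_add, inv_pow]
    field_simp
  have i : IntegrableOn (fun r : ℝ => r ^ n) (Ioc 0 R) :=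
    (continuous_pow n).integrableOn_Icc.mono_set Ioc_subset_Icc_self
  have hset : Ioi 0 ∩ Iic R = Ioc 0 R := Ioi_inter_Iic
  constructor
  · refine integrableOn_radial measurableSet_Iic (fun r => r⁻¹ ^ θ) (by omega) ?_
    rw [hset]
    exact (integrableOn_congr_fun e measurableSet_Ioc).1 i
  · rw [setIntegral_radial measurableSet_Iic (fun r => r⁻¹ ^ θ) (by omega), hset,
      ← setIntegral_congr_fun measurableSet_Ioc e, ← intervalIntegral.integral_of_le hR.le,
      integral_pow]
    gcongr
    have : R ^ (θ + n + 1) * R⁻¹ ^ θ = R ^ (n + 1) := by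
      simp only [pow_add, inv_pow]; field_simp
    rw [this]
    simp only [ne_eq, Nat.add_eq_zero_iff, one_ne_zero, and_false, not_false_eq_true, zero_pow,
      sub_zero]
    exact div_le_self (by positivity) (by linarith [Nat.cast_nonneg (α := ℝ) n])

lemma exists_integral_far_inv_norm_pow_le {θ : ℕ} (hd : 0 < d) (hθ : d < θ) :
    ∃ C : ℝ, 0 ≤ C ∧ ∀ R : ℝ, 0 < R →
    IntegrableOn (fun y : Sp d => ‖y‖⁻¹ ^ θ) (norm ⁻¹' Ioi R) ∧
      ∫ y : Sp d in norm ⁻¹' Ioi R, ‖y‖⁻¹ ^ θ ≤ C * (R ^ d * R⁻¹ ^ θ) := by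
  obtain ⟨m, rfl⟩ : ∃ m, d = m + 1 := ⟨d - 1, by omega⟩
  obtain ⟨n, rfl⟩ : ∃ n, θ = m + 1 + n + 1 := ⟨θ - m - 2, by omega⟩
  refine ⟨_, (by positivity : 0 ≤ ((m + 1 : ℕ) : ℝ) *
    volume.real (Metric.ball (0 : Sp (m + 1)) 1)), fun R hR => ?_⟩
  have e : EqOn (fun r : ℝ => r ^ (-((n : ℝ) + 2)))
      (fun r : ℝ => r ^ (m + 1 - 1) * r⁻¹ ^ (m + 1 + n + 1)) (Ioi R) := by
    intro r hr
    have hr0 : 0 < r := hR.trans hr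
    simp only [Nat.add_sub_cancel]
    rw [Real.rpow_neg hr0.le, show (n : ℝ) + 2 = ((n + 2 : ℕ) : ℝ) by push_cast; ring,
      Real.rpow_natCast, show m + 1 + n + 1 = m + (n + 2) by ring, inv_pow, pow_add,
      pow_add r m, pow_add r n]
    field_simp
  have hn : (0 : ℝ) ≤ n := Nat.cast_nonneg n
  have i : IntegrableOn (fun r : ℝ => r ^ (-((n : ℝ) + 2))) (Ioi R) :=
    integrableOn_Ioi_rpow_of_lt (by linarith) hR
  have hset : Ioi 0 ∩ Ioi R = Ioi R := inter_eq_right.2 (Ioi_subset_Ioi hR.le)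
  constructor
  · refine integrableOn_radial measurableSet_Ioi (fun r => r⁻¹ ^ (m + 1 + n + 1)) (by omega) ?_
    rw [hset]
    exact (integrableOn_congr_fun e measurableSet_Ioi).1 i
  · rw [setIntegral_radial measurableSet_Ioi (fun r => r⁻¹ ^ (m + 1 + n + 1)) (by omega), hset,
      ← setIntegral_congr_fun measurableSet_Ioi e, integral_Ioi_rpow_of_lt (by linarith) hR]
    gcongr
    have h1 : R ^ (m + 1) * R⁻¹ ^ (m + 1 + n + 1) = (R ^ (n + 1))⁻¹ := by
      simp only [pow_add, inv_pow]; field_simp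
    have h2 : R ^ (-((n : ℝ) + 2) + 1) = (R ^ (n + 1))⁻¹ := by
      rw [show -((n : ℝ) + 2) + 1 = -((n + 1 : ℕ) : ℝ) by push_cast; ring, Real.rpow_neg hR.le,
        Real.rpow_natCast]
    rw [h1, h2, show -((n : ℝ) + 2) + 1 = -((n : ℝ) + 1) by ring, neg_div_neg_eq]
    exact div_le_self (by positivity) (by linarith)

lemma exists_integral_log_le (hd : 0 < d) : ∃ C : ℝ, 0 ≤ C ∧ ∀ R : ℝ, 0 < R → ∀ σ : ℝ, 0 < σ →
    IntegrableOn (fun y : Sp d => (σ + ‖y‖)⁻¹ ^ d) (norm ⁻¹' Iic R) ∧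
      ∫ y : Sp d in norm ⁻¹' Iic R, (σ + ‖y‖)⁻¹ ^ d ≤ C * Real.log (1 + R / σ) := by
  obtain ⟨m, rfl⟩ : ∃ m, d = m + 1 := ⟨d - 1, by omega⟩
  refine ⟨_, (by positivity : 0 ≤ ((m + 1 : ℕ) : ℝ) *
    volume.real (Metric.ball (0 : Sp (m + 1)) 1)), fun R hR σ hσ => ?_⟩
  have hset : Ioi 0 ∩ Iic R = Ioc 0 R := Ioi_inter_Iic
  have i1 : ContinuousOn (fun r : ℝ => r ^ (m + 1 - 1) * (σ + r)⁻¹ ^ (m + 1)) (Icc 0 R) := by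
    refine ContinuousOn.mul (by fun_prop) (ContinuousOn.pow (ContinuousOn.inv₀ (by fun_prop) ?_) _)
    intro r hr
    have := hr.1
    positivity
  have i2 : ContinuousOn (fun r : ℝ => (σ + r)⁻¹) (Icc 0 R) := by
    refine ContinuousOn.inv₀ (by fun_prop) ?_
    intro r hr
    have := hr.1
    positivity
  have j1 := i1.integrableOn_Icc.mono_set (Ioc_subset_Icc_self (a := (0 : ℝ)) (b := R)) (μ := volume)
  have j2 := i2.integrableOn_Icc.mono_set (Ioc_subset_Icc_self (a := (0 : ℝ)) (b := R)) (μ := volume)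
  constructor
  · refine integrableOn_radial measurableSet_Iic (fun r => (σ + r)⁻¹ ^ (m + 1)) (by omega) ?_
    rwa [hset]
  · rw [setIntegral_radial measurableSet_Iic (fun r => (σ + r)⁻¹ ^ (m + 1)) (by omega), hset]
    gcongr
    calc _ ≤ ∫ r in Ioc 0 R, (σ + r)⁻¹ := by
          refine setIntegral_mono_on j1 j2 measurableSet_Ioc fun r hr => ?_
          have hr0 := hr.1
          simp only [Nat.add_sub_cancel, pow_succ]
          have : r ^ m * (σ + r)⁻¹ ^ m ≤ 1 := by
            rw [← mul_pow]
            refine pow_le_one₀ (by positivity) ?_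
            rw [← div_eq_mul_inv, div_le_one (by positivity)]
            linarith
          calc _ = r ^ m * (σ + r)⁻¹ ^ m * (σ + r)⁻¹ := by ring
            _ ≤ 1 * (σ + r)⁻¹ := by gcongr
            _ = _ := one_mul _
      _ = Real.log (1 + R / σ) := by
          rw [← intervalIntegral.integral_of_le hR.le,
            intervalIntegral.integral_comp_add_left (fun r => r⁻¹) σ,
            integral_inv_of_pos (by linarith) (by linarith)]
          congr 1; field_simp; ring

/-! ### Functions homogeneously bounded away from the origin, and the cut-off -/

/-- `w` is of class `C^3` away from the origin and `|x|^{θ+k} |∇^k w(x)| ≤ A` for `k ≤ 3`. -/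
def HomBd (θ : ℕ) (w : Sp d → ℝ) (A : ℝ) : Prop :=
  ContDiffOn ℝ 3 w {0}ᶜ ∧
    ∀ k ≤ 3, ∀ x, x ≠ 0 → ‖iteratedFDeriv ℝ k w x‖ ≤ A * ‖x‖⁻¹ ^ (θ + k)

lemma HomBd.abs_le {θ : ℕ} {w : Sp d → ℝ} {A : ℝ} (h : HomBd θ w A) {x : Sp d} (hx : x ≠ 0) :
    |w x| ≤ A * ‖x‖⁻¹ ^ θ := by
  simpa using h.2 0 (by norm_num) x hx

lemma norm_iteratedFDeriv_mul_le_of_contDiffOn {f g : Sp d → ℝ} (hf : ContDiffOn ℝ 3 f {0}ᶜ)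
    (hg : ContDiffOn ℝ 3 g {0}ᶜ) {x : Sp d} (hx : x ≠ 0) {k : ℕ} (hk : k ≤ 3) :
    ‖iteratedFDeriv ℝ k (fun y => f y * g y) x‖ ≤ ∑ i ∈ Finset.range (k + 1),
      (k.choose i : ℝ) * ‖iteratedFDeriv ℝ i f x‖ * ‖iteratedFDeriv ℝ (k - i) g x‖ := by
  have ho : IsOpen ({0}ᶜ : Set (Sp d)) := isOpen_compl_singleton
  have := norm_iteratedFDerivWithin_mul_le hf hg ho.uniqueDiffOn hx (n := k)
    (by exact_mod_cast hk)
  simpa only [iteratedFDerivWithin_of_isOpen _ ho (mem_compl_singleton_iff.2 hx)] using this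

lemma sum_choose_mul_le {k : ℕ} (hk : k ≤ 3) {B : ℝ} (hB : 0 ≤ B) {f : ℕ → ℝ}
    (h : ∀ i ≤ k, f i ≤ B) : ∑ i ∈ Finset.range (k + 1), (k.choose i : ℝ) * f i ≤ 8 * B := by
  calc _ ≤ ∑ i ∈ Finset.range (k + 1), (k.choose i : ℝ) * B := by
        refine Finset.sum_le_sum fun i hi => ?_
        have := h i (by simpa [Nat.lt_succ_iff] using hi)
        gcongr
    _ = (2 : ℝ) ^ k * B := by
        rw [← Finset.sum_mul]
        congr 1
        exact_mod_cast Nat.sum_range_choose k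
    _ ≤ (2 : ℝ) ^ 3 * B := by gcongr; norm_num
    _ = _ := by norm_num

lemma HomBd.mul {θ θ' : ℕ} {v w : Sp d → ℝ} {A B : ℝ} (hv : HomBd θ v A) (hw : HomBd θ' w B)
    (hA : 0 ≤ A) (hB : 0 ≤ B) :
    HomBd (θ + θ') (fun y => v y * w y) (8 * (A * B)) := by
  refine ⟨hv.1.mul hw.1, fun k hk x hx => ?_⟩
  refine (norm_iteratedFDeriv_mul_le_of_contDiffOn hv.1 hw.1 hx hk).trans ?_
  simp_rw [mul_assoc]
  have hx0 := norm_pos_iff.2 hx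
  refine (sum_choose_mul_le hk (B := A * B * ‖x‖⁻¹ ^ (θ + θ' + k)) (by positivity)
    fun i hi => ?_).trans (le_of_eq (by ring))
  calc _ ≤ (A * ‖x‖⁻¹ ^ (θ + i)) * (B * ‖x‖⁻¹ ^ (θ' + (k - i))) :=
        mul_le_mul (hv.2 i (by omega) x hx) (hw.2 (k - i) (by omega) x hx) (norm_nonneg _)
          (by positivity)
    _ = A * B * ‖x‖⁻¹ ^ ((θ + i) + (θ' + (k - i))) := by rw [pow_add]; ring
    _ = _ := by rw [show (θ + i) + (θ' + (k - i)) = θ + θ' + k by omega]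

lemma ScaleBd.scale {n : ℕ} {f : Sp d → ℝ} {M : ℝ} (h : ScaleBd n f M 1) {R : ℝ} (hR : 0 < R) :
    ScaleBd n (fun y => f (R⁻¹ • y)) M R := by
  refine ⟨h.1.comp (contDiff_const_smul _), fun k hk x => ?_⟩
  have hk' : (k : ℕ∞ω) ≤ n := by exact_mod_cast hk
  rw [iteratedFDeriv_comp_const_smul _ (h.1.of_le hk'), norm_smul, norm_pow,
    Real.norm_of_nonneg (by positivity)]
  have := h.2 k hk (R⁻¹ • x)
  rw [inv_one, one_pow, mul_one] at this
  calc _ ≤ R⁻¹ ^ k * M := by gcongr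
    _ = _ := mul_comm _ _

/-- A smooth function vanishing for `|y| ≤ 1/4` and equal to `1` for `|y| ≥ 1/2`. -/
noncomputable def farCutoff (y : Sp d) : ℝ :=
  1 - (⟨1 / 4, 1 / 2, by norm_num, by norm_num⟩ : ContDiffBump (0 : Sp d)) y

lemma farCutoff_of_le {y : Sp d} (h : ‖y‖ ≤ 1 / 4) : farCutoff y = 0 := by
  unfold farCutoff
  rw [ContDiffBump.one_of_mem_closedBall _ (by simpa using h), sub_self]

lemma farCutoff_of_ge {y : Sp d} (h : 1 / 2 ≤ ‖y‖) : farCutoff y = 1 := by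
  unfold farCutoff
  rw [ContDiffBump.zero_of_le_dist _ (by simpa using h), sub_zero]

lemma farCutoff_nonneg (y : Sp d) : 0 ≤ farCutoff y := sub_nonneg.2 (ContDiffBump.le_one _)

lemma farCutoff_le_one (y : Sp d) : farCutoff y ≤ 1 := sub_le_self _ (ContDiffBump.nonneg _)

lemma exists_scaleBd_farCutoff (d : ℕ) : ∃ C : ℝ, 0 ≤ C ∧ ScaleBd 3 (farCutoff (d := d)) C 1 := by
  set χ : ContDiffBump (0 : Sp d) := ⟨1 / 4, 1 / 2, by norm_num, by norm_num⟩ with hχ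
  have hb : ∀ k : ℕ, ∃ C, ∀ x, ‖iteratedFDeriv ℝ k χ x‖ ≤ C := fun k =>
    HasCompactSupport.exists_bound_of_continuous (χ.hasCompactSupport.iteratedFDeriv k)
      ((χ.contDiff (n := k)).continuous_iteratedFDeriv le_rfl)
  choose C hC using hb
  have hC0 : ∀ k, 0 ≤ C k := fun k => (norm_nonneg _).trans (hC k 0)
  refine ⟨1 + ∑ k ∈ Finset.range 4, C k, by
    have := Finset.sum_nonneg fun k (_ : k ∈ Finset.range 4) => hC0 k
    linarith, contDiff_const.sub χ.contDiff, fun k hk x => ?_⟩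
  have e : iteratedFDeriv ℝ k (farCutoff (d := d)) x
      = iteratedFDeriv ℝ k (fun _ : Sp d => (1 : ℝ)) x - iteratedFDeriv ℝ k χ x :=
    fun_iteratedFDeriv_sub_apply contDiff_const.contDiffAt χ.contDiff.contDiffAt
  rw [e, inv_one, one_pow, mul_one]
  refine (norm_sub_le _ _).trans (add_le_add ?_ ?_)
  · rcases Nat.eq_zero_or_pos k with rfl | hk
    · simp
    · rw [iteratedFDeriv_const_of_ne hk.ne']; simp
  · exact (hC k x).trans (Finset.single_le_sum (f := C) (fun i _ => hC0 i)
      (Finset.mem_range.2 (by omega)))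

/-- The part of `w` at distance of order at least `R` from the origin. -/
noncomputable def farPart (R : ℝ) (w : Sp d → ℝ) (y : Sp d) : ℝ := farCutoff (R⁻¹ • y) * w y

/-- The part of `w` near the origin, supported in the ball of radius `R / 2`. -/
noncomputable def nearPart (R : ℝ) (w : Sp d → ℝ) (y : Sp d) : ℝ := w y - farPart R w y

lemma norm_inv_smul {R : ℝ} (hR : 0 < R) (y : Sp d) : ‖R⁻¹ • y‖ = ‖y‖ / R := by
  rw [norm_smul, Real.norm_of_nonneg (by positivity)]; field_simp

lemma farPart_of_ge {R : ℝ} (hR : 0 < R) (w : Sp d → ℝ) {y : Sp d} (h : R / 2 ≤ ‖y‖) :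
    farPart R w y = w y := by
  rw [farPart, farCutoff_of_ge, one_mul]
  rw [norm_inv_smul hR, le_div_iff₀ hR]; linarith

lemma farPart_of_le {R : ℝ} (hR : 0 < R) (w : Sp d → ℝ) {y : Sp d} (h : ‖y‖ ≤ R / 4) :
    farPart R w y = 0 := by
  rw [farPart, farCutoff_of_le, zero_mul]
  rw [norm_inv_smul hR, div_le_iff₀ hR]; linarith

lemma abs_farPart_le (R : ℝ) (w : Sp d → ℝ) (y : Sp d) : |farPart R w y| ≤ |w y| := by
  rw [farPart, abs_mul, abs_of_nonneg (farCutoff_nonneg _)]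
  exact mul_le_of_le_one_left (abs_nonneg _) (farCutoff_le_one _)

lemma nearPart_of_ge {R : ℝ} (hR : 0 < R) (w : Sp d → ℝ) {y : Sp d} (h : R / 2 ≤ ‖y‖) :
    nearPart R w y = 0 := by
  rw [nearPart, farPart_of_ge hR w h, sub_self]

lemma abs_nearPart_le (R : ℝ) (w : Sp d → ℝ) (y : Sp d) : |nearPart R w y| ≤ |w y| := by
  have : nearPart R w y = (1 - farCutoff (R⁻¹ • y)) * w y := by rw [nearPart, farPart]; ring
  rw [this, abs_mul, abs_of_nonneg (sub_nonneg.2 (farCutoff_le_one _))]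
  exact mul_le_of_le_one_left (abs_nonneg _) (sub_le_self _ (farCutoff_nonneg _))

lemma continuous_farCutoff_smul (R : ℝ) : Continuous fun y : Sp d => farCutoff (R⁻¹ • y) := by
  unfold farCutoff
  exact continuous_const.sub ((ContDiffBump.continuous _).comp (by fun_prop))

lemma aestronglyMeasurable_farPart (R : ℝ) {w : Sp d → ℝ} (hw : AEStronglyMeasurable w volume) :
    AEStronglyMeasurable (farPart R w) volume :=
  (continuous_farCutoff_smul R).aestronglyMeasurable.mul hw

lemma aestronglyMeasurable_nearPart (R : ℝ) {w : Sp d → ℝ} (hw : AEStronglyMeasurable w volume) :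
    AEStronglyMeasurable (nearPart R w) volume :=
  hw.sub (aestronglyMeasurable_farPart R hw)

lemma ae_ne_zero (hd : 0 < d) : ∀ᵐ y : Sp d, y ≠ 0 := by
  have : Nontrivial (Sp d) := by
    have : Nonempty (Fin d) := ⟨⟨0, hd⟩⟩
    infer_instance
  exact Measure.ae_ne volume 0

lemma HomBd.aestronglyMeasurable {θ : ℕ} {w : Sp d → ℝ} {A : ℝ} (h : HomBd θ w A) (hd : 0 < d) :
    AEStronglyMeasurable w volume := by
  have h1 := h.1.continuousOn.aestronglyMeasurable (μ := volume)
    (measurableSet_singleton (0 : Sp d)).compl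
  have : Nontrivial (Sp d) := by
    have : Nonempty (Fin d) := ⟨⟨0, hd⟩⟩
    infer_instance
  rwa [restrict_compl_singleton] at h1

lemma exists_scaleBd_farPart (d θ : ℕ) : ∃ C : ℝ, 0 ≤ C ∧ ∀ (w : Sp d → ℝ) (A : ℝ), 0 ≤ A →
    HomBd θ w A → ∀ R : ℝ, 0 < R → ScaleBd 3 (farPart R w) (C * A * R⁻¹ ^ θ) R := by
  obtain ⟨C, hC, hη⟩ := exists_scaleBd_farCutoff d
  refine ⟨8 * (C * 4 ^ (θ + 3)), by positivity, fun w A hA hw R hR => ?_⟩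
  have hηR := hη.scale hR
  have hzero : ∀ x : Sp d, ‖x‖ < R / 4 → farPart R w =ᶠ[nhds x] fun _ => 0 := by
    intro x hx
    filter_upwards [continuous_norm.continuousAt.eventually_lt continuousAt_const hx] with y hy
    exact farPart_of_le hR w hy.le
  constructor
  · rw [contDiff_iff_contDiffAt]
    intro x
    by_cases hx : x = 0
    · refine contDiffAt_const.congr_of_eventuallyEq (hzero x ?_)
      rw [hx, norm_zero]; positivity
    · exact hηR.1.contDiffAt.mul (hw.1.contDiffAt (isOpen_compl_singleton.mem_nhds hx))
  · intro k hk x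
    by_cases hx : ‖x‖ < R / 4
    · rw [((hzero x hx).iteratedFDeriv ℝ k).eq_of_nhds]
      have : iteratedFDeriv ℝ k (fun _ : Sp d => (0 : ℝ)) x = 0 := by simp
      rw [this, norm_zero]
      positivity
    · push Not at hx
      have hx0 : 0 < ‖x‖ := by linarith
      refine (norm_iteratedFDeriv_mul_le_of_contDiffOn hηR.1.contDiffOn hw.1
        (norm_pos_iff.1 hx0) hk).trans ?_
      simp_rw [mul_assoc]
      refine (sum_choose_mul_le hk (B := C * 4 ^ (θ + 3) * A * R⁻¹ ^ (θ + k)) (by positivity)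
        fun i hi => ?_).trans (le_of_eq (by rw [pow_add]; ring))
      have h4 : ‖x‖⁻¹ ≤ 4 * R⁻¹ := by
        rw [inv_le_comm₀ hx0 (by positivity)]
        refine le_trans (le_of_eq ?_) hx
        field_simp
      calc _ ≤ (C * R⁻¹ ^ i) * (A * ‖x‖⁻¹ ^ (θ + (k - i))) :=
            mul_le_mul (hηR.2 i (by omega) x) (hw.2 (k - i) (by omega) x (norm_pos_iff.1 hx0))
              (norm_nonneg _) (by positivity)
        _ ≤ (C * R⁻¹ ^ i) * (A * (4 * R⁻¹) ^ (θ + (k - i))) := by gcongr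
        _ = C * 4 ^ (θ + (k - i)) * A * R⁻¹ ^ (i + (θ + (k - i))) := by
            rw [mul_pow, pow_add R⁻¹ i]; ring
        _ ≤ C * 4 ^ (θ + 3) * A * R⁻¹ ^ (i + (θ + (k - i))) := by
            gcongr
            · norm_num
            · omega
        _ = _ := by rw [show i + (θ + (k - i)) = θ + k by omega]

lemma exists_integral_nearPart_le {θ : ℕ} (hθ : θ < d) : ∃ C : ℝ, 0 ≤ C ∧
    ∀ (w : Sp d → ℝ) (A : ℝ), 0 ≤ A → AEStronglyMeasurable w volume →
      (∀ y, y ≠ 0 → |w y| ≤ A * ‖y‖⁻¹ ^ θ) → ∀ R : ℝ, 0 < R → ∀ (κ : Sp d → ℝ) (K : ℝ), 0 ≤ K →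
      AEStronglyMeasurable κ volume → (∀ y, ‖y‖ ≤ R / 2 → |κ y| ≤ K) →
      Integrable (fun y => κ y * nearPart R w y) ∧
      |∫ y, κ y * nearPart R w y| ≤ C * (K * A * (R ^ d * R⁻¹ ^ θ)) := by
  obtain ⟨C, hC, h⟩ := exists_integral_inv_norm_pow_le hθ
  refine ⟨C, hC, fun w A hA hwm hw R hR κ K hK hκm hκ => ?_⟩
  obtain ⟨i, v⟩ := h R hR
  have hS : MeasurableSet (norm ⁻¹' Iic R : Set (Sp d)) := measurable_norm measurableSet_Iic
  have i' : Integrable ((norm ⁻¹' Iic R).indicator fun y : Sp d => K * A * ‖y‖⁻¹ ^ θ) :=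
    (integrable_indicator_iff hS).2 (i.const_mul _)
  have hb : ∀ᵐ y : Sp d, ‖κ y * nearPart R w y‖
      ≤ (norm ⁻¹' Iic R).indicator (fun y : Sp d => K * A * ‖y‖⁻¹ ^ θ) y := by
    filter_upwards [ae_ne_zero (by omega : 0 < d)] with y hy
    by_cases hyR : ‖y‖ ≤ R / 2
    · have : y ∈ (norm ⁻¹' Iic R : Set (Sp d)) := by
        simp only [mem_preimage, mem_Iic]; linarith
      rw [indicator_of_mem this, norm_mul, Real.norm_eq_abs, Real.norm_eq_abs, mul_assoc]
      exact mul_le_mul (hκ y hyR) ((abs_nearPart_le R w y).trans (hw y hy)) (abs_nonneg _) hK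
    · rw [nearPart_of_ge hR w (by linarith), mul_zero, norm_zero]
      exact indicator_nonneg (fun y _ => by positivity) y
  refine ⟨i'.mono' (hκm.mul (aestronglyMeasurable_nearPart R hwm)) hb, ?_⟩
  rw [← Real.norm_eq_abs]
  refine (norm_integral_le_of_norm_le i' hb).trans ?_
  rw [integral_indicator hS, integral_const_mul]
  calc _ ≤ K * A * (C * (R ^ d * R⁻¹ ^ θ)) := by gcongr
    _ = _ := by ring

/-! ### Local bounds at the scale of the distance to the origin -/

/-- In the ball of radius `|x|/8` about `x`, the function `f` is bounded by `m` and differs from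
`f x` by at most `m |x' - x| / |x|`. -/
def LocalBd (f : Sp d → ℝ) (x : Sp d) (m : ℝ) : Prop :=
  ∀ x', ‖x' - x‖ ≤ ‖x‖ / 8 → |f x'| ≤ m ∧ |f x' - f x| ≤ m * ‖x‖⁻¹ * ‖x' - x‖

namespace LocalBd

variable {f g : Sp d → ℝ} {x : Sp d} {m m' : ℝ}

lemma abs_le (h : LocalBd f x m) : |f x| ≤ m :=
  (h x (by rw [sub_self, norm_zero]; positivity)).1

lemma nonneg (h : LocalBd f x m) : 0 ≤ m := (abs_nonneg _).trans h.abs_le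

lemma mono (h : LocalBd f x m) (hm : m ≤ m') : LocalBd f x m' := fun x' hx' =>
  ⟨(h x' hx').1.trans hm, (h x' hx').2.trans (by gcongr)⟩

lemma add (hf : LocalBd f x m) (hg : LocalBd g x m') : LocalBd (fun y => f y + g y) x (m + m') := by
  intro x' hx'
  obtain ⟨a, b⟩ := hf x' hx'
  obtain ⟨c, e⟩ := hg x' hx'
  refine ⟨(abs_add_le _ _).trans (add_le_add a c), ?_⟩
  calc |f x' + g x' - (f x + g x)| = |(f x' - f x) + (g x' - g x)| := by congr 1; ring
    _ ≤ m * ‖x‖⁻¹ * ‖x' - x‖ + m' * ‖x‖⁻¹ * ‖x' - x‖ := (abs_add_le _ _).trans (add_le_add b e)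
    _ = _ := by ring

lemma neg (hf : LocalBd f x m) : LocalBd (fun y => -f y) x m := by
  intro x' hx'
  obtain ⟨a, b⟩ := hf x' hx'
  refine ⟨by rwa [abs_neg], ?_⟩
  rwa [show -f x' - -f x = -(f x' - f x) by ring, abs_neg]

lemma sub (hf : LocalBd f x m) (hg : LocalBd g x m') : LocalBd (fun y => f y - g y) x (m + m') := by
  simpa only [sub_eq_add_neg] using hf.add hg.neg

lemma mul (hf : LocalBd f x m) (hg : LocalBd g x m') :
    LocalBd (fun y => f y * g y) x (2 * (m * m')) := by
  intro x' hx'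
  obtain ⟨a, b⟩ := hf x' hx'
  obtain ⟨c, e⟩ := hg x' hx'
  have hm := hf.nonneg
  have hm' := hg.nonneg
  have h0 := hf.abs_le
  constructor
  · rw [abs_mul]
    have := mul_le_mul a c (abs_nonneg _) hm
    have : 0 ≤ m * m' := by positivity
    linarith
  · calc |f x' * g x' - f x * g x| = |(f x' - f x) * g x' + f x * (g x' - g x)| := by congr 1; ring
      _ ≤ |(f x' - f x)| * |g x'| + |f x| * |(g x' - g x)| := by
          rw [← abs_mul, ← abs_mul]; exact abs_add_le _ _
      _ ≤ (m * ‖x‖⁻¹ * ‖x' - x‖) * m' + m * (m' * ‖x‖⁻¹ * ‖x' - x‖) := by gcongr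
      _ = _ := by ring

end LocalBd

lemma norm_ge_of_near {x x' : Sp d} (h : ‖x' - x‖ ≤ ‖x‖ / 8) : 7 / 8 * ‖x‖ ≤ ‖x'‖ := by
  have := norm_sub_norm_le x x'
  rw [norm_sub_rev] at this
  linarith

lemma exists_localBd_of_homBd (d θ : ℕ) : ∃ C : ℝ, 0 ≤ C ∧ ∀ (w : Sp d → ℝ) (A : ℝ), 0 ≤ A →
    HomBd θ w A → ∀ x, x ≠ 0 → LocalBd w x (C * A * ‖x‖⁻¹ ^ θ) := by
  obtain ⟨C, hC, h⟩ := exists_scaleBd_farPart d θ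
  refine ⟨C, hC, fun w A hA hw x hx x' hx' => ?_⟩
  have hx0 := norm_pos_iff.2 hx
  have hf := h w A hA hw ‖x‖ hx0
  have e1 := farPart_of_ge hx0 w (y := x) (by linarith)
  have e2 := farPart_of_ge hx0 w (y := x') (by linarith [norm_ge_of_near hx'])
  have h2 := hf.abs_sub_le x x'
  rw [e1, e2] at h2
  exact ⟨e2 ▸ hf.abs_le x', h2⟩

/-- A kernel with decay `|z|^{-d-m}`, and one order better for its differences, which moreover
maps functions with bounds at scale `R` to functions that are smaller by `R^{-m}`, maps
functions that are homogeneously bounded of order `θ` to order `θ + m`. A multiple `c` of the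
identity may be subtracted. The function is split into a part near the origin, on which the
decay of the kernel is used, and a part which has bounds at the scale `R = |x|`. -/
lemma exists_localBd_convolution {θ : ℕ} (hθ : θ < d) (m : ℕ) : ∃ C : ℝ, 0 ≤ C ∧
    ∀ (κ : Sp d → ℝ) (c K : ℝ), 0 ≤ K → (∀ x, Integrable fun y => κ (x - y)) →
      (∀ z, z ≠ 0 → |κ z| ≤ K * ‖z‖⁻¹ ^ (d + m)) →
      (∀ z z', z ≠ 0 → ‖z' - z‖ ≤ ‖z‖ / 2 →
        |κ z' - κ z| ≤ K * ‖z‖⁻¹ ^ (d + m + 1) * ‖z' - z‖) →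
      (∀ (f : Sp d → ℝ) (M R : ℝ), 0 < R → ScaleBd 2 f M R → ∀ x,
        |(∫ y, κ (x - y) * f y) - c * f x| ≤ K * (M * R⁻¹ ^ m)) →
      ∀ (w : Sp d → ℝ) (A : ℝ), 0 ≤ A → HomBd θ w A → ∀ x, x ≠ 0 →
        (Integrable fun y => κ (x - y) * w y) ∧
        LocalBd (fun x => (∫ y, κ (x - y) * w y) - c * w x) x (C * (K * A) * ‖x‖⁻¹ ^ (θ + m)) := by
  obtain ⟨C₁, hC₁, h₁⟩ := exists_integral_nearPart_le hθ
  obtain ⟨C₂, hC₂, h₂⟩ := exists_scaleBd_farPart d θ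
  set B : ℝ := (8 / 3) ^ (d + m + 1) with hB
  have hB1 : (8 / 3 : ℝ) ^ (d + m) ≤ B := pow_le_pow_right₀ (by norm_num) (by omega)
  refine ⟨C₁ * B + C₂, by positivity, fun κ c K hK hint hκ hκ' hS w A hA hw x hx => ?_⟩
  have hR := norm_pos_iff.2 hx
  set R := ‖x‖ with hRdef
  have hwm := hw.aestronglyMeasurable (by omega)
  have hfar := h₂ w A hA hw R hR
  have hfar' := hfar.of_succ
  have hx2 : ∀ x' : Sp d, ‖x' - x‖ ≤ R / 8 → ∀ y : Sp d, ‖y‖ ≤ R / 2 → 3 / 8 * R ≤ ‖x' - y‖ := by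
    intro x' hx' y hy
    have h1 := norm_ge_of_near hx'
    have := norm_sub_norm_le x' y
    linarith
  have hinv : ∀ z : Sp d, 3 / 8 * R ≤ ‖z‖ → ‖z‖⁻¹ ≤ 8 / 3 * R⁻¹ := by
    intro z hz
    rw [inv_le_comm₀ (by linarith) (by positivity)]
    refine le_trans (le_of_eq ?_) hz
    field_simp
  have hself : ‖x - x‖ ≤ R / 8 := by rw [sub_self, norm_zero]; positivity
  -- near part of the function, at a point x'
  have near : ∀ x' : Sp d, ‖x' - x‖ ≤ R / 8 →
      Integrable (fun y => κ (x' - y) * nearPart R w y) ∧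
      |∫ y, κ (x' - y) * nearPart R w y| ≤ C₁ * B * (K * A) * R⁻¹ ^ (θ + m) := by
    intro x' hx'
    obtain ⟨a, b⟩ := h₁ w A hA hwm (fun y hy => hw.abs_le hy) R hR (fun y => κ (x' - y))
      (K * (B * R⁻¹ ^ (d + m))) (by positivity) (hint x').1 (fun y hy => by
        have h3 := hx2 x' hx' y hy
        refine (hκ _ (norm_pos_iff.1 (by linarith))).trans ?_
        gcongr
        calc ‖x' - y‖⁻¹ ^ (d + m) ≤ (8 / 3 * R⁻¹) ^ (d + m) := by gcongr; exact hinv _ h3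
          _ = (8 / 3) ^ (d + m) * R⁻¹ ^ (d + m) := mul_pow _ _ _
          _ ≤ _ := by gcongr)
    refine ⟨a, b.trans (le_of_eq ?_)⟩
    simp only [pow_add, inv_pow]; field_simp
  have far_int : ∀ x' : Sp d, Integrable fun y => κ (x' - y) * farPart R w y := fun x' =>
    (hint x').mul_bdd hfar.continuous.aestronglyMeasurable
      (Filter.Eventually.of_forall hfar.abs_le)
  have split : ∀ x' : Sp d, (fun y => κ (x' - y) * w y)
      = fun y => κ (x' - y) * nearPart R w y + κ (x' - y) * farPart R w y := fun x' => by
    funext y; rw [nearPart]; ring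
  have val : ∀ x' : Sp d, ‖x' - x‖ ≤ R / 8 → (∫ y, κ (x' - y) * w y) - c * w x'
      = (∫ y, κ (x' - y) * nearPart R w y)
        + ((∫ y, κ (x' - y) * farPart R w y) - c * farPart R w x') := by
    intro x' hx'
    rw [split x', integral_add (near x' hx').1 (far_int x'),
      farPart_of_ge hR w (y := x') (by linarith [norm_ge_of_near hx'])]
    ring
  refine ⟨by rw [split x]; exact (near x hself).1.add (far_int x), fun x' hx' => ⟨?_, ?_⟩⟩
  · beta_reduce
    rw [val x' hx']
    refine (abs_add_le _ _).trans ((add_le_add (near x' hx').2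
      (hS _ _ R hR hfar' x')).trans (le_of_eq ?_))
    rw [pow_add]; ring
  · beta_reduce
    rw [val x' hx', val x hself, ← hRdef]
    -- the near part: smoothness of the kernel
    have hdn : |(∫ y, κ (x' - y) * nearPart R w y) - ∫ y, κ (x - y) * nearPart R w y|
        ≤ C₁ * B * (K * A) * R⁻¹ ^ (θ + m) * R⁻¹ * ‖x' - x‖ := by
      rw [← integral_sub (near x' hx').1 (near x hself).1]
      simp_rw [← sub_mul]
      obtain ⟨-, b⟩ := h₁ w A hA hwm (fun y hy => hw.abs_le hy) R hR
        (fun y => κ (x' - y) - κ (x - y))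
        (K * (B * R⁻¹ ^ (d + m + 1)) * ‖x' - x‖) (by positivity) ((hint x').1.sub (hint x).1)
        (fun y hy => by
          have h3 := hx2 x hself y hy
          have h4 : R / 2 ≤ ‖x - y‖ := by
            have := norm_sub_norm_le x y
            linarith
          have e : x' - y - (x - y) = x' - x := by abel
          have := hκ' (x - y) (x' - y) (norm_pos_iff.1 (by linarith)) (by rw [e]; linarith)
          rw [e] at this
          refine this.trans ?_
          gcongr
          calc ‖x - y‖⁻¹ ^ (d + m + 1) ≤ (8 / 3 * R⁻¹) ^ (d + m + 1) := by gcongr; exact hinv _ h3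
            _ = _ := mul_pow _ _ _)
      refine b.trans (le_of_eq ?_)
      simp only [pow_add, inv_pow]; field_simp
    -- the far part: differences of the function have bounds at the same scale
    have hdf : |((∫ y, κ (x' - y) * farPart R w y) - c * farPart R w x')
          - ((∫ y, κ (x - y) * farPart R w y) - c * farPart R w x)|
        ≤ K * (C₂ * A * R⁻¹ ^ θ * R⁻¹ * ‖x' - x‖ * R⁻¹ ^ m) := by
      have hs := hS _ _ R hR (hfar.sub_shift (x' - x)) x
      have e1 : ∫ y, κ (x - y) * farPart R w (y + (x' - x)) = ∫ y, κ (x' - y) * farPart R w y := by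
        rw [← integral_add_right_eq_self (fun y => κ (x' - y) * farPart R w y) (x' - x)]
        refine integral_congr_ae (Filter.Eventually.of_forall fun y => ?_)
        simp only
        congr 2; abel
      have i1 : Integrable fun y => κ (x - y) * farPart R w (y + (x' - x)) := by
        have := (far_int x').comp_add_right (x' - x)
        refine this.congr (Filter.Eventually.of_forall fun y => ?_)
        simp only
        congr 2; abel
      have e2 : (∫ y, κ (x - y) * (farPart R w y - farPart R w (y + (x' - x))))
          = (∫ y, κ (x - y) * farPart R w y) - ∫ y, κ (x' - y) * farPart R w y := by
        simp_rw [mul_sub]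
        rw [integral_sub (far_int x) i1, e1]
      rw [e2, add_sub_cancel, abs_sub_comm] at hs
      refine le_trans (le_of_eq ?_) hs
      congr 1; ring
    calc _ = |((∫ y, κ (x' - y) * nearPart R w y) - ∫ y, κ (x - y) * nearPart R w y)
          + (((∫ y, κ (x' - y) * farPart R w y) - c * farPart R w x')
          - ((∫ y, κ (x - y) * farPart R w y) - c * farPart R w x))| := by congr 1; ring
      _ ≤ _ := (abs_add_le _ _).trans (add_le_add hdn hdf)
      _ = _ := by rw [pow_add]; ring

/-- The heat semigroup at time `s` moves homogeneously bounded functions by `s |x|^{-θ-2}`. -/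
lemma exists_localBd_heat_sub {θ : ℕ} (hθ : θ < d) : ∃ C : ℝ, 0 ≤ C ∧
    ∀ s : ℝ, 0 < s → ∀ (w : Sp d → ℝ) (A : ℝ), 0 ≤ A → HomBd θ w A → ∀ x, x ≠ 0 →
      (Integrable fun y => gauss s (x - y) * w y) ∧
      LocalBd (fun x => (∫ y, gauss s (x - y) * w y) - w x) x (C * (s * A) * ‖x‖⁻¹ ^ (θ + 2)) := by
  obtain ⟨C, hC, H⟩ := exists_localBd_convolution hθ 2
  obtain ⟨C₁, hC₁, h₁⟩ := (gaussBd_gauss (d := d)).far 2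
  obtain ⟨C₂, hC₂, h₂⟩ := GaussBd.lipschitz_far differentiable_gauss (gaussBd_fderiv_gauss (d := d)) 2
  obtain ⟨C₃, hC₃, h₃⟩ := exists_heat_sub_le d
  set L := max C₁ (max C₂ C₃) with hL
  have l1 : C₁ ≤ L := le_max_left _ _
  have l2 : C₂ ≤ L := (le_max_left _ _).trans (le_max_right _ _)
  have l3 : C₃ ≤ L := (le_max_right _ _).trans (le_max_right _ _)
  refine ⟨C * L, by positivity, fun s hs w A hA hw x hx => ?_⟩
  obtain ⟨a, b⟩ := H (gauss s) 1 (L * s) (by positivity)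
    (fun x => (integrable_gauss hs).comp_sub_left x)
    (fun z hz => by
      refine (h₁ s hs z hz).trans ?_
      rw [Real.sq_sqrt hs.le, add_zero]; gcongr)
    (fun z z' hz hzz => by
      refine (h₂ s hs z z' hz hzz).trans ?_
      rw [Real.sq_sqrt hs.le, show d + 1 + 2 = d + 2 + 1 by ring]; gcongr)
    (fun f M R hR hf x => by
      rw [one_mul]
      refine (h₃ s hs f M R hf x).trans ?_
      have := hf.nonneg
      rw [show M * R⁻¹ * R⁻¹ = M * R⁻¹ ^ 2 by ring]
      gcongr) w A hA hw x hx
  refine ⟨a, ?_⟩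
  simp only [one_mul] at b
  exact b.mono (le_of_eq (by ring))

/-- The Oseen kernel maps homogeneously bounded functions of order `θ` to order `θ + 1`,
uniformly in time. -/
lemma exists_localBd_oseenDiv {θ : ℕ} (hθ : θ < d) (j h k : Fin d) : ∃ C : ℝ, 0 ≤ C ∧
    ∀ τ : ℝ, 0 < τ → ∀ (w : Sp d → ℝ) (A : ℝ), 0 ≤ A → HomBd θ w A → ∀ x, x ≠ 0 →
      (Integrable fun y => oseenDiv τ (x - y) j h k * w y) ∧
      LocalBd (fun x => ∫ y, oseenDiv τ (x - y) j h k * w y) x (C * A * ‖x‖⁻¹ ^ (θ + 1)) := by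
  obtain ⟨C, hC, H⟩ := exists_localBd_convolution hθ 1
  obtain ⟨C₁, hC₁, h₁⟩ := exists_oseenDiv_le j h k
  obtain ⟨C₂, hC₂, h₂⟩ := exists_oseenDiv_sub_le j h k
  obtain ⟨C₃, hC₃, h₃⟩ := exists_integral_oseenDiv_mul_le j h k
  set L := max C₁ (max C₂ C₃) with hL
  have l1 : C₁ ≤ L := le_max_left _ _
  have l2 : C₂ ≤ L := (le_max_left _ _).trans (le_max_right _ _)
  have l3 : C₃ ≤ L := (le_max_right _ _).trans (le_max_right _ _)
  refine ⟨C * L, by positivity, fun τ hτ w A hA hw x hx => ?_⟩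
  obtain ⟨a, b⟩ := H (fun z => oseenDiv τ z j h k) 0 L (by positivity)
    (fun x => integrable_oseenDiv hτ j h k x)
    (fun z hz => (h₁ z hz τ hτ).trans (by gcongr))
    (fun z z' hz hzz => (h₂ z z' hz hzz τ hτ).trans (by
      rw [show d + 1 + 1 = d + 2 by ring]; gcongr))
    (fun f M R hR hf x => by
      rw [zero_mul, sub_zero, pow_one]
      refine (h₃ τ hτ f M R hR hf x).trans ?_
      have := hf.nonneg
      gcongr) w A hA hw x hx
  refine ⟨a, ?_⟩
  simp only [zero_mul, sub_zero] at b
  exact b.mono (le_of_eq (by ring))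

/-- The heat extension of `|y|^{-θ}` at time `s` is bounded by `s^{-θ/2}`. -/
lemma exists_integral_gauss_mul_inv_norm_le {θ : ℕ} (hθ : θ < d) : ∃ C : ℝ, 0 ≤ C ∧
    ∀ s : ℝ, 0 < s → ∀ x : Sp d,
      Integrable (fun y : Sp d => gauss s (x - y) * ‖y‖⁻¹ ^ θ) ∧
      ∫ y : Sp d, gauss s (x - y) * ‖y‖⁻¹ ^ θ ≤ C * (√s)⁻¹ ^ θ := by
  obtain ⟨C, hC, h⟩ := exists_integral_inv_norm_pow_le hθ
  refine ⟨C + 1, by positivity, fun s hs x => ?_⟩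
  have hq := Real.sqrt_pos.2 hs
  obtain ⟨i, v⟩ := h (√s) hq
  have hS : MeasurableSet (norm ⁻¹' Iic (√s) : Set (Sp d)) := measurable_norm measurableSet_Iic
  have i1 : Integrable ((norm ⁻¹' Iic (√s)).indicator fun y : Sp d => (√s)⁻¹ ^ d * ‖y‖⁻¹ ^ θ) :=
    (integrable_indicator_iff hS).2 (i.const_mul _)
  have i2 := ((integrable_gauss (d := d) hs).comp_sub_left x).const_mul ((√s)⁻¹ ^ θ)
  have hb : ∀ y : Sp d, ‖gauss s (x - y) * ‖y‖⁻¹ ^ θ‖ ≤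
      (norm ⁻¹' Iic (√s)).indicator (fun y : Sp d => (√s)⁻¹ ^ d * ‖y‖⁻¹ ^ θ) y
        + (√s)⁻¹ ^ θ * gauss s (x - y) := by
    intro y
    have hg := gauss_pos hs (x - y)
    rw [Real.norm_of_nonneg (by positivity)]
    by_cases hy : ‖y‖ ≤ √s
    · have hy' : y ∈ (norm ⁻¹' Iic (√s) : Set (Sp d)) := hy
      rw [indicator_of_mem hy']
      have : gauss s (x - y) * ‖y‖⁻¹ ^ θ ≤ (√s)⁻¹ ^ d * ‖y‖⁻¹ ^ θ := by
        gcongr; exact gauss_le hs _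
      have h0 : 0 ≤ (√s)⁻¹ ^ θ * gauss s (x - y) := by positivity
      linarith
    · have hy' : y ∉ (norm ⁻¹' Iic (√s) : Set (Sp d)) := hy
      rw [indicator_of_notMem hy', zero_add, mul_comm]
      push Not at hy
      gcongr
  have i12 := i1.add i2
  refine ⟨i12.mono' ?_ (Filter.Eventually.of_forall hb), ?_⟩
  · have : Measurable fun y : Sp d => gauss s (x - y) * ‖y‖⁻¹ ^ θ := by
      have := (continuous_gauss (d := d) s).measurable
      fun_prop
    exact this.aestronglyMeasurable
  · refine (Real.le_norm_self _).trans ((norm_integral_le_of_norm_le i12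
      (Filter.Eventually.of_forall hb)).trans ?_)
    simp only [Pi.add_apply]
    rw [integral_add i1 i2, integral_indicator hS, integral_const_mul, integral_const_mul,
      integral_sub_left_eq_self (fun y => gauss s y) volume x, integral_gauss hs, mul_one]
    calc _ ≤ (√s)⁻¹ ^ d * (C * (√s ^ d * (√s)⁻¹ ^ θ)) + (√s)⁻¹ ^ θ := by gcongr
      _ = C * ((√s)⁻¹ * √s) ^ d * (√s)⁻¹ ^ θ + (√s)⁻¹ ^ θ := by rw [mul_pow]; ring
      _ = _ := by rw [inv_mul_cancel₀ hq.ne', one_pow]; ring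

/-! ### Scalar components of the solution -/

/-- The velocity at time `s` is homogeneously bounded of order one by `U`, and bounded by
`U s^{-1/2}`. -/
def VelocityBd (u : ℝ → Sp d → Sp d) (U s : ℝ) : Prop :=
  (∀ h, HomBd 1 (fun x => u s x h) U) ∧ ∀ h x, |u s x h| ≤ U * (√s)⁻¹

/-- The quantitative hypotheses on a solution `u` and its datum `a`, in terms of scalar components
and with explicit constants. -/
structure FlowBd (a : Sp d → Sp d) (u : ℝ → Sp d → Sp d) (A U : ℝ) : Prop where
  three_le : 3 ≤ d
  datum_nonneg : 0 ≤ A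
  velocity_nonneg : 0 ≤ U
  datum : ∀ h, HomBd 1 (fun x => a x h) A
  velocity : ∀ᵐ s ∂(volume.restrict (Ioi (0 : ℝ))), VelocityBd u U s
  measurable : AEStronglyMeasurable (fun p : ℝ × Sp d => u p.1 p.2)
    ((volume.restrict (Ioi 0)).prod volume)
  mild : IsMildSolution a u

lemma norm_iteratedFDeriv_component_le {f : Sp d → Sp d} {x : Sp d} {k : ℕ}
    (hf : ContDiffAt ℝ k f x) (h : Fin d) :
    ‖iteratedFDeriv ℝ k (fun x => f x h) x‖ ≤ ‖iteratedFDeriv ℝ k f x‖ := by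
  have := (EuclideanSpace.proj h : Sp d →L[ℝ] ℝ).norm_iteratedFDeriv_comp_left hf le_rfl
  refine this.trans ?_
  exact mul_le_of_le_one_left (norm_nonneg _) (norm_proj_le h)

lemma le_mul_inv_pow_of_rpow_mul_le {r y C : ℝ} (hr : 0 < r) {k : ℕ}
    (h : r ^ ((1 : ℝ) + k) * y ≤ C) : y ≤ C * r⁻¹ ^ (1 + k) := by
  rw [show (1 : ℝ) + k = ((1 + k : ℕ) : ℝ) by push_cast; ring, Real.rpow_natCast] at h
  calc y = r⁻¹ ^ (1 + k) * (r ^ (1 + k) * y) := by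
        rw [← mul_assoc, ← mul_pow, inv_mul_cancel₀ hr.ne', one_pow, one_mul]
    _ ≤ r⁻¹ ^ (1 + k) * C := by gcongr
    _ = _ := mul_comm _ _

lemma MemE.exists_homBd {a : Sp d → Sp d} (ha : MemE 3 1 a) :
    ∃ A : ℝ, 0 ≤ A ∧ ∀ h, HomBd 1 (fun x => a x h) A := by
  obtain ⟨hc, C, hC⟩ := ha
  refine ⟨max C 0, le_max_right _ _, fun h => ⟨?_, fun k hk x hx => ?_⟩⟩
  · exact (EuclideanSpace.proj h : Sp d →L[ℝ] ℝ).contDiff.comp_contDiffOn hc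
  · have hca : ContDiffAt ℝ k a x :=
      (hc.contDiffAt (isOpen_compl_singleton.mem_nhds hx)).of_le (by exact_mod_cast hk)
    have hx0 := norm_pos_iff.2 hx
    refine (norm_iteratedFDeriv_component_le hca h).trans
      ((le_mul_inv_pow_of_rpow_mul_le hx0 (hC k hk x hx)).trans ?_)
    gcongr; exact le_max_left _ _

lemma MemX.exists_velocityBd {u : ℝ → Sp d → Sp d} (hu : MemX 3 1 u) :
    ∃ U : ℝ, 0 ≤ U ∧ ∀ᵐ s ∂(volume.restrict (Ioi (0 : ℝ))), VelocityBd u U s := by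
  obtain ⟨-, C, hC⟩ := hu
  refine ⟨max C 0, le_max_right _ _, ?_⟩
  filter_upwards [hC, ae_restrict_mem measurableSet_Ioi] with s hs hs0
  have hq : 0 < √s := Real.sqrt_pos.2 hs0
  have key : ∀ r : ℝ, 0 < r → ∀ x : Sp d, r ≤ √s + ‖x‖ → ∀ k ≤ 3,
      ‖iteratedFDeriv ℝ k (u s) x‖ ≤ max C 0 * r⁻¹ ^ (1 + k) := fun r hr x hrx k hk => by
    refine le_mul_inv_pow_of_rpow_mul_le hr (le_trans ?_ ((hs.2 k hk x).trans (le_max_left _ _)))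
    gcongr
  refine ⟨fun h => ⟨?_, fun k hk x hx => ?_⟩, fun h x => ?_⟩
  · exact ((EuclideanSpace.proj h : Sp d →L[ℝ] ℝ).contDiff.comp hs.1).contDiffOn
  · have hca : ContDiffAt ℝ k (u s) x := hs.1.contDiffAt.of_le (by exact_mod_cast hk)
    exact (norm_iteratedFDeriv_component_le hca h).trans
      (key _ (norm_pos_iff.2 hx) x (by linarith) k hk)
  · have := key _ hq x (by linarith [norm_nonneg x]) 0 (by norm_num)
    rw [norm_iteratedFDeriv_zero, add_zero, pow_one] at this
    exact (abs_apply_le_norm _ _).trans this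

lemma exists_flowBd (hd : 3 ≤ d) {a : Sp d → Sp d} (ha : MemE 3 1 a) {u : ℝ → Sp d → Sp d}
    (hu : MemX 3 1 u) (hsol : IsMildSolution a u) : ∃ A U, FlowBd a u A U := by
  obtain ⟨A, hA, hA'⟩ := ha.exists_homBd
  obtain ⟨U, hU, hU'⟩ := hu.exists_velocityBd
  refine ⟨A, U, hd, hA, hU, hA', hU', ?_, hsol⟩
  have := hu.1
  rwa [Measure.volume_eq_prod, ← Measure.prod_restrict, Measure.restrict_univ] at this

variable {a : Sp d → Sp d} {u : ℝ → Sp d → Sp d} {A U : ℝ}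

lemma VelocityBd.mul (hU : 0 ≤ U) {s : ℝ} (h : VelocityBd u U s) (i k : Fin d) :
    HomBd 2 (fun y => u s y i * u s y k) (8 * (U * U)) :=
  (h.1 i).mul (h.1 k) hU hU

lemma FlowBd.datum_mul (H : FlowBd a u A U) (i k : Fin d) :
    HomBd 2 (fun y => a y i * a y k) (8 * (A * A)) :=
  (H.datum i).mul (H.datum k) H.datum_nonneg H.datum_nonneg

lemma contract_outer_apply (Q : Fin d → Fin d → Fin d → ℝ) (v : Sp d) (j : Fin d) :
    contract Q (outer v v) j = ∑ h, ∑ k, Q j h k * (v h * v k) := rfl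

lemma heat_apply {t : ℝ} {x : Sp d} (h : ∀ j, Integrable fun y => gauss t (x - y) * a y j)
    (j : Fin d) : heat t a x j = ∫ y, gauss t (x - y) * a y j := by
  unfold heat
  rw [eval_integral_piLp (q := 2) (fun i => by simpa using h i)]
  simp

lemma heatLerayDiv_outer_apply {t : ℝ} {x : Sp d} {v : Sp d → Sp d}
    (hint : ∀ j h k, Integrable fun y => oseenDiv t (x - y) j h k * (v y h * v y k)) (j : Fin d) :
    heatLerayDiv t (fun y => outer (v y) (v y)) x j
      = ∑ h, ∑ k, ∫ y, oseenDiv t (x - y) j h k * (v y h * v y k) := by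
  unfold heatLerayDiv
  rw [eval_integral_piLp (q := 2) (fun i => by
    simp only [contract_outer_apply]
    exact integrable_finsetSum _ fun h _ => integrable_finsetSum _ fun k _ => hint i h k)]
  simp only [contract_outer_apply]
  rw [integral_finsetSum _ fun h _ => integrable_finsetSum _ fun k _ => hint j h k]
  refine Finset.sum_congr rfl fun h _ => ?_
  rw [integral_finsetSum _ fun k _ => hint j h k]

/-- The component `(j; h, k)` of the integrand in the Duhamel formula. -/
noncomputable def duhamel (u : ℝ → Sp d → Sp d) (j h k : Fin d) (t s : ℝ) (x : Sp d) : ℝ :=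
  ∫ y, oseenDiv (t - s) (x - y) j h k * (u s y h * u s y k)

lemma FlowBd.velocity_Ioc (H : FlowBd a u A U) (t : ℝ) :
    ∀ᵐ s ∂(volume.restrict (Ioc 0 t)), 0 < s ∧ s < t ∧ VelocityBd u U s := by
  have h1 : ∀ᵐ s ∂(volume.restrict (Ioc 0 t)), VelocityBd u U s :=
    ae_mono (Measure.restrict_mono Ioc_subset_Ioi_self le_rfl) H.velocity
  have h2 : ∀ᵐ s ∂(volume.restrict (Ioc 0 t)), s ≠ t :=
    ae_restrict_of_ae (Measure.ae_ne volume t)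
  filter_upwards [h1, h2, ae_restrict_mem measurableSet_Ioc] with s a1 a2 a3
  exact ⟨a3.1, lt_of_le_of_ne a3.2 a2, a1⟩

lemma FlowBd.measurable_Ioc (H : FlowBd a u A U) (t : ℝ) (h k : Fin d) :
    AEStronglyMeasurable (fun p : ℝ × Sp d => u p.1 p.2 h * u p.1 p.2 k)
      ((volume.restrict (Ioc 0 t)).prod volume) := by
  have hle : (volume.restrict (Ioc 0 t)).prod (volume : Measure (Sp d))
      ≤ (volume.restrict (Ioi 0)).prod volume := by
    have e : ∀ S : Set ℝ, (volume.restrict S).prod (volume : Measure (Sp d))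
        = (volume.prod volume).restrict (S ×ˢ univ) := fun S => by
      rw [← Measure.prod_restrict, Measure.restrict_univ]
    rw [e, e]
    exact Measure.restrict_mono (prod_mono Ioc_subset_Ioi_self le_rfl) le_rfl
  have hm := H.measurable.mono_measure hle
  have hc : ∀ i : Fin d, AEStronglyMeasurable (fun p : ℝ × Sp d => u p.1 p.2 i)
      ((volume.restrict (Ioc 0 t)).prod volume) := fun i =>
    (EuclideanSpace.proj i : Sp d →L[ℝ] ℝ).continuous.comp_aestronglyMeasurable hm
  exact (hc h).mul (hc k)

lemma measurable_comp_sub {F : ℝ → Sp d → ℝ} (hF : Measurable fun p : ℝ × Sp d => F p.1 p.2)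
    (t : ℝ) (x : Sp d) : Measurable fun p : ℝ × Sp d => F (t - p.1) (x - p.2) := by
  have hg : Measurable fun p : ℝ × Sp d => (t - p.1, x - p.2) :=
    (measurable_const.sub measurable_fst).prodMk (measurable_const.sub measurable_snd)
  exact hF.comp hg

lemma measurable_oseenDiv_shift (j h k : Fin d) (t : ℝ) (x : Sp d) :
    Measurable fun p : ℝ × Sp d => oseenDiv (t - p.1) (x - p.2) j h k :=
  measurable_comp_sub (F := fun τ z => oseenDiv τ z j h k) (measurable_oseenDiv j h k) t x

/-- The integrand of the Duhamel formula is `O(|x|⁻³)`, uniformly in the two times. -/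
lemma FlowBd.exists_localBd_duhamel (d : ℕ) : ∃ C : ℝ, 0 ≤ C ∧
    ∀ (a : Sp d → Sp d) (u : ℝ → Sp d → Sp d) (A U : ℝ), FlowBd a u A U → ∀ j h k : Fin d,
    ∀ t, 0 < t → (∀ᵐ s ∂(volume.restrict (Ioc 0 t)), ∀ x, x ≠ 0 →
      (Integrable fun y => oseenDiv (t - s) (x - y) j h k * (u s y h * u s y k)) ∧
      LocalBd (duhamel u j h k t s) x (C * (U * U) * ‖x‖⁻¹ ^ 3)) ∧
      ∀ x, x ≠ 0 → IntegrableOn (fun s => duhamel u j h k t s x) (Ioc 0 t) := by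
  rcases Nat.lt_or_ge 2 d with hd | hd
  swap
  · exact ⟨0, le_rfl, fun a u A U H => absurd H.three_le (by omega)⟩
  choose C hC h₁ using fun j h k : Fin d => exists_localBd_oseenDiv hd j h k
  refine ⟨∑ j, ∑ h, ∑ k, C j h k * 8, Finset.sum_nonneg fun j _ => Finset.sum_nonneg fun h _ =>
    Finset.sum_nonneg fun k _ => mul_nonneg (hC j h k) (by norm_num),
    fun a u A U H j h k t ht => ?_⟩
  have hCle : C j h k * 8 ≤ ∑ j, ∑ h, ∑ k, C j h k * 8 := by
    have n1 : ∀ j h k, 0 ≤ C j h k * 8 := fun j h k => mul_nonneg (hC j h k) (by norm_num)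
    calc C j h k * 8 ≤ ∑ k, C j h k * 8 :=
          Finset.single_le_sum (f := fun k => C j h k * 8) (fun k _ => n1 j h k) (Finset.mem_univ k)
      _ ≤ ∑ h, ∑ k, C j h k * 8 :=
          Finset.single_le_sum (f := fun h => ∑ k, C j h k * 8)
            (fun h _ => Finset.sum_nonneg fun k _ => n1 j h k) (Finset.mem_univ h)
      _ ≤ _ := Finset.single_le_sum (f := fun j => ∑ h, ∑ k, C j h k * 8)
            (fun j _ => Finset.sum_nonneg fun h _ => Finset.sum_nonneg fun k _ => n1 j h k)
            (Finset.mem_univ j)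
  set K := ∑ j, ∑ h, ∑ k, C j h k * 8 with hK
  have hU := H.velocity_nonneg
  have hloc : ∀ᵐ s ∂(volume.restrict (Ioc 0 t)), ∀ x, x ≠ 0 →
      (Integrable fun y => oseenDiv (t - s) (x - y) j h k * (u s y h * u s y k)) ∧
      LocalBd (duhamel u j h k t s) x (K * (U * U) * ‖x‖⁻¹ ^ 3) := by
    filter_upwards [H.velocity_Ioc t] with s hs x hx
    obtain ⟨i, b⟩ := h₁ j h k (t - s) (by linarith [hs.2.1]) _ _ (by positivity)
      (hs.2.2.mul hU h k) x hx
    refine ⟨i, b.mono ?_⟩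
    calc _ = C j h k * 8 * (U * U) * ‖x‖⁻¹ ^ (2 + 1) := by ring
      _ ≤ _ := by gcongr
  refine ⟨hloc, fun x hx => ?_⟩
  have hm : AEStronglyMeasurable (fun s => duhamel u j h k t s x) (volume.restrict (Ioc 0 t)) :=
    ((measurable_oseenDiv_shift j h k t x).aestronglyMeasurable.mul
      (H.measurable_Ioc t h k)).integral_prod_right'
  refine Integrable.mono' (integrable_const (K * (U * U) * ‖x‖⁻¹ ^ 3)) hm ?_
  filter_upwards [hloc] with s hs
  exact (hs x hx).2.abs_le

lemma FlowBd.integrable_heat (H : FlowBd a u A U) {t : ℝ} (ht : 0 < t) {x : Sp d} (hx : x ≠ 0)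
    (j : Fin d) : Integrable fun y => gauss t (x - y) * a y j := by
  obtain ⟨C, hC, h⟩ := exists_localBd_heat_sub (by have := H.three_le; omega : 1 < d)
  exact (h t ht _ A H.datum_nonneg (H.datum j) x hx).1

/-- The integral form of the Navier–Stokes equations, component by component. -/
lemma FlowBd.velocity_eq (H : FlowBd a u A U) {t : ℝ} (ht : 0 < t) {x : Sp d} (hx : x ≠ 0)
    (j : Fin d) :
    u t x j = heat t a x j - ∑ h, ∑ k, ∫ s in Ioc 0 t, duhamel u j h k t s x := by
  obtain ⟨C, hC, h⟩ := FlowBd.exists_localBd_duhamel d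
  have hcomp : ∀ᵐ s ∂(volume.restrict (Ioc 0 t)), ∀ j : Fin d,
      heatLerayDiv (t - s) (fun y => outer (u s y) (u s y)) x j
        = ∑ h, ∑ k, duhamel u j h k t s x := by
    have : ∀ᵐ s ∂(volume.restrict (Ioc 0 t)), ∀ j h k : Fin d,
        Integrable fun y => oseenDiv (t - s) (x - y) j h k * (u s y h * u s y k) := by
      simp only [ae_all_iff]
      intro j h' k
      filter_upwards [(h a u A U H j h' k t ht).1] with s hs
      exact (hs x hx).1
    filter_upwards [this] with s hs j
    exact heatLerayDiv_outer_apply hs j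
  have hi : ∀ j : Fin d, Integrable (fun s => ∑ h, ∑ k, duhamel u j h k t s x)
      (volume.restrict (Ioc 0 t)) := fun j =>
    integrable_finsetSum _ fun h' _ => integrable_finsetSum _ fun k _ =>
      (h a u A U H j h' k t ht).2 x hx
  rw [H.mild.2 t ht x, intervalIntegral.integral_of_le ht.le, PiLp.sub_apply,
    eval_integral_piLp (q := 2) (fun i => (hi i).congr (by
      filter_upwards [hcomp] with s hs
      exact (hs i).symm))]
  congr 1
  rw [integral_congr_ae (by filter_upwards [hcomp] with s hs; exact hs j),
    integral_finsetSum _ fun h' _ => integrable_finsetSum _ fun k _ =>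
      (h a u A U H j h' k t ht).2 x hx]
  refine Finset.sum_congr rfl fun h' _ => ?_
  rw [integral_finsetSum _ fun k _ => (h a u A U H j h' k t ht).2 x hx]

lemma LocalBd.sum {ι : Type*} (S : Finset ι) {f : ι → Sp d → ℝ} {x : Sp d} {m : ℝ}
    (h : ∀ i ∈ S, LocalBd (f i) x m) : LocalBd (fun y => ∑ i ∈ S, f i y) x (S.card * m) := by
  classical
  induction S using Finset.induction_on with
  | empty => intro x' _; simp
  | insert i S hi ih =>
    have h1 := (h i (Finset.mem_insert_self i S)).add
      (ih fun k hk => h k (Finset.mem_insert_of_mem hk))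
    simp only [Finset.sum_insert hi, Finset.card_insert_of_notMem hi]
    refine h1.mono (le_of_eq ?_)
    push_cast; ring

/-- The solution stays within `O(s |x|^{-3})` of its datum, with a matching Lipschitz bound. -/
lemma FlowBd.exists_localBd_sub_datum (H : FlowBd a u A U) : ∃ C : ℝ, 0 ≤ C ∧ ∀ s, 0 < s →
    ∀ x, x ≠ 0 → ∀ j : Fin d, LocalBd (fun y => u s y j - a y j) x (C * s * ‖x‖⁻¹ ^ 3) := by
  have hd := H.three_le
  obtain ⟨C₁, hC₁, h₁⟩ := FlowBd.exists_localBd_duhamel d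
  obtain ⟨C₂, hC₂, h₂⟩ := exists_localBd_heat_sub (by omega : 1 < d)
  have hA := H.datum_nonneg
  have hU := H.velocity_nonneg
  refine ⟨C₂ * A + d * (d * (C₁ * (U * U))), by positivity, fun s hs x hx j => ?_⟩
  have hx0 := norm_pos_iff.2 hx
  have hne : ∀ x' : Sp d, ‖x' - x‖ ≤ ‖x‖ / 8 → x' ≠ 0 := fun x' hx' =>
    norm_pos_iff.1 (by linarith [norm_ge_of_near hx'])
  have hD : ∀ h k : Fin d, LocalBd (fun y => ∫ σ in Ioc 0 s, duhamel u j h k s σ y) x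
      (C₁ * (U * U) * s * ‖x‖⁻¹ ^ 3) := by
    intro h k x' hx'
    obtain ⟨a1, a2⟩ := h₁ a u A U H j h k s hs
    constructor
    · have : ‖∫ σ in Ioc 0 s, duhamel u j h k s σ x'‖
          ≤ C₁ * (U * U) * ‖x‖⁻¹ ^ 3 * volume.real (Ioc 0 s) := by
        refine norm_setIntegral_le_of_norm_le_const_ae (by simp) ?_
        filter_upwards [a1] with σ hσ
        exact ((hσ x hx).2 x' hx').1
      rw [Real.volume_real_Ioc_of_le hs.le, sub_zero] at this
      exact this.trans (le_of_eq (by ring))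
    · have : ‖∫ σ in Ioc 0 s, (duhamel u j h k s σ x' - duhamel u j h k s σ x)‖
          ≤ C₁ * (U * U) * ‖x‖⁻¹ ^ 3 * ‖x‖⁻¹ * ‖x' - x‖ * volume.real (Ioc 0 s) := by
        refine norm_setIntegral_le_of_norm_le_const_ae (by simp) ?_
        filter_upwards [a1] with σ hσ
        exact ((hσ x hx).2 x' hx').2
      rw [Real.volume_real_Ioc_of_le hs.le, sub_zero,
        integral_sub (a2 x' (hne x' hx')) (a2 x hx)] at this
      exact this.trans (le_of_eq (by ring))
  have hS := LocalBd.sum Finset.univ (fun h _ => LocalBd.sum Finset.univ fun k _ => hD h k)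
  have hT := ((h₂ s hs _ A hA (H.datum j) x hx).2.sub hS).mono
    (m' := (C₂ * A + d * (d * (C₁ * (U * U)))) * s * ‖x‖⁻¹ ^ 3)
    (by simp only [Finset.card_univ, Fintype.card_fin]; exact le_of_eq (by ring))
  have e : ∀ y : Sp d, y ≠ 0 → u s y j - a y j
      = (∫ z, gauss s (y - z) * a z j) - a y j
        - ∑ h, ∑ k, ∫ σ in Ioc 0 s, duhamel u j h k s σ y := by
    intro y hy
    rw [H.velocity_eq hs hy j, heat_apply (fun i => H.integrable_heat hs hy i)]
    ring
  intro x' hx'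
  have := hT x' hx'
  simp only at this ⊢
  rwa [e x' (hne x' hx'), e x hx]

/-! ### The defect between `u ⊗ u` and the heat extension of `a ⊗ a` -/

/-- The components of `u ⊗ u - e^{sΔ}(a ⊗ a)` at time `s`. -/
noncomputable def defect (a : Sp d → Sp d) (u : ℝ → Sp d → Sp d) (h k : Fin d) (s : ℝ)
    (y : Sp d) : ℝ :=
  u s y h * u s y k - ∫ z, gauss s (y - z) * (a z h * a z k)

lemma FlowBd.exists_heat_mul_le (H : FlowBd a u A U) : ∃ C : ℝ, 0 ≤ C ∧ ∀ s, 0 < s →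
    ∀ h k : Fin d, ∀ y : Sp d, |∫ z, gauss s (y - z) * (a z h * a z k)| ≤ C * s⁻¹ := by
  have hd := H.three_le
  obtain ⟨C, hC, h₁⟩ := exists_integral_gauss_mul_inv_norm_le (by omega : 2 < d)
  have hA := H.datum_nonneg
  refine ⟨8 * (A * A) * C, by positivity, fun s hs h k y => ?_⟩
  obtain ⟨i, b⟩ := h₁ s hs y
  rw [← Real.norm_eq_abs]
  refine (norm_integral_le_of_norm_le (i.const_mul (8 * (A * A))) ?_).trans ?_
  · filter_upwards [ae_ne_zero (by omega : 0 < d)] with z hz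
    have hg := gauss_pos hs (y - z)
    rw [norm_mul, Real.norm_of_nonneg hg.le, Real.norm_eq_abs]
    calc _ ≤ gauss s (y - z) * (8 * (A * A) * ‖z‖⁻¹ ^ 2) := by
          gcongr; exact (H.datum_mul h k).abs_le hz
      _ = _ := by ring
  · rw [integral_const_mul, inv_eq_sqrt_inv_sq hs, mul_assoc _ C]
    gcongr

/-- For each fixed time, the defect is bounded by `min(s⁻¹, s |x|⁻⁴)`, with a matching Lipschitz
bound away from the origin. -/
lemma FlowBd.exists_defect_le (H : FlowBd a u A U) : ∃ C : ℝ, 0 ≤ C ∧ ∀ s, 0 < s →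
    VelocityBd u U s → ∀ h k : Fin d, (∀ x, |defect a u h k s x| ≤ C * s⁻¹) ∧
      ∀ x, x ≠ 0 → LocalBd (defect a u h k s) x (C * s * ‖x‖⁻¹ ^ 4) := by
  have hd := H.three_le
  obtain ⟨C₀, hC₀, h₀⟩ := H.exists_heat_mul_le
  obtain ⟨C₁, hC₁, h₁⟩ := H.exists_localBd_sub_datum
  obtain ⟨C₂, hC₂, h₂⟩ := exists_localBd_of_homBd d 1
  obtain ⟨C₃, hC₃, h₃⟩ := exists_localBd_heat_sub (by omega : 2 < d)
  have hA := H.datum_nonneg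
  have hU := H.velocity_nonneg
  set K := 2 * (C₁ * (C₂ * U)) + 2 * (C₂ * A * C₁) + C₃ * (8 * (A * A)) with hK
  refine ⟨max (U * U + C₀) K, by positivity, fun s hs hV h k => ⟨fun x => ?_, fun x hx => ?_⟩⟩
  · have a1 := mul_le_mul (hV.2 h x) (hV.2 k x) (abs_nonneg _) (by positivity)
    have hq : (√s)⁻¹ * (√s)⁻¹ = s⁻¹ := by rw [inv_eq_sqrt_inv_sq hs, sq]
    calc |defect a u h k s x| ≤ |u s x h * u s x k| + |∫ z, gauss s (x - z) * (a z h * a z k)| :=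
          abs_sub _ _
      _ ≤ U * (√s)⁻¹ * (U * (√s)⁻¹) + C₀ * s⁻¹ := by
          rw [abs_mul]; exact add_le_add a1 (h₀ s hs h k x)
      _ = (U * U + C₀) * s⁻¹ := by rw [← hq]; ring
      _ ≤ _ := by gcongr; exact le_max_left _ _
  · -- `u_h u_k - e^{sΔ}(a_h a_k) = (u_h - a_h) u_k + a_h (u_k - a_k) - (e^{sΔ} - 1)(a_h a_k)`, and
    -- each of the three terms gains a factor `s |x|⁻²` over `|x|⁻²`.
    have b1 := (h₁ s hs x hx h).mul (h₂ _ U hU (hV.1 k) x hx)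
    have b2 := (h₂ _ A hA (H.datum h) x hx).mul (h₁ s hs x hx k)
    have b3 := (h₃ s hs _ _ (by positivity) (H.datum_mul h k) x hx).2
    have b := ((b1.add b2).sub b3).mono (m' := max (U * U + C₀) K * s * ‖x‖⁻¹ ^ 4) (by
      calc _ = K * s * ‖x‖⁻¹ ^ 4 := by rw [hK]; ring
        _ ≤ _ := by gcongr; exact le_max_right _ _)
    have e : defect a u h k s = fun y => (u s y h - a y h) * u s y k + a y h * (u s y k - a y k)
        - ((∫ z, gauss s (y - z) * (a z h * a z k)) - a y h * a y k) := by
      funext y; unfold defect; ring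
    rw [e]
    exact b

lemma FlowBd.measurable_defect (H : FlowBd a u A U) (t : ℝ) (h k : Fin d) :
    AEStronglyMeasurable (fun p : ℝ × Sp d => defect a u h k p.1 p.2)
      ((volume.restrict (Ioc 0 t)).prod volume) := by
  have hd := H.three_le
  have hb := (H.datum_mul h k).aestronglyMeasurable (by omega)
  refine (H.measurable_Ioc t h k).sub ?_
  have hg : Measurable fun p : (ℝ × Sp d) × Sp d => gauss p.1.1 (p.1.2 - p.2) :=
    measurable_gauss.comp
      (by fun_prop : Measurable fun p : (ℝ × Sp d) × Sp d => (p.1.1, p.1.2 - p.2))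
  have : AEStronglyMeasurable
      (fun p : (ℝ × Sp d) × Sp d => gauss p.1.1 (p.1.2 - p.2) * (a p.2 h * a p.2 k))
      (((volume.restrict (Ioc 0 t)).prod volume).prod volume) :=
    hg.aestronglyMeasurable.mul hb.comp_snd
  exact this.integral_prod_right'

lemma FlowBd.measurable_heat_mul (H : FlowBd a u A U) (s : ℝ) (h k : Fin d) :
    AEStronglyMeasurable (fun y => ∫ z, gauss s (y - z) * (a z h * a z k)) volume := by
  have hd := H.three_le
  have hb := (H.datum_mul h k).aestronglyMeasurable (by omega)
  have hg : Measurable fun p : Sp d × Sp d => gauss s (p.1 - p.2) :=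
    measurable_gauss.comp (by fun_prop : Measurable fun p : Sp d × Sp d => (s, p.1 - p.2))
  have : AEStronglyMeasurable (fun p : Sp d × Sp d => gauss s (p.1 - p.2) * (a p.2 h * a p.2 k))
      (volume.prod volume) := hg.aestronglyMeasurable.mul hb.comp_snd
  exact this.integral_prod_right'

lemma FlowBd.measurable_defect_right (H : FlowBd a u A U) {s : ℝ} (hV : VelocityBd u U s)
    (h k : Fin d) : AEStronglyMeasurable (defect a u h k s) volume :=
  ((hV.mul H.velocity_nonneg h k).aestronglyMeasurable (by have := H.three_le; omega)).sub
    (H.measurable_heat_mul s h k)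

/-- By the semigroup property, `e^{(t-s)Δ} P∇·` applied to the heat extension of `a ⊗ a` does not
depend on `s`. -/
lemma FlowBd.integral_oseenDiv_heat (H : FlowBd a u A U) {t s : ℝ} (hs : 0 < s) (hst : s < t)
    (x : Sp d) (j h k : Fin d) :
    ∫ y, oseenDiv (t - s) (x - y) j h k * ∫ z, gauss s (y - z) * (a z h * a z k)
      = ∫ z, oseenDiv t (x - z) j h k * (a z h * a z k) := by
  have hd := H.three_le
  have hτ : 0 < t - s := by linarith
  have hA := H.datum_nonneg
  have hb := (H.datum_mul h k).aestronglyMeasurable (by omega)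
  obtain ⟨C, hC, h₁⟩ := exists_integral_gauss_mul_inv_norm_le (by omega : 2 < d)
  have hF := integrable_oseenDiv hτ j h k x
  have hg : Measurable fun p : Sp d × Sp d => gauss s (p.1 - p.2) :=
    measurable_gauss.comp (by fun_prop : Measurable fun p : Sp d × Sp d => (s, p.1 - p.2))
  have hm2 : AEStronglyMeasurable (fun p : Sp d × Sp d => gauss s (p.1 - p.2) * (a p.2 h * a p.2 k))
      (volume.prod volume) := hg.aestronglyMeasurable.mul hb.comp_snd
  have hm : AEStronglyMeasurable (fun p : Sp d × Sp d =>
      oseenDiv (t - s) (x - p.1) j h k * (gauss s (p.1 - p.2) * (a p.2 h * a p.2 k)))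
      (volume.prod volume) := hF.1.comp_fst.mul hm2
  have hbd : ∀ y : Sp d, ∀ᵐ z : Sp d, ‖gauss s (y - z) * (a z h * a z k)‖
      ≤ 8 * (A * A) * (gauss s (y - z) * ‖z‖⁻¹ ^ 2) := by
    intro y
    filter_upwards [ae_ne_zero (by omega : 0 < d)] with z hz
    have hg := gauss_pos hs (y - z)
    rw [norm_mul, Real.norm_of_nonneg hg.le, Real.norm_eq_abs]
    calc _ ≤ gauss s (y - z) * (8 * (A * A) * ‖z‖⁻¹ ^ 2) := by
          gcongr; exact (H.datum_mul h k).abs_le hz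
      _ = _ := by ring
  have hgm : ∀ y : Sp d, AEStronglyMeasurable (fun z => gauss s (y - z) * (a z h * a z k)) volume :=
    fun y => ((continuous_gauss s).comp (by fun_prop : Continuous fun z => y - z)
      ).aestronglyMeasurable.mul hb
  have hgi : ∀ y : Sp d, Integrable fun z => gauss s (y - z) * (a z h * a z k) := fun y =>
    ((h₁ s hs y).1.const_mul (8 * (A * A))).mono' (hgm y) (hbd y)
  have hint : Integrable (fun p : Sp d × Sp d =>
      oseenDiv (t - s) (x - p.1) j h k * (gauss s (p.1 - p.2) * (a p.2 h * a p.2 k)))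
      (volume.prod volume) := by
    rw [integrable_prod_iff hm]
    refine ⟨Filter.Eventually.of_forall fun y => (hgi y).const_mul (oseenDiv (t - s) (x - y) j h k), ?_⟩
    refine (hF.norm.mul_const (8 * (A * A) * (C * (√s)⁻¹ ^ 2))).mono' hm.norm.integral_prod_right'
      (Filter.Eventually.of_forall fun y => ?_)
    rw [Real.norm_of_nonneg (integral_nonneg fun _ => norm_nonneg _)]
    simp only [norm_mul (oseenDiv _ _ _ _ _)]
    rw [integral_const_mul]
    gcongr
    calc _ ≤ ∫ z, 8 * (A * A) * (gauss s (y - z) * ‖z‖⁻¹ ^ 2) :=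
          integral_mono_ae (hgi y).norm ((h₁ s hs y).1.const_mul _) (hbd y)
      _ ≤ _ := by rw [integral_const_mul]; gcongr; exact (h₁ s hs y).2
  calc _ = ∫ y, ∫ z, oseenDiv (t - s) (x - y) j h k * (gauss s (y - z) * (a z h * a z k)) := by
        simp_rw [integral_const_mul]
    _ = ∫ z, ∫ y, oseenDiv (t - s) (x - y) j h k * (gauss s (y - z) * (a z h * a z k)) :=
        integral_integral_swap hint
    _ = _ := by
        refine integral_congr_ae (Filter.Eventually.of_forall fun z => ?_)
        simp only [← mul_assoc]
        simp_rw [mul_assoc _ (a z h)]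
        rw [integral_mul_const, integral_oseenDiv_mul_gauss hτ hs, sub_add_cancel]

lemma FlowBd.integrable_oseenDiv_datum (H : FlowBd a u A U) {t : ℝ} (ht : 0 < t) {x : Sp d}
    (hx : x ≠ 0) (j h k : Fin d) :
    Integrable fun y => oseenDiv t (x - y) j h k * (a y h * a y k) := by
  obtain ⟨C, hC, h₁⟩ := exists_localBd_oseenDiv (by have := H.three_le; omega : 2 < d) j h k
  have hA := H.datum_nonneg
  exact (h₁ t ht _ _ (by positivity) (H.datum_mul h k) x hx).1

lemma FlowBd.integral_oseenDiv_defect (H : FlowBd a u A U) {t s : ℝ} (hs : 0 < s) (hst : s < t)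
    (hV : VelocityBd u U s) (x : Sp d) (j h k : Fin d) :
    ∫ y, oseenDiv (t - s) (x - y) j h k * defect a u h k s y
      = duhamel u j h k t s x - ∫ y, oseenDiv t (x - y) j h k * (a y h * a y k) := by
  have hτ : 0 < t - s := by linarith
  obtain ⟨C, hC, h₁⟩ := H.exists_heat_mul_le
  have hU := H.velocity_nonneg
  rw [← H.integral_oseenDiv_heat hs hst x j h k, duhamel, ← integral_sub]
  · simp_rw [defect, mul_sub]
  · refine integrable_oseenDiv_mul hτ j h k x ((hV.mul hU h k).aestronglyMeasurable
      (by have := H.three_le; omega)) (M := U * (√s)⁻¹ * (U * (√s)⁻¹)) fun y => ?_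
    rw [abs_mul]
    exact mul_le_mul (hV.2 h y) (hV.2 k y) (abs_nonneg _) (by positivity)
  · exact integrable_oseenDiv_mul hτ j h k x (H.measurable_heat_mul s h k) (h₁ s hs h k)

/-! ### The Oseen kernel acting on a concentrated profile -/

/-- The profile `w` has size `min (s⁻¹, s |y|⁻⁴)` up to the factor `K`, and a matching Lipschitz
bound away from the origin. -/
structure DecayBd (w : Sp d → ℝ) (K s : ℝ) : Prop where
  pos : 0 < s
  nonneg : 0 ≤ K
  measurable : AEStronglyMeasurable w volume
  bdd : ∀ y, |w y| ≤ K * s⁻¹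
  localBd : ∀ x, x ≠ 0 → LocalBd w x (K * s * ‖x‖⁻¹ ^ 4)

namespace DecayBd

variable {w : Sp d → ℝ} {K s : ℝ}

/-- The two bounds on a profile merged into one, valid everywhere. -/
lemma abs_le (H : DecayBd w K s) (y : Sp d) : |w y| ≤ 16 * (K * s) * (√s + ‖y‖)⁻¹ ^ 4 := by
  have hs := H.pos
  have hK := H.nonneg
  have hq : 0 < √s := Real.sqrt_pos.2 hs
  have hn := norm_nonneg y
  -- The two bounds agree at `|y| = √s`, where `√s + |y|` is comparable to both.
  rcases le_total ‖y‖ (√s) with h | h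
  · have h1 : (2 * √s)⁻¹ ≤ (√s + ‖y‖)⁻¹ := inv_anti₀ (by positivity) (by linarith)
    have hss : s * (√s)⁻¹ ^ 2 = 1 := by rw [← inv_eq_sqrt_inv_sq hs, mul_inv_cancel₀ hs.ne']
    calc |w y| ≤ K * s⁻¹ := H.bdd y
      _ = K * (√s)⁻¹ ^ 2 * (s * (√s)⁻¹ ^ 2) := by rw [hss, mul_one, inv_eq_sqrt_inv_sq hs]
      _ = 16 * (K * s) * (2 * √s)⁻¹ ^ 4 := by rw [mul_inv]; ring
      _ ≤ _ := by gcongr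
  · have hy : 0 < ‖y‖ := hq.trans_le h
    have h1 : (2 * ‖y‖)⁻¹ ≤ (√s + ‖y‖)⁻¹ := inv_anti₀ (by positivity) (by linarith)
    calc |w y| ≤ K * s * ‖y‖⁻¹ ^ 4 := (H.localBd y (norm_pos_iff.1 hy)).abs_le
      _ = 16 * (K * s) * (2 * ‖y‖)⁻¹ ^ 4 := by rw [mul_inv]; ring
      _ ≤ _ := by gcongr

lemma abs_farPart_le (H : DecayBd w K s) {R : ℝ} (hR : 0 < R) (y : Sp d) :
    |farPart R w y| ≤ 256 * (K * s * R⁻¹ ^ 4) := by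
  have hs := H.pos
  have hK := H.nonneg
  rcases le_or_gt ‖y‖ (R / 4) with h | h
  · rw [farPart_of_le hR w h, abs_zero]; positivity
  · have hy : 0 < ‖y‖ := lt_trans (by positivity) h
    have h1 : ‖y‖⁻¹ ≤ (R / 4)⁻¹ := inv_anti₀ (by positivity) h.le
    calc _ ≤ |w y| := NSFar.abs_farPart_le R w y
      _ ≤ K * s * ‖y‖⁻¹ ^ 4 := (H.localBd y (norm_pos_iff.1 hy)).abs_le
      _ ≤ K * s * (R / 4)⁻¹ ^ 4 := by gcongr
      _ = _ := by rw [inv_div, div_eq_mul_inv]; ring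

/-- The contribution of the far part, where the kernel is singular but the profile is smooth. -/
lemma exists_integral_oseenDiv_mul_farPart_le (j h k : Fin d) : ∃ C : ℝ, 0 ≤ C ∧
    ∀ (w : Sp d → ℝ) (K s : ℝ), DecayBd w K s → ∀ τ : ℝ, 0 < τ → ∀ x : Sp d, x ≠ 0 →
      |∫ y, oseenDiv τ (x - y) j h k * farPart ‖x‖ w y|
        ≤ C * (K * s * ‖x‖⁻¹ ^ 5) * (1 + Real.log (1 + ‖x‖ ^ 2 / τ)) := by
  obtain ⟨C, hC, H⟩ := exists_integral_oseenDiv_mul_le_log j h k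
  refine ⟨C * 4096, by positivity, fun w K s hw τ hτ x hx => ?_⟩
  have hs := hw.pos
  have hK := hw.nonneg
  have hR := norm_pos_iff.2 hx
  have hB : 0 ≤ K * s * ‖x‖⁻¹ ^ 4 := by positivity
  refine (H τ hτ (farPart ‖x‖ w) (4096 * (K * s * ‖x‖⁻¹ ^ 4)) ‖x‖ hR
    (aestronglyMeasurable_farPart _ hw.measurable)
    (fun y => (hw.abs_farPart_le hR y).trans (by gcongr; norm_num)) x fun y => ?_).trans
    (le_of_eq (by ring))
  rcases le_or_gt ‖y - x‖ (‖x‖ / 8) with hy | hy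
  · have h1 := norm_ge_of_near hy
    rw [farPart_of_ge hR w (by linarith), farPart_of_ge hR w (by linarith)]
    refine (hw.localBd x hx y hy).2.trans ?_
    exact mul_le_mul_of_nonneg_right
      (mul_le_mul_of_nonneg_right (by linarith) (by positivity)) (norm_nonneg _)
  · -- Far from `x` the Lipschitz bound at scale `|x|` is a consequence of the uniform bound.
    have h2 : 1 ≤ 8 * (‖x‖⁻¹ * ‖y - x‖) := by
      rw [← mul_inv_cancel₀ hR.ne']
      have : ‖x‖ ≤ 8 * ‖y - x‖ := by linarith
      calc ‖x‖ * ‖x‖⁻¹ ≤ (8 * ‖y - x‖) * ‖x‖⁻¹ := by gcongr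
        _ = _ := by ring
    calc _ ≤ |farPart ‖x‖ w y| + |farPart ‖x‖ w x| := abs_sub _ _
      _ ≤ 512 * (K * s * ‖x‖⁻¹ ^ 4) * 1 := by
          linarith [hw.abs_farPart_le hR y, hw.abs_farPart_le hR x]
      _ ≤ 512 * (K * s * ‖x‖⁻¹ ^ 4) * (8 * (‖x‖⁻¹ * ‖y - x‖)) := by gcongr
      _ = _ := by ring

/-- Pairing with the near part costs a logarithm, as soon as the weight makes the profile
borderline integrable at infinity. -/
lemma exists_integral_mul_nearPart_le (hd : 0 < d) : ∃ C : ℝ, 0 ≤ C ∧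
    ∀ (w : Sp d → ℝ) (K s : ℝ), DecayBd w K s → ∀ R : ℝ, 0 < R → ∀ (κ : Sp d → ℝ) (B : ℝ), 0 ≤ B →
      (∀ y, ‖y‖ ≤ R / 2 → |κ y| * (√s + ‖y‖)⁻¹ ^ 4 ≤ B * (√s + ‖y‖)⁻¹ ^ d) →
      |∫ y, κ y * nearPart R w y| ≤ C * (B * (K * s)) * Real.log (1 + R / √s) := by
  obtain ⟨C, hC, h⟩ := exists_integral_log_le hd
  refine ⟨16 * C, by positivity, fun w K s hw R hR κ B hB hκ => ?_⟩
  have hs := hw.pos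
  have hK := hw.nonneg
  have hq : 0 < √s := Real.sqrt_pos.2 hs
  obtain ⟨i, v⟩ := h R hR (√s) hq
  have hmeas : MeasurableSet (norm ⁻¹' Iic R : Set (Sp d)) := measurable_norm measurableSet_Iic
  set S : Set (Sp d) := norm ⁻¹' Iic R with hS
  have hbd : ∀ y, ‖κ y * nearPart R w y‖
      ≤ S.indicator (fun y => 16 * (K * s) * B * (√s + ‖y‖)⁻¹ ^ d) y := by
    intro y
    rcases le_or_gt ‖y‖ (R / 2) with hy | hy
    · have hyS : y ∈ S := by rw [hS, mem_preimage, mem_Iic]; linarith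
      rw [indicator_of_mem hyS, Real.norm_eq_abs, abs_mul]
      calc _ ≤ |κ y| * (16 * (K * s) * (√s + ‖y‖)⁻¹ ^ 4) := by
            gcongr; exact (NSFar.abs_nearPart_le R w y).trans (hw.abs_le y)
        _ = 16 * (K * s) * (|κ y| * (√s + ‖y‖)⁻¹ ^ 4) := by ring
        _ ≤ 16 * (K * s) * (B * (√s + ‖y‖)⁻¹ ^ d) :=
            mul_le_mul_of_nonneg_left (hκ y hy) (by positivity)
        _ = _ := by ring
    · rw [nearPart_of_ge hR w hy.le, mul_zero, norm_zero]
      exact indicator_nonneg (fun y _ => by positivity) y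
  have := norm_integral_le_of_norm_le ((integrable_indicator_iff hmeas).2
    (i.const_mul (16 * (K * s) * B))) (Filter.Eventually.of_forall hbd)
  rw [Real.norm_eq_abs] at this
  refine this.trans ?_
  rw [integral_indicator hmeas, integral_const_mul]
  calc _ ≤ 16 * (K * s) * B * (C * Real.log (1 + R / √s)) := by gcongr
    _ = _ := by ring

/-- In dimension at least four, the near part contributes only to the remainder. -/
lemma exists_integral_oseenDiv_mul_nearPart_le (hd : 4 ≤ d) (j h k : Fin d) : ∃ C : ℝ, 0 ≤ C ∧
    ∀ (w : Sp d → ℝ) (K s : ℝ), DecayBd w K s → ∀ τ : ℝ, 0 < τ → ∀ x : Sp d, x ≠ 0 → √s ≤ ‖x‖ →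
      |∫ y, oseenDiv τ (x - y) j h k * nearPart ‖x‖ w y|
        ≤ C * (K * s * ‖x‖⁻¹ ^ 5) * Real.log (1 + ‖x‖ / √s) := by
  obtain ⟨C, hC, H⟩ := exists_integral_mul_nearPart_le (by omega : 0 < d)
  obtain ⟨C₁, hC₁, h₁⟩ := exists_oseenDiv_le j h k
  obtain ⟨n, rfl⟩ : ∃ n, d = n + 4 := ⟨d - 4, by omega⟩
  refine ⟨C * (C₁ * 2 ^ (n + 5) * 2 ^ n), by positivity, fun w K s hw τ hτ x hx hsx => ?_⟩
  have hs := hw.pos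
  have hR := norm_pos_iff.2 hx
  have hq : 0 < √s := Real.sqrt_pos.2 hs
  have hRR : ‖x‖⁻¹ * ‖x‖ = 1 := inv_mul_cancel₀ hR.ne'
  refine (H w K s hw ‖x‖ hR _ (C₁ * 2 ^ (n + 5) * 2 ^ n * ‖x‖⁻¹ ^ 5) (by positivity)
    fun y hy => ?_).trans (le_of_eq (by ring))
  have hn := norm_nonneg y
  have hxy : ‖x‖ / 2 ≤ ‖x - y‖ := by linarith [norm_sub_norm_le x y]
  have hxy0 : 0 < ‖x - y‖ := lt_of_lt_of_le (by positivity) hxy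
  -- The `d - 4` powers that the profile lacks are paid for by `√s + |y| ≤ 2|x|`.
  have e : (√s + ‖y‖)⁻¹ ^ 4 = (√s + ‖y‖) ^ n * (√s + ‖y‖)⁻¹ ^ (n + 4) := by
    rw [pow_add _ n, ← mul_assoc, ← mul_pow, mul_inv_cancel₀ (by positivity), one_pow, one_mul]
  calc |oseenDiv τ (x - y) j h k| * (√s + ‖y‖)⁻¹ ^ 4
      ≤ C₁ * (‖x‖ / 2)⁻¹ ^ (n + 4 + 1) * ((2 * ‖x‖) ^ n * (√s + ‖y‖)⁻¹ ^ (n + 4)) := by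
        rw [e]
        gcongr
        · refine (h₁ _ (norm_pos_iff.1 hxy0) τ hτ).trans ?_
          gcongr
        · linarith
    _ = C₁ * 2 ^ (n + 5) * 2 ^ n * ‖x‖⁻¹ ^ 5 * (‖x‖⁻¹ * ‖x‖) ^ n * (√s + ‖y‖)⁻¹ ^ (n + 4) := by
        rw [inv_div, div_eq_mul_inv]; ring
    _ = _ := by rw [hRR, one_pow, mul_one]

/-- In dimension three the profile is integrable. -/
lemma exists_integral_norm_le : ∃ C : ℝ, 0 ≤ C ∧ ∀ (w : Sp 3 → ℝ) (K s : ℝ), DecayBd w K s →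
    Integrable w ∧ ∫ y, ‖w y‖ ≤ C * (K * √s) := by
  obtain ⟨C₁, hC₁, h₁⟩ := exists_integral_log_le (by norm_num : 0 < 3)
  obtain ⟨C₂, hC₂, h₂⟩ := exists_integral_far_inv_norm_pow_le (by norm_num : 0 < 3)
    (by norm_num : 3 < 4)
  refine ⟨16 * C₁ + C₂, by positivity, fun w K s hw => ?_⟩
  have hs := hw.pos
  have hK := hw.nonneg
  have hq : 0 < √s := Real.sqrt_pos.2 hs
  obtain ⟨i₁, v₁⟩ := h₁ (√s) hq (√s) hq
  obtain ⟨i₂, v₂⟩ := h₂ (√s) hq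
  have hS : MeasurableSet (norm ⁻¹' Iic (√s) : Set (Sp 3)) := measurable_norm measurableSet_Iic
  have hT : MeasurableSet (norm ⁻¹' Ioi (√s) : Set (Sp 3)) := measurable_norm measurableSet_Ioi
  set S : Set (Sp 3) := norm ⁻¹' Iic (√s) with hSd
  set T : Set (Sp 3) := norm ⁻¹' Ioi (√s) with hTd
  have j₁ := (integrable_indicator_iff hS).2 (i₁.const_mul (16 * (K * √s)))
  have j₂ := (integrable_indicator_iff hT).2 (i₂.const_mul (K * s))
  have hss : s * (√s)⁻¹ = √s := by rw [← div_eq_mul_inv, Real.div_sqrt]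
  have hbd : ∀ y, ‖w y‖ ≤ S.indicator (fun y => 16 * (K * √s) * (√s + ‖y‖)⁻¹ ^ 3) y
      + T.indicator (fun y => K * s * ‖y‖⁻¹ ^ 4) y := by
    intro y
    rcases le_or_gt ‖y‖ (√s) with hy | hy
    · have hyS : y ∈ S := hy
      have hyT : y ∉ T := not_lt.2 hy
      rw [indicator_of_mem hyS, indicator_of_notMem hyT, add_zero, Real.norm_eq_abs]
      have hn := norm_nonneg y
      calc |w y| ≤ 16 * (K * s) * (√s + ‖y‖)⁻¹ ^ 4 := hw.abs_le y
        _ = 16 * (K * s) * ((√s + ‖y‖)⁻¹ * (√s + ‖y‖)⁻¹ ^ 3) := by ring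
        _ ≤ 16 * (K * s) * ((√s)⁻¹ * (√s + ‖y‖)⁻¹ ^ 3) := by gcongr; linarith
        _ = 16 * (K * (s * (√s)⁻¹)) * (√s + ‖y‖)⁻¹ ^ 3 := by ring
        _ = _ := by rw [hss]
    · have hyS : y ∉ S := not_le.2 hy
      have hyT : y ∈ T := hy
      rw [indicator_of_mem hyT, indicator_of_notMem hyS, zero_add, Real.norm_eq_abs]
      exact (hw.localBd y (norm_pos_iff.1 (hq.trans hy))).abs_le
  refine ⟨(j₁.add j₂).mono' hw.measurable (Filter.Eventually.of_forall hbd), ?_⟩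
  have hlog : Real.log (1 + √s / √s) ≤ 1 := by
    rw [div_self hq.ne']
    linarith [Real.log_le_sub_one_of_pos (by norm_num : (0 : ℝ) < 1 + 1)]
  calc ∫ y, ‖w y‖ ≤ ∫ y, (S.indicator (fun y => 16 * (K * √s) * (√s + ‖y‖)⁻¹ ^ 3) y
      + T.indicator (fun y => K * s * ‖y‖⁻¹ ^ 4) y) :=
        integral_mono_of_nonneg (Filter.Eventually.of_forall fun _ => norm_nonneg _) (j₁.add j₂)
          (Filter.Eventually.of_forall hbd)
    _ = 16 * (K * √s) * (∫ y in S, (√s + ‖y‖)⁻¹ ^ 3) + K * s * ∫ y in T, ‖y‖⁻¹ ^ 4 := by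
        rw [integral_add j₁ j₂, integral_indicator hS, integral_indicator hT, integral_const_mul,
          integral_const_mul]
    _ ≤ 16 * (K * √s) * (C₁ * 1) + K * s * (C₂ * (√s ^ 3 * (√s)⁻¹ ^ 4)) := by
        gcongr
        exact v₁.trans (by gcongr)
    _ = 16 * (K * √s) * C₁ + K * C₂ * (s * (√s)⁻¹) * (√s * (√s)⁻¹) ^ 3 := by ring
    _ = _ := by rw [mul_inv_cancel₀ hq.ne', hss]; ring

/-- In dimension three the far part carries only a small portion of the mass of the profile. -/
lemma exists_integral_farPart_le : ∃ C : ℝ, 0 ≤ C ∧ ∀ (w : Sp 3 → ℝ) (K s : ℝ), DecayBd w K s →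
    ∀ R : ℝ, 0 < R → |∫ y, farPart R w y| ≤ C * (K * s * R⁻¹) := by
  obtain ⟨C₂, hC₂, h₂⟩ := exists_integral_far_inv_norm_pow_le (by norm_num : 0 < 3)
    (by norm_num : 3 < 4)
  refine ⟨4 * C₂, by positivity, fun w K s hw R hR => ?_⟩
  have hs := hw.pos
  have hK := hw.nonneg
  obtain ⟨i₂, v₂⟩ := h₂ (R / 4) (by positivity)
  have hT : MeasurableSet (norm ⁻¹' Ioi (R / 4) : Set (Sp 3)) := measurable_norm measurableSet_Ioi
  set T : Set (Sp 3) := norm ⁻¹' Ioi (R / 4) with hTd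
  have hbd : ∀ y, ‖farPart R w y‖ ≤ T.indicator (fun y => K * s * ‖y‖⁻¹ ^ 4) y := by
    intro y
    rcases le_or_gt ‖y‖ (R / 4) with hy | hy
    · rw [farPart_of_le hR w hy, norm_zero]
      exact indicator_nonneg (fun y _ => by positivity) y
    · have hyT : y ∈ T := hy
      rw [indicator_of_mem hyT, Real.norm_eq_abs]
      exact (NSFar.abs_farPart_le R w y).trans
        (hw.localBd y (norm_pos_iff.1 (lt_trans (by positivity) hy))).abs_le
  have := norm_integral_le_of_norm_le ((integrable_indicator_iff hT).2 (i₂.const_mul (K * s)))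
    (Filter.Eventually.of_forall hbd)
  rw [Real.norm_eq_abs, integral_indicator hT, integral_const_mul] at this
  calc _ ≤ K * s * (C₂ * ((R / 4) ^ 3 * (R / 4)⁻¹ ^ 4)) := this.trans (by gcongr)
    _ = 4 * C₂ * (K * s * R⁻¹) * (R * R⁻¹) ^ 3 := by rw [inv_div, div_eq_mul_inv]; ring
    _ = _ := by rw [mul_inv_cancel₀ hR.ne', one_pow, mul_one]

/-- In dimension three, the near part contributes the homogeneous kernel times the integral of the
profile. -/
lemma exists_integral_oseenDiv_mul_nearPart_sub_le (j h k : Fin 3) : ∃ C : ℝ, 0 ≤ C ∧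
    ∀ (w : Sp 3 → ℝ) (K s : ℝ), DecayBd w K s → ∀ τ : ℝ, 0 < τ → ∀ x : Sp 3, x ≠ 0 →
      |(∫ y, oseenDiv τ (x - y) j h k * nearPart ‖x‖ w y) - homKernel x j h k * ∫ y, w y|
        ≤ C * K * (s * ‖x‖⁻¹ ^ 5 * Real.log (1 + ‖x‖ / √s) + τ * √s * ‖x‖⁻¹ ^ 6
          + s * ‖x‖⁻¹ ^ 5) := by
  obtain ⟨C, hC, H⟩ := exists_integral_mul_nearPart_le (by norm_num : 0 < 3)
  obtain ⟨C₁, hC₁, h₁⟩ := exists_oseenDiv_sub_le j h k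
  obtain ⟨C₂, hC₂, h₂⟩ := exists_oseenDiv_sub_homKernel_le j h k
  obtain ⟨C₃, hC₃, h₃⟩ := exists_homKernel_le j h k
  obtain ⟨C₄, hC₄, h₄⟩ := exists_integral_norm_le
  obtain ⟨C₅, hC₅, h₅⟩ := exists_integral_farPart_le
  refine ⟨C * C₁ + C₂ * C₄ + C₃ * C₅, by positivity, fun w K s hw τ hτ x hx => ?_⟩
  have hs := hw.pos
  have hK := hw.nonneg
  have hR := norm_pos_iff.2 hx
  have hq : 0 < √s := Real.sqrt_pos.2 hs
  obtain ⟨iw, vw⟩ := h₄ w K s hw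
  have hfar : Integrable (farPart ‖x‖ w) := iw.norm.mono'
    (aestronglyMeasurable_farPart _ hw.measurable)
    (Filter.Eventually.of_forall fun y => NSFar.abs_farPart_le _ w y)
  have hnear : Integrable (nearPart ‖x‖ w) := iw.sub hfar
  have hFn : Integrable fun y => oseenDiv τ (x - y) j h k * nearPart ‖x‖ w y :=
    integrable_oseenDiv_mul hτ j h k x (aestronglyMeasurable_nearPart _ hw.measurable)
      (M := K * s⁻¹) fun y => (NSFar.abs_nearPart_le _ w y).trans (hw.bdd y)
  have hw_eq : ∫ y, w y = (∫ y, nearPart ‖x‖ w y) + ∫ y, farPart ‖x‖ w y := by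
    rw [← integral_add hnear hfar]
    exact integral_congr_ae (Filter.Eventually.of_forall fun y => by simp [nearPart])
  -- Freeze the kernel at `x`, replace it there by its homogeneous limit, and complete the mass of
  -- the near part to the mass of the profile.
  have hsplit : (∫ y, oseenDiv τ (x - y) j h k * nearPart ‖x‖ w y) - homKernel x j h k * ∫ y, w y
      = (∫ y, (oseenDiv τ (x - y) j h k - oseenDiv τ x j h k) * nearPart ‖x‖ w y)
        + (oseenDiv τ x j h k - homKernel x j h k) * (∫ y, nearPart ‖x‖ w y)
        - homKernel x j h k * ∫ y, farPart ‖x‖ w y := by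
    simp_rw [sub_mul (oseenDiv _ _ _ _ _)]
    rw [integral_sub hFn (hnear.const_mul _), integral_const_mul, hw_eq]
    ring
  have e1 : |∫ y, (oseenDiv τ (x - y) j h k - oseenDiv τ x j h k) * nearPart ‖x‖ w y|
      ≤ C * (C₁ * ‖x‖⁻¹ ^ 5 * (K * s)) * Real.log (1 + ‖x‖ / √s) := by
    refine H w K s hw ‖x‖ hR _ _ (by positivity) fun y hy => ?_
    have hn := norm_nonneg y
    have hxy : x - y - x = -y := by abel
    have := h₁ x (x - y) hx (by rw [hxy, norm_neg]; exact hy) τ hτ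
    rw [hxy, norm_neg] at this
    calc _ ≤ C₁ * ‖x‖⁻¹ ^ (3 + 2) * (√s + ‖y‖) * (√s + ‖y‖)⁻¹ ^ 4 := by
          gcongr
          exact this.trans (by gcongr; linarith)
      _ = C₁ * ‖x‖⁻¹ ^ 5 * ((√s + ‖y‖) * (√s + ‖y‖)⁻¹) * (√s + ‖y‖)⁻¹ ^ 3 := by ring
      _ = _ := by rw [mul_inv_cancel₀ (by positivity), mul_one]
  have e2 : |∫ y, nearPart ‖x‖ w y| ≤ C₄ * (K * √s) := by
    rw [← Real.norm_eq_abs]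
    exact (norm_integral_le_of_norm_le iw.norm
      (Filter.Eventually.of_forall fun y => NSFar.abs_nearPart_le _ w y)).trans vw
  have e3 := h₅ w K s hw ‖x‖ hR
  rw [hsplit]
  calc _ ≤ _ + _ * _ + _ * _ :=
        (abs_sub _ _).trans (add_le_add ((abs_add_le _ _).trans
          (add_le_add e1 ((abs_mul _ _).trans_le (mul_le_mul (h₂ x hx τ hτ) e2 (abs_nonneg _)
            (by positivity))))) ((abs_mul _ _).trans_le (mul_le_mul (h₃ x hx) e3 (abs_nonneg _)
            (by positivity))))
    _ = C * C₁ * (K * (s * ‖x‖⁻¹ ^ 5 * Real.log (1 + ‖x‖ / √s)))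
        + C₂ * C₄ * (K * (τ * √s * ‖x‖⁻¹ ^ 6)) + C₃ * C₅ * (K * (s * ‖x‖⁻¹ ^ 5)) := by ring
    _ ≤ _ := by
        have hl : 0 ≤ Real.log (1 + ‖x‖ / √s) :=
          Real.log_nonneg (le_add_of_nonneg_right (by positivity))
        have n1 : 0 ≤ K * (s * ‖x‖⁻¹ ^ 5 * Real.log (1 + ‖x‖ / √s)) := by positivity
        have n2 : 0 ≤ K * (τ * √s * ‖x‖⁻¹ ^ 6) := by positivity
        have n3 : 0 ≤ K * (s * ‖x‖⁻¹ ^ 5) := by positivity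
        have m1 : 0 ≤ C * C₁ := by positivity
        have m2 : 0 ≤ C₂ * C₄ := by positivity
        have m3 : 0 ≤ C₃ * C₅ := by positivity
        nlinarith [mul_nonneg m1 n2, mul_nonneg m1 n3, mul_nonneg m2 n1, mul_nonneg m2 n3,
          mul_nonneg m3 n1, mul_nonneg m3 n2]

end DecayBd

/-! ### The remainder as a function of the intermediate time -/

/-- The common majorant, as a function of the intermediate time `s`, of all the terms in the
expansion at time `t` and distance `R` from the origin. The integrable singularity at `s = t`
dominates the logarithm `log (t / (t - s))` coming from the far part. -/
noncomputable def timeMajorant (R t s : ℝ) : ℝ :=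
  t * R⁻¹ ^ 5 * (Real.log (R / √t) + √t / √(t - s))

section

variable {R t s : ℝ}

lemma one_le_log_div_sqrt (ht : 0 < t) (hR : Real.exp 1 * √t ≤ R) : 1 ≤ Real.log (R / √t) := by
  have hq : 0 < √t := Real.sqrt_pos.2 ht
  rw [Real.le_log_iff_exp_le (div_pos ((by positivity : 0 < Real.exp 1 * √t).trans_le hR) hq),
    le_div_iff₀ hq]
  exact hR

lemma sqrt_le_of_exp_mul_le (hR : Real.exp 1 * √t ≤ R) : √t ≤ R := by
  refine le_trans ?_ hR
  have := Real.add_one_le_exp 1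
  nlinarith [Real.sqrt_nonneg t]

/-- Positivity facts in the regime `0 < s < t`, `e √t ≤ R`. -/
lemma timeMajorant_aux (hs : 0 < s) (hst : s < t) (hR : Real.exp 1 * √t ≤ R) :
    0 < R ∧ 0 < t - s ∧ 0 < √t / √(t - s) ∧ 0 ≤ timeMajorant R t s := by
  have ht : 0 < t := hs.trans hst
  have hq : 0 < √t := Real.sqrt_pos.2 ht
  have hτ : 0 < t - s := by linarith
  have hr : 0 < √(t - s) := Real.sqrt_pos.2 hτ
  have hR0 : 0 < R := hq.trans_le (sqrt_le_of_exp_mul_le hR)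
  have hl := one_le_log_div_sqrt ht hR
  refine ⟨hR0, hτ, by positivity, ?_⟩
  unfold timeMajorant
  have : 0 ≤ Real.log (R / √t) := by linarith
  positivity

lemma mul_log_far_le (hs : 0 < s) (hst : s < t) (hR : Real.exp 1 * √t ≤ R) :
    s * R⁻¹ ^ 5 * (1 + Real.log (1 + R ^ 2 / (t - s))) ≤ 4 * timeMajorant R t s := by
  obtain ⟨hR0, hτ, hp, -⟩ := timeMajorant_aux hs hst hR
  have ht : 0 < t := hs.trans hst
  have hq : 0 < √t := Real.sqrt_pos.2 ht
  have hr : 0 < √(t - s) := Real.sqrt_pos.2 hτ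
  have hl := one_le_log_div_sqrt ht hR
  have hRt := sqrt_le_of_exp_mul_le hR
  have hRt' : 1 ≤ R / √t := (one_le_div hq).2 hRt
  have e1 : (1 : ℝ) + R ^ 2 / (t - s) ≤ 2 * (R / √t) ^ 2 * (√t / √(t - s)) ^ 2 := by
    have h1 : 1 ≤ √t / √(t - s) := (one_le_div hr).2 (Real.sqrt_le_sqrt (by linarith))
    have h2 : (R / √t) ^ 2 * (√t / √(t - s)) ^ 2 = R ^ 2 / (t - s) := by
      rw [← mul_pow, div_mul_div_cancel₀ hq.ne', div_pow, Real.sq_sqrt hτ.le]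
    have h3 : 1 ≤ (R / √t) ^ 2 * (√t / √(t - s)) ^ 2 :=
      one_le_mul_of_one_le_of_one_le (one_le_pow₀ hRt') (one_le_pow₀ h1)
    linarith
  have e2 : Real.log (1 + R ^ 2 / (t - s)) ≤ 1 + 2 * Real.log (R / √t) + 2 * (√t / √(t - s)) := by
    refine (Real.log_le_log (by positivity) e1).trans ?_
    rw [Real.log_mul (by positivity) (by positivity), Real.log_mul (by positivity) (by positivity),
      Real.log_pow, Real.log_pow]
    have := Real.log_le_sub_one_of_pos (by norm_num : (0 : ℝ) < 2)
    have := Real.log_le_sub_one_of_pos hp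
    push_cast
    linarith
  have e3 : 0 ≤ Real.log (1 + R ^ 2 / (t - s)) :=
    Real.log_nonneg (le_add_of_nonneg_right (by positivity))
  unfold timeMajorant
  calc _ ≤ t * R⁻¹ ^ 5 * (4 * (Real.log (R / √t) + √t / √(t - s))) := by gcongr; linarith
    _ = _ := by ring

lemma mul_log_near_le (hs : 0 < s) (hst : s < t) (hR : Real.exp 1 * √t ≤ R) :
    s * R⁻¹ ^ 5 * Real.log (1 + R / √s) ≤ 3 * timeMajorant R t s := by
  obtain ⟨hR0, hτ, hp, -⟩ := timeMajorant_aux hs hst hR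
  have ht : 0 < t := hs.trans hst
  have hq : 0 < √t := Real.sqrt_pos.2 ht
  have hr : 0 < √s := Real.sqrt_pos.2 hs
  have hl := one_le_log_div_sqrt ht hR
  have hRt' : 1 ≤ R / √t := (one_le_div hq).2 (sqrt_le_of_exp_mul_le hR)
  have hst' : √s ≤ √t := Real.sqrt_le_sqrt hst.le
  have e1 : 1 + R / √s ≤ 2 * (R / √t) * (√t / √s) := by
    have h1 : 1 ≤ √t / √s := (one_le_div hr).2 hst'
    have h2 : R / √t * (√t / √s) = R / √s := div_mul_div_cancel₀ hq.ne'
    have h3 : 1 ≤ R / √t * (√t / √s) := one_le_mul_of_one_le_of_one_le hRt' h1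
    linarith
  have e2 : Real.log (1 + R / √s) ≤ 2 * Real.log (R / √t) + √t / √s := by
    refine (Real.log_le_log (by positivity) e1).trans ?_
    rw [Real.log_mul (by positivity) (by positivity), Real.log_mul (by positivity) (by positivity)]
    have := Real.log_le_sub_one_of_pos (by norm_num : (0 : ℝ) < 2)
    have := Real.log_le_sub_one_of_pos (by positivity : 0 < √t / √s)
    linarith
  have e3 : s * (√t / √s) ≤ t := by
    calc s * (√t / √s) = s / √s * √t := by ring
      _ ≤ √t * √t := by rw [Real.div_sqrt]; gcongr
      _ = t := Real.mul_self_sqrt ht.le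
  have hl0 : 0 ≤ Real.log (R / √t) := by linarith
  unfold timeMajorant
  calc _ ≤ s * R⁻¹ ^ 5 * (2 * Real.log (R / √t) + √t / √s) := by gcongr
    _ = R⁻¹ ^ 5 * (s * (2 * Real.log (R / √t)) + s * (√t / √s)) := by ring
    _ ≤ R⁻¹ ^ 5 * (t * (2 * Real.log (R / √t)) + t * 1) := by
        have : s * (2 * Real.log (R / √t)) ≤ t * (2 * Real.log (R / √t)) := by gcongr
        exact mul_le_mul_of_nonneg_left (by linarith) (by positivity)
    _ ≤ R⁻¹ ^ 5 * (t * (2 * Real.log (R / √t)) + t * (Real.log (R / √t) + 3 * (√t / √(t - s)))) := by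
        gcongr; linarith
    _ = _ := by ring

lemma mul_sqrt_le_timeMajorant (hs : 0 < s) (hst : s < t) (hR : Real.exp 1 * √t ≤ R) :
    (t - s) * √s * R⁻¹ ^ 6 + s * R⁻¹ ^ 5 ≤ 2 * timeMajorant R t s := by
  obtain ⟨hR0, hτ, hp, -⟩ := timeMajorant_aux hs hst hR
  have ht : 0 < t := hs.trans hst
  have hl := one_le_log_div_sqrt ht hR
  have hsR : √s ≤ R := (Real.sqrt_le_sqrt hst.le).trans (sqrt_le_of_exp_mul_le hR)
  unfold timeMajorant
  calc (t - s) * √s * R⁻¹ ^ 6 + s * R⁻¹ ^ 5 ≤ t * R * R⁻¹ ^ 6 + t * R⁻¹ ^ 5 := by gcongr; linarith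
    _ = t * R⁻¹ ^ 5 * ((R * R⁻¹) + 1) := by ring
    _ = 2 * (t * R⁻¹ ^ 5 * 1) := by rw [mul_inv_cancel₀ hR0.ne']; ring
    _ ≤ _ := by gcongr; linarith

lemma integral_timeMajorant_le (ht : 0 < t) (hR : Real.exp 1 * √t ≤ R) :
    IntegrableOn (timeMajorant R t) (Ioc 0 t) ∧
      ∫ s in Ioc 0 t, timeMajorant R t s ≤ 3 * (t ^ 2 / R ^ 5 * Real.log (R / √t)) := by
  have hq : 0 < √t := Real.sqrt_pos.2 ht
  have hR0 : 0 < R := hq.trans_le (sqrt_le_of_exp_mul_le hR)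
  have hl := one_le_log_div_sqrt ht hR
  obtain ⟨i, v⟩ := integrableOn_time_near (p := 1) (by norm_num) hq
  rw [Real.sq_sqrt ht.le] at i v
  simp only [pow_one] at i v
  have i1 : IntervalIntegrable (fun r => √t / √r) volume 0 t :=
    (intervalIntegrable_iff_integrableOn_Ioc_of_le ht.le).2 i
  have i2 : IntegrableOn (fun s => √t / √(t - s)) (Ioc 0 t) := by
    have := (i1.comp_sub_left t).symm
    rw [sub_self, sub_zero] at this
    exact (intervalIntegrable_iff_integrableOn_Ioc_of_le ht.le).1 this
  have v2 : ∫ s in Ioc 0 t, √t / √(t - s) = 2 * t := by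
    have := intervalIntegral.integral_comp_sub_left (a := 0) (b := t) (fun r => √t / √r) t
    rw [sub_self, sub_zero, intervalIntegral.integral_of_le ht.le,
      intervalIntegral.integral_of_le ht.le, v] at this
    rw [this]; norm_num
  have i3 : IntegrableOn (fun _ : ℝ => Real.log (R / √t)) (Ioc 0 t) := by simp
  unfold timeMajorant
  refine ⟨(i3.add i2).const_mul _, ?_⟩
  rw [integral_const_mul, integral_add i3 i2, v2, setIntegral_const,
    Real.volume_real_Ioc_of_le ht.le, sub_zero, smul_eq_mul]
  calc t * R⁻¹ ^ 5 * (t * Real.log (R / √t) + 2 * t)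
      ≤ t * R⁻¹ ^ 5 * (t * Real.log (R / √t) + 2 * t * Real.log (R / √t)) := by
        exact mul_le_mul_of_nonneg_left (by nlinarith) (by positivity)
    _ = _ := by rw [inv_pow, div_eq_mul_inv]; ring

end

/-! ### The asymptotic expansion -/

lemma FlowBd.exists_decayBd_defect (H : FlowBd a u A U) : ∃ K : ℝ, 0 ≤ K ∧ ∀ s, 0 < s →
    VelocityBd u U s → ∀ h k : Fin d, DecayBd (defect a u h k s) K s := by
  obtain ⟨K, hK, h⟩ := H.exists_defect_le
  exact ⟨K, hK, fun s hs hV i k => ⟨hs, hK, H.measurable_defect_right hV i k, (h s hs hV i k).1,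
    (h s hs hV i k).2⟩⟩

lemma DecayBd.integral_oseenDiv_mul_eq {w : Sp d → ℝ} {K s τ : ℝ} (hw : DecayBd w K s) (hτ : 0 < τ)
    (x : Sp d) (R : ℝ) (j h k : Fin d) :
    ∫ y, oseenDiv τ (x - y) j h k * w y
      = (∫ y, oseenDiv τ (x - y) j h k * nearPart R w y)
        + ∫ y, oseenDiv τ (x - y) j h k * farPart R w y := by
  rw [← integral_add]
  · simp_rw [← mul_add, nearPart, sub_add_cancel]
  · exact integrable_oseenDiv_mul hτ j h k x (aestronglyMeasurable_nearPart _ hw.measurable)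
      (M := K * s⁻¹) fun y => (NSFar.abs_nearPart_le _ w y).trans (hw.bdd y)
  · exact integrable_oseenDiv_mul hτ j h k x (aestronglyMeasurable_farPart _ hw.measurable)
      (M := K * s⁻¹) fun y => (NSFar.abs_farPart_le _ w y).trans (hw.bdd y)

/-- In dimension at least four, the kernel acting on the defect is negligible. -/
lemma FlowBd.exists_integral_oseenDiv_defect_le (H : FlowBd a u A U) (hd : 4 ≤ d) (j h k : Fin d) :
    ∃ C : ℝ, 0 ≤ C ∧ ∀ t s, 0 < s → s < t → VelocityBd u U s → ∀ x : Sp d,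
      Real.exp 1 * √t ≤ ‖x‖ →
      |∫ y, oseenDiv (t - s) (x - y) j h k * defect a u h k s y| ≤ C * timeMajorant ‖x‖ t s := by
  obtain ⟨K, hK, hD⟩ := H.exists_decayBd_defect
  obtain ⟨C₁, hC₁, h₁⟩ := DecayBd.exists_integral_oseenDiv_mul_nearPart_le hd j h k
  obtain ⟨C₂, hC₂, h₂⟩ := DecayBd.exists_integral_oseenDiv_mul_farPart_le j h k
  refine ⟨C₁ * K * 3 + C₂ * K * 4, by positivity, fun t s hs hst hV x hx => ?_⟩
  obtain ⟨hR, hτ, -, -⟩ := timeMajorant_aux hs hst hx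
  have hw := hD s hs hV h k
  have hx0 := norm_pos_iff.1 hR
  have hsR : √s ≤ ‖x‖ := (Real.sqrt_le_sqrt hst.le).trans (sqrt_le_of_exp_mul_le hx)
  rw [hw.integral_oseenDiv_mul_eq hτ x ‖x‖]
  calc _ ≤ _ + _ := (abs_add_le _ _).trans
        (add_le_add (h₁ _ K s hw _ hτ x hx0 hsR) (h₂ _ K s hw _ hτ x hx0))
    _ = C₁ * K * (s * ‖x‖⁻¹ ^ 5 * Real.log (1 + ‖x‖ / √s))
        + C₂ * K * (s * ‖x‖⁻¹ ^ 5 * (1 + Real.log (1 + ‖x‖ ^ 2 / (t - s)))) := by ring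
    _ ≤ C₁ * K * (3 * timeMajorant ‖x‖ t s) + C₂ * K * (4 * timeMajorant ‖x‖ t s) :=
        add_le_add (mul_le_mul_of_nonneg_left (mul_log_near_le hs hst hx) (by positivity))
          (mul_le_mul_of_nonneg_left (mul_log_far_le hs hst hx) (by positivity))
    _ = _ := by ring

/-- In dimension three, the kernel acting on the defect is the homogeneous kernel times the mass of
the defect, up to a negligible term. -/
lemma FlowBd.exists_integral_oseenDiv_defect_sub_le {a : Sp 3 → Sp 3} {u : ℝ → Sp 3 → Sp 3}
    (H : FlowBd a u A U) (j h k : Fin 3) :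
    ∃ C : ℝ, 0 ≤ C ∧ ∀ t s, 0 < s → s < t → VelocityBd u U s → ∀ x : Sp 3,
      Real.exp 1 * √t ≤ ‖x‖ →
      |(∫ y, oseenDiv (t - s) (x - y) j h k * defect a u h k s y)
        - homKernel x j h k * ∫ y, defect a u h k s y| ≤ C * timeMajorant ‖x‖ t s := by
  obtain ⟨K, hK, hD⟩ := H.exists_decayBd_defect
  obtain ⟨C₁, hC₁, h₁⟩ := DecayBd.exists_integral_oseenDiv_mul_nearPart_sub_le j h k
  obtain ⟨C₂, hC₂, h₂⟩ := DecayBd.exists_integral_oseenDiv_mul_farPart_le j h k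
  refine ⟨C₁ * K * 5 + C₂ * K * 4, by positivity, fun t s hs hst hV x hx => ?_⟩
  obtain ⟨hR, hτ, -, -⟩ := timeMajorant_aux hs hst hx
  have hw := hD s hs hV h k
  have hx0 := norm_pos_iff.1 hR
  rw [hw.integral_oseenDiv_mul_eq hτ x ‖x‖, add_sub_right_comm]
  calc _ ≤ _ + _ := (abs_add_le _ _).trans
        (add_le_add (h₁ _ K s hw _ hτ x hx0) (h₂ _ K s hw _ hτ x hx0))
    _ = C₁ * K * (s * ‖x‖⁻¹ ^ 5 * Real.log (1 + ‖x‖ / √s)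
          + ((t - s) * √s * ‖x‖⁻¹ ^ 6 + s * ‖x‖⁻¹ ^ 5))
        + C₂ * K * (s * ‖x‖⁻¹ ^ 5 * (1 + Real.log (1 + ‖x‖ ^ 2 / (t - s)))) := by ring
    _ ≤ C₁ * K * (3 * timeMajorant ‖x‖ t s + 2 * timeMajorant ‖x‖ t s)
        + C₂ * K * (4 * timeMajorant ‖x‖ t s) :=
        add_le_add
          (mul_le_mul_of_nonneg_left (add_le_add (mul_log_near_le hs hst hx)
            (mul_sqrt_le_timeMajorant hs hst hx)) (by positivity))
          (mul_le_mul_of_nonneg_left (mul_log_far_le hs hst hx) (by positivity))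
    _ = _ := by ring

/-- The mass of the defect is integrable in time, with the bound `O(t^{3/2})` for its integral. -/
lemma FlowBd.exists_integral_defect_le {a : Sp 3 → Sp 3} {u : ℝ → Sp 3 → Sp 3}
    (H : FlowBd a u A U) : ∃ C : ℝ, 0 ≤ C ∧ ∀ t, 0 < t → ∀ h k : Fin 3,
      IntegrableOn (fun s => ∫ y, defect a u h k s y) (Ioc 0 t) ∧
        |∫ s in Ioc 0 t, ∫ y, defect a u h k s y| ≤ C * t ^ (3 / 2 : ℝ) := by
  obtain ⟨K, hK, hD⟩ := H.exists_decayBd_defect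
  obtain ⟨C, hC, h₁⟩ := DecayBd.exists_integral_norm_le
  refine ⟨C * K, by positivity, fun t ht h k => ?_⟩
  have hbd : ∀ᵐ s ∂(volume.restrict (Ioc 0 t)), ‖∫ y, defect a u h k s y‖ ≤ C * (K * √t) := by
    filter_upwards [H.velocity_Ioc t] with s hs
    refine (norm_integral_le_integral_norm _).trans
      ((h₁ _ K s (hD s hs.1 hs.2.2 h k)).2.trans ?_)
    gcongr
    exact hs.2.1.le
  refine ⟨(integrable_const (C * (K * √t))).mono' (H.measurable_defect t h k).integral_prod_right'
    hbd, ?_⟩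
  have := norm_setIntegral_le_of_norm_le_const_ae (by simp) hbd
  rw [Real.volume_real_Ioc_of_le ht.le, sub_zero] at this
  refine this.trans (le_of_eq ?_)
  rw [show (3 / 2 : ℝ) = 1 + 1 / 2 by norm_num, Real.rpow_add ht, Real.rpow_one,
    ← Real.sqrt_eq_rpow]
  ring

lemma norm_le_sum_abs (v : Sp d) : ‖v‖ ≤ ∑ j, |v j| := by
  have : v = ∑ j, EuclideanSpace.single j (v j) := by
    ext i
    simp [Finset.sum_apply]
  calc ‖v‖ = ‖∑ j, EuclideanSpace.single j (v j)‖ := by rw [← this]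
    _ ≤ ∑ j, ‖EuclideanSpace.single j (v j)‖ := norm_sum_le _ _
    _ = _ := by simp

/-- Since the semigroup property turns the Duhamel term of the heat extension of `a ⊗ a` into
`t e^{tΔ} P∇·(a ⊗ a)`, the remainder in the expansion is the time integral of the Oseen kernel
acting on the defect, less the multiple `e` of the homogeneous kernel (which is zero if `d ≥ 4`). -/
lemma FlowBd.norm_sub_le (H : FlowBd a u A U) {t : ℝ} (ht : 0 < t) {x : Sp d}
    (hx : Real.exp 1 * √t ≤ ‖x‖) {e : Fin d → Fin d → ℝ → ℝ}
    (he : ∀ h k, IntegrableOn (e h k) (Ioc 0 t)) {C : Fin d → Fin d → Fin d → ℝ}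
    (hC : ∀ j h k s, 0 < s → s < t → VelocityBd u U s →
      |(∫ y, oseenDiv (t - s) (x - y) j h k * defect a u h k s y) - homKernel x j h k * e h k s|
        ≤ C j h k * timeMajorant ‖x‖ t s) (hC0 : ∀ j h k, 0 ≤ C j h k) :
    ‖u t x - (heat t a x - t • heatLerayDiv t (fun y => outer (a y) (a y)) x
        - contract (homKernel x) (Matrix.of fun h k => ∫ s in Ioc 0 t, e h k s))‖
      ≤ (∑ j, ∑ h, ∑ k, C j h k * 3) * (t ^ 2 / ‖x‖ ^ 5 * Real.log (‖x‖ / √t)) := by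
  have hx0 : x ≠ 0 :=
    norm_pos_iff.1 ((Real.sqrt_pos.2 ht).trans_le (sqrt_le_of_exp_mul_le hx))
  obtain ⟨_, _, hdu⟩ := FlowBd.exists_localBd_duhamel d
  obtain ⟨im, vm⟩ := integral_timeMajorant_le ht hx
  set J : Fin d → Fin d → Fin d → ℝ := fun j h k =>
    ∫ y, oseenDiv t (x - y) j h k * (a y h * a y k) with hJ
  have hterm : ∀ j h k, |(∫ s in Ioc 0 t, duhamel u j h k t s x) - t * J j h k
      - homKernel x j h k * ∫ s in Ioc 0 t, e h k s|
        ≤ C j h k * 3 * (t ^ 2 / ‖x‖ ^ 5 * Real.log (‖x‖ / √t)) := by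
    intro j h k
    have i1 := (hdu a u A U H j h k t ht).2 x hx0
    have i2 : IntegrableOn (fun _ : ℝ => J j h k) (Ioc 0 t) := by simp
    have i12 : IntegrableOn (fun s => duhamel u j h k t s x - J j h k) (Ioc 0 t) := i1.sub i2
    have i3 := (he h k).const_mul (homKernel x j h k)
    have e1 : (∫ s in Ioc 0 t, duhamel u j h k t s x) - t * J j h k
        - homKernel x j h k * ∫ s in Ioc 0 t, e h k s
        = ∫ s in Ioc 0 t, (duhamel u j h k t s x - J j h k - homKernel x j h k * e h k s) := by
      rw [integral_sub i12 i3, integral_sub i1 i2, setIntegral_const,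
        Real.volume_real_Ioc_of_le ht.le, sub_zero, smul_eq_mul, integral_const_mul]
    rw [e1, ← Real.norm_eq_abs]
    refine (norm_integral_le_of_norm_le (im.const_mul (C j h k)) ?_).trans ?_
    · filter_upwards [H.velocity_Ioc t] with s hs
      have := hC j h k s hs.1 hs.2.1 hs.2.2
      rwa [H.integral_oseenDiv_defect hs.1 hs.2.1 hs.2.2] at this
    · rw [integral_const_mul, mul_assoc]
      exact mul_le_mul_of_nonneg_left vm (hC0 j h k)
  refine (norm_le_sum_abs _).trans ?_
  rw [Finset.sum_mul]
  refine Finset.sum_le_sum fun j _ => ?_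
  have ej : (u t x - (heat t a x - t • heatLerayDiv t (fun y => outer (a y) (a y)) x
        - contract (homKernel x) (Matrix.of fun h k => ∫ s in Ioc 0 t, e h k s))) j
      = -∑ h, ∑ k, ((∫ s in Ioc 0 t, duhamel u j h k t s x) - t * J j h k
          - homKernel x j h k * ∫ s in Ioc 0 t, e h k s) := by
    have c1 : contract (homKernel x) (Matrix.of fun h k => ∫ s in Ioc 0 t, e h k s) j
        = ∑ h, ∑ k, homKernel x j h k * ∫ s in Ioc 0 t, e h k s := rfl
    have c2 := heatLerayDiv_outer_apply (v := a)
      (fun j h k => H.integrable_oseenDiv_datum ht hx0 j h k) j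
    simp only [PiLp.sub_apply, PiLp.smul_apply, smul_eq_mul]
    rw [H.velocity_eq ht hx0 j, c1, c2]
    simp only [Finset.sum_sub_distrib, Finset.mul_sum, hJ]
    ring
  rw [ej, abs_neg, Finset.sum_mul]
  refine (Finset.abs_sum_le_sum_abs _ _).trans (Finset.sum_le_sum fun h _ => ?_)
  rw [Finset.sum_mul]
  exact (Finset.abs_sum_le_sum_abs _ _).trans (Finset.sum_le_sum fun k _ => hterm j h k)

end NSFar

theorem theorem8 (d : ℕ) (hd : 3 ≤ d)
    (a : Sp d → Sp d) (ha : MemE 3 1 a)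
    (u : ℝ → Sp d → Sp d) (hu : MemX 3 1 u) (hsol : IsMildSolution a u) :
    (d = 3 →
      ∃ (Λ : ℝ → Matrix (Fin d) (Fin d) ℝ) (C : ℝ),
        (∀ t : ℝ, 0 < t → ∀ h k : Fin d, |Λ t h k| ≤ C * t ^ (3 / 2 : ℝ)) ∧
        ∀ t : ℝ, 0 < t → ∀ x : Sp d, Real.exp 1 * √t ≤ ‖x‖ →
          ‖u t x - (heat t a x - t • heatLerayDiv t (fun y => outer (a y) (a y)) x
              - contract (homKernel x) (Λ t))‖
            ≤ C * (t ^ 2 / ‖x‖ ^ 5 * Real.log (‖x‖ / √t))) ∧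
    (4 ≤ d →
      ∃ C : ℝ, ∀ t : ℝ, 0 < t → ∀ x : Sp d, Real.exp 1 * √t ≤ ‖x‖ →
          ‖u t x - (heat t a x - t • heatLerayDiv t (fun y => outer (a y) (a y)) x)‖
            ≤ C * (t ^ 2 / ‖x‖ ^ 5 * Real.log (‖x‖ / √t))) := by
  obtain ⟨A, U, H⟩ := exists_flowBd hd ha hu hsol
  constructor
  · rintro rfl
    obtain ⟨C₀, hC₀, h₀⟩ := H.exists_integral_defect_le
    choose C hC hI using fun j h k => H.exists_integral_oseenDiv_defect_sub_le j h k
    refine ⟨fun t => Matrix.of fun h k => ∫ s in Ioc 0 t, ∫ y, defect a u h k s y,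
      max C₀ (∑ j, ∑ h, ∑ k, C j h k * 3), fun t ht h k => ?_, fun t ht x hx => ?_⟩
    · refine ((h₀ t ht h k).2).trans ?_
      gcongr
      exact le_max_left _ _
    · have hl := one_le_log_div_sqrt ht hx
      have hl0 : 0 ≤ Real.log (‖x‖ / √t) := by linarith
      refine (H.norm_sub_le ht hx (e := fun h k s => ∫ y, defect a u h k s y)
        (fun h k => (h₀ t ht h k).1) (C := C)
        (fun j h k s hs hst hV => hI j h k t s hs hst hV x hx) hC).trans ?_
      gcongr
      exact le_max_right _ _
  · intro hd4
    choose C hC hI using fun j h k => H.exists_integral_oseenDiv_defect_le hd4 j h k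
    refine ⟨∑ j, ∑ h, ∑ k, C j h k * 3, fun t ht x hx => ?_⟩
    have := H.norm_sub_le ht hx (e := fun _ _ _ => 0) (fun h k => integrableOn_zero) (C := C)
      (fun j h k s hs hst hV => by simpa using hI j h k t s hs hst hV x hx) hC
    have hz : contract (homKernel x) (Matrix.of fun _ _ => ∫ _ in Ioc 0 t, (0 : ℝ)) = 0 := by
      ext j
      simp [contract]
    rwa [hz, sub_zero] at this
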